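/- Let $\mathcal C$ be a class of C*-algebras each of which is isomorphic to a finite direct sum of semiprojective simple C*-algebras. Let $X$ be a nonempty finite-dimensional compact metrizable space ($\dim X$ denotes covering dimension) and let $A$ be a separable continuous $C(X)$-algebra, that is, a separable C*-algebra with a $*$-homomorphism $\theta$ from $C(X)$ to the center of the multiplier algebra $M(A)$ such that $\theta(C(X))A$ is dense in $A$, and such that $x\mapsto\|a(x)\|$ is continuous for every $a\in A$; here, for $Y\subseteq X$ closed, $A(Y)$ denotes the quotient of $A$ by the ideal $C(X,Y)A$ generated by the functions vanishing on $Y$, a $C(Y)$-algebra with quotient map $\pi_Y:A\to A(Y)$; $A(x)=A(\{x\})$ is the fiber at $x$, and $a(x)=\pi_{\{x\}}(a)$. Suppose that every fiber $A(x)$ admits an exhaustive sequence of C*-algebras in $\mathcal C$: there is a sequence $(S_n)$ of C*-subalgebras of $A(x)$, each isomorphic to a C*-algebra in $\mathcal C$, such that for every finite set $F\subset A(x)$ and every $\varepsilon>0$ there is $n$ with $\operatorname{dist}(a,S_n)<\varepsilon$ for all $a\in F$. Then $A$ is isomorphic, as a $C(X)$-algebra, to the inductive limit of a sequence $A_1\to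 A_2\to\cdots$ of continuous $C(X)$-algebras with $C(X)$-linear connecting $*$-homomorphisms, such that $\operatorname{cat}_{\mathcal C}(A_k)\le\dim X$ for all $k$. Here a separable nonzero C*-algebra $D$ is semiprojective if for every separable C*-algebra $B$ and every increasing sequence of closed two-sided ideals $J_n$ of $B$ with $J=\overline{\bigcup_n J_n}$, every $*$-homomorphism $D\to B/J$ lifts to a $*$-homomorphism $D\to B/J_n$ for some $n$. A $C(Z)$-algebra $E$ is $\mathcal C$-elementary if $E\cong\bigoplus_{i=1}^r C(Z_i)\otimes D_i$ as $C(Z)$-algebras for some finite partition of $Z$ into closed sets $Z_1,\dots,Z_r$ ($r\ge1$) and some $D_1,\dots,D_r\in\mathcal C$. The category $\operatorname{cat}_{\mathcal C}(A)\in\{0,1,\dots,\infty\}$ of a $C(X)$-algebra $A$ is defined inductively: $\operatorname{cat}_{\mathcal C}(A)=0$ if $A$ is $\mathcal C$-elementary; and $\operatorname{cat}_{\mathcal C}(A)\le n$ if there are closed sets $Y,Z$ with $X=Y\cup Z$, a $C(Y)$-algebra $B$ with $\operatorname{cat}_{\mathcal C}(B)\le n-1$, a $\mathcal C$-elementary $C(Z)$-algebra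 $E$ and an injective $*$-homomorphism of $C(Y\cap Z)$-algebras $\gamma:E(Y\cap Z)\to B(Y\cap Z)$ such that $A$ is isomorphic, as a $C(X)$-algebra, to $\{(b,e)\in B\oplus E:\ \pi_{Y\cap Z}(b)=\gamma(\pi_{Y\cap Z}(e))\}$. -/

import Mathlib

open Topology Filter
open scoped MultiplierAlgebra CStarAlgebra

universe u

/-- Closed two-sided ideals of a C⋆-algebra. -/
structure ClosedIdeal (A : Type u) [NonUnitalCStarAlgebra A] extends Submodule ℂ A where
  mul_mem_left' : ∀ (a : A) {j : A}, j ∈ carrier → a * j ∈ carrier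
  mul_mem_right' : ∀ {j : A} (a : A), j ∈ carrier → j * a ∈ carrier
  isClosed' : IsClosed carrier

namespace ClosedIdeal

variable {A : Type u} [NonUnitalCStarAlgebra A]

instance : SetLike (ClosedIdeal A) A where
  coe J := J.carrier
  coe_injective J K h := by
    cases J; cases K; congr; exact SetLike.coe_injective h

theorem mul_mem_left (J : ClosedIdeal A) (a : A) {j : A} (hj : j ∈ J) : a * j ∈ J :=
  J.mul_mem_left' a hj

theorem mul_mem_right (J : ClosedIdeal A) {j : A} (a : A) (hj : j ∈ J) : j * a ∈ J :=
  J.mul_mem_right' a hj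

theorem isClosed (J : ClosedIdeal A) : IsClosed (J : Set A) := J.isClosed'

instance : AddSubgroupClass (ClosedIdeal A) A where
  add_mem {J} := J.toSubmodule.add_mem
  zero_mem J := J.toSubmodule.zero_mem
  neg_mem {J} := J.toSubmodule.neg_mem

theorem smul_mem (J : ClosedIdeal A) (c : ℂ) {j : A} (hj : j ∈ J) : c • j ∈ J :=
  J.toSubmodule.smul_mem c hj

/-- The C⋆-subalgebra `J ∩ J⋆`. -/
def selfStar (J : ClosedIdeal A) : NonUnitalStarSubalgebra ℂ A where
  carrier := {a | a ∈ J ∧ star a ∈ J}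
  add_mem' ha hb := ⟨add_mem ha.1 hb.1, by simpa using add_mem ha.2 hb.2⟩
  zero_mem' := ⟨zero_mem J, by simp⟩
  mul_mem' {a b} ha hb := ⟨J.mul_mem_left a hb.1, by simpa using J.mul_mem_right _ hb.2⟩
  smul_mem' c a ha := ⟨J.smul_mem c ha.1, by simpa using J.smul_mem _ ha.2⟩
  star_mem' ha := ⟨ha.2, by simpa using ha.1⟩

theorem norm_sub_mul_le {e b : A} (he : e = star b * b) (h1 : ‖e‖ ≤ 1) (x : A) :
    ‖x - x * e‖ ≤ ‖x‖ := by
  let _ := CStarAlgebra.spectralOrder (Unitization ℂ A)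
  have _ := CStarAlgebra.spectralOrderedRing (Unitization ℂ A)
  have h0 : (0 : Unitization ℂ A) ≤ (e : Unitization ℂ A) := by
    rw [he]; simp
  have h2 : (e : Unitization ℂ A) ≤ 1 := by
    rw [← CStarAlgebra.norm_le_one_iff_of_nonneg _ h0, Unitization.norm_inr]; exact h1
  have h3 : ‖(1 : Unitization ℂ A) - e‖ ≤ 1 := by
    rw [CStarAlgebra.norm_le_one_iff_of_nonneg _ (sub_nonneg.2 h2)]
    simpa using h0
  have h4 : ((x - x * e : A) : Unitization ℂ A) = x * (1 - e) := by
    rw [mul_sub, mul_one, Unitization.inr_sub, Unitization.inr_mul]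
  rw [← Unitization.norm_inr (𝕜 := ℂ), h4]
  refine (norm_mul_le _ _).trans ?_
  rw [Unitization.norm_inr]
  exact mul_le_of_le_one_right (norm_nonneg _) h3

theorem exists_approx (J : ClosedIdeal A) {j : A} (h : star j * j ∈ J) {ε : ℝ} (hε : 0 < ε) :
    ∃ e ∈ J, star e = e ∧ ‖j - j * e‖ < ε ∧ ∀ x : A, ‖x - x * e‖ ≤ ‖x‖ := by
  have hcl : IsClosed (J.selfStar : Set A) :=
    J.isClosed.inter (J.isClosed.preimage continuous_star)
  let _ : NonUnitalCStarAlgebra J.selfStar :=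
    NonUnitalStarSubalgebra.nonUnitalCStarAlgebra (h_closed := hcl) J.selfStar
  let _ := CStarAlgebra.spectralOrder J.selfStar
  have _ := CStarAlgebra.spectralOrderedRing J.selfStar
  have hk : star j * j ∈ J.selfStar := ⟨h, by simpa using h⟩
  have hu := CStarAlgebra.increasingApproximateUnit J.selfStar
  have ht := hu.tendsto_mul_left ⟨_, hk⟩
  have hev := Metric.tendsto_nhds.1 ht (ε ^ 2 / 2) (by positivity)
  obtain ⟨e, h1, h2, h3⟩ := (hev.and (hu.eventually_nonneg.and hu.eventually_norm)).exists
  obtain ⟨b, hb⟩ := CStarAlgebra.nonneg_iff_eq_star_mul_self.1 h2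
  have hb' : (e : A) = star (b : A) * b := congrArg Subtype.val hb
  have hse : star (e : A) = e := by rw [hb']; simp
  have hx := norm_sub_mul_le (A := A) hb' h3
  refine ⟨e, e.2.1, hse, ?_, hx⟩
  have h1' : ‖star j * j - star j * j * e‖ < ε ^ 2 / 2 := by
    rw [dist_comm, dist_eq_norm] at h1; exact h1
  have h3' : ‖(e : A)‖ ≤ 1 := h3
  have : ‖j - j * e‖ ^ 2 < ε ^ 2 := by
    rw [sq, ← CStarRing.norm_star_mul_self]
    have : star (j - j * (e : A)) * (j - j * e)
        = (star j * j - star j * j * e) - e * (star j * j - star j * j * e) := by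
      rw [star_sub, star_mul, hse]; noncomm_ring
    rw [this]
    refine (norm_sub_le _ _).trans_lt ?_
    have := norm_mul_le (e : A) (star j * j - star j * j * e)
    nlinarith [norm_nonneg (star j * j - star j * j * (e : A))]
  exact lt_of_pow_lt_pow_left₀ 2 hε.le this

theorem mem_of_forall_approx (J : ClosedIdeal A) {a : A}
    (h : ∀ ε > 0, ∃ b ∈ J, ‖a - b‖ < ε) : a ∈ J := by
  rw [← SetLike.mem_coe, ← J.isClosed.closure_eq, Metric.mem_closure_iff]
  intro ε hε
  obtain ⟨b, hb, h⟩ := h ε hε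
  exact ⟨b, hb, by rwa [dist_eq_norm]⟩

theorem star_mem (J : ClosedIdeal A) {j : A} (hj : j ∈ J) : star j ∈ J := by
  refine J.mem_of_forall_approx fun ε hε => ?_
  obtain ⟨e, he, -, h, -⟩ := J.exists_approx (j := star j)
    (by simpa using J.mul_mem_right _ hj) hε
  exact ⟨star j * e, J.mul_mem_left _ he, h⟩

/-- The quotient C⋆-algebra `A / J`. -/
def QuotAlg (J : ClosedIdeal A) : Type u := A ⧸ J.toSubmodule

noncomputable section

variable (J : ClosedIdeal A)

instance : NormedAddCommGroup J.QuotAlg :=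
  haveI : IsClosed (J.toSubmodule : Set A) := J.isClosed
  inferInstanceAs (NormedAddCommGroup (A ⧸ J.toSubmodule))

instance : NormedSpace ℂ J.QuotAlg :=
  haveI : IsClosed (J.toSubmodule : Set A) := J.isClosed
  inferInstanceAs (NormedSpace ℂ (A ⧸ J.toSubmodule))

instance : CompleteSpace J.QuotAlg :=
  inferInstanceAs (CompleteSpace (A ⧸ J.toSubmodule))

/-- The class of `a` in `A / J`. -/
def cls (a : A) : J.QuotAlg := Submodule.Quotient.mk (p := J.toSubmodule) a

theorem cls_surjective : Function.Surjective J.cls := Submodule.Quotient.mk_surjective _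

variable {J}
theorem cls_eq_cls {a b : A} : J.cls a = J.cls b ↔ a - b ∈ J := Submodule.Quotient.eq _
theorem cls_eq_zero {a : A} : J.cls a = 0 ↔ a ∈ J := Submodule.Quotient.mk_eq_zero _
theorem cls_add (a b : A) : J.cls (a + b) = J.cls a + J.cls b := rfl
theorem cls_smul (c : ℂ) (a : A) : J.cls (c • a) = c • J.cls a := rfl
theorem norm_mk_le (a : A) : ‖J.cls a‖ ≤ ‖a‖ := Submodule.Quotient.norm_mk_le J.toSubmodule a
theorem exists_norm_lt (x : J.QuotAlg) {ε : ℝ} (hε : 0 < ε) : ∃ a, J.cls a = x ∧ ‖a‖ < ‖x‖ + ε :=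
  Submodule.Quotient.norm_mk_lt (S := J.toSubmodule) x hε
variable (J)

instance : Mul J.QuotAlg where
  mul := Quotient.map₂ (· * ·) fun a a' h b b' h' => by
    have h1 : a - a' ∈ J := (Submodule.quotientRel_def _).1 h
    have h2 : b - b' ∈ J := (Submodule.quotientRel_def _).1 h'
    refine (Submodule.quotientRel_def _).2 ?_
    have : a * b - a' * b' = (a - a') * b + a' * (b - b') := by noncomm_ring
    change a * b - a' * b' ∈ J
    rw [this]
    exact add_mem (J.mul_mem_right _ h1) (J.mul_mem_left _ h2)

instance : Star J.QuotAlg where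
  star := Quotient.map star fun a a' h => by
    have h1 : a - a' ∈ J := (Submodule.quotientRel_def _).1 h
    refine (Submodule.quotientRel_def _).2 ?_
    change star a - star a' ∈ J
    rw [← star_sub]; exact J.star_mem h1

variable {J}
theorem cls_mul (a b : A) : J.cls (a * b) = J.cls a * J.cls b := rfl
theorem cls_star (a : A) : J.cls (star a) = star (J.cls a) := rfl
variable (J)

instance : NonUnitalCStarAlgebra J.QuotAlg where
  left_distrib := by
    intro a b c
    obtain ⟨a, rfl⟩ := J.cls_surjective a; obtain ⟨b, rfl⟩ := J.cls_surjective b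
    obtain ⟨c, rfl⟩ := J.cls_surjective c
    simp only [← cls_mul, ← cls_add, mul_add]
  right_distrib := by
    intro a b c
    obtain ⟨a, rfl⟩ := J.cls_surjective a; obtain ⟨b, rfl⟩ := J.cls_surjective b
    obtain ⟨c, rfl⟩ := J.cls_surjective c
    simp only [← cls_mul, ← cls_add, add_mul]
  zero_mul := by
    intro a
    obtain ⟨a, rfl⟩ := J.cls_surjective a
    exact congrArg J.cls (zero_mul a)
  mul_zero := by
    intro a
    obtain ⟨a, rfl⟩ := J.cls_surjective a
    exact congrArg J.cls (mul_zero a)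
  mul_assoc := by
    intro a b c
    obtain ⟨a, rfl⟩ := J.cls_surjective a; obtain ⟨b, rfl⟩ := J.cls_surjective b
    obtain ⟨c, rfl⟩ := J.cls_surjective c
    simp only [← cls_mul, mul_assoc]
  dist_eq := fun a b => NormedAddCommGroup.dist_eq a b
  norm_mul_le := by
    intro a b
    refine le_of_forall_pos_le_add fun ε hε => ?_
    have hc : Continuous fun δ : ℝ => (‖a‖ + δ) * (‖b‖ + δ) := by fun_prop
    have ht : Tendsto (fun δ : ℝ => (‖a‖ + δ) * (‖b‖ + δ)) (𝓝[>] 0) (𝓝 (‖a‖ * ‖b‖)) := by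
      simpa using (hc.tendsto 0).mono_left nhdsWithin_le_nhds
    obtain ⟨δ, hδ, hδ0⟩ := ((ht.eventually (gt_mem_nhds (lt_add_of_pos_right _ hε))).and
      self_mem_nhdsWithin).exists
    obtain ⟨a', rfl, ha⟩ := exists_norm_lt a hδ0
    obtain ⟨b', rfl, hb⟩ := exists_norm_lt b hδ0
    rw [← cls_mul]
    calc ‖J.cls (a' * b')‖ ≤ ‖a' * b'‖ := norm_mk_le _
      _ ≤ ‖a'‖ * ‖b'‖ := norm_mul_le _ _
      _ ≤ _ := mul_le_mul ha.le hb.le (norm_nonneg _) (by positivity)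
      _ ≤ _ := hδ.le
  star_involutive := by
    intro a
    obtain ⟨a, rfl⟩ := J.cls_surjective a
    simp only [← cls_star, star_star]
  star_mul := by
    intro a b
    obtain ⟨a, rfl⟩ := J.cls_surjective a; obtain ⟨b, rfl⟩ := J.cls_surjective b
    simp only [← cls_star, ← cls_mul, star_mul]
  star_add := by
    intro a b
    obtain ⟨a, rfl⟩ := J.cls_surjective a; obtain ⟨b, rfl⟩ := J.cls_surjective b
    simp only [← cls_star, ← cls_add, star_add]
  norm_mul_self_le := by
    intro x
    obtain ⟨a, rfl⟩ := J.cls_surjective x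
    refine le_of_forall_pos_le_add fun ε hε => ?_
    obtain ⟨c, hc, hcn⟩ := exists_norm_lt (star (J.cls a) * J.cls a) (half_pos hε)
    rw [← cls_star, ← cls_mul] at hc
    have hj : star a * a - c ∈ J := cls_eq_cls.1 hc.symm
    obtain ⟨e, he, hse, h1, h2⟩ := J.exists_approx (J.mul_mem_left (star (star a * a - c)) hj)
      (half_pos hε)
    have h3 : ∀ x : A, ‖x - e * x‖ ≤ ‖x‖ := fun x => by
      have := h2 (star x)
      rwa [← norm_star, star_sub, star_mul, star_star, hse, norm_star] at this
    have hq : J.cls a = J.cls (a - a * e) := by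
      rw [cls_eq_cls]; simpa using J.mul_mem_left a he
    have hT : star (a - a * e) * (a - a * e)
        = ((c - c * e) - e * (c - c * e)) + (((star a * a - c) - (star a * a - c) * e)
          - e * ((star a * a - c) - (star a * a - c) * e)) := by
      rw [star_sub, star_mul, hse]; noncomm_ring
    calc ‖J.cls a‖ * ‖J.cls a‖ ≤ ‖a - a * e‖ * ‖a - a * e‖ := by
          rw [hq]; exact mul_self_le_mul_self (norm_nonneg _) (norm_mk_le _)
      _ = ‖star (a - a * e) * (a - a * e)‖ := CStarRing.norm_star_mul_self.symm
      _ ≤ ‖c‖ + ‖(star a * a - c) - (star a * a - c) * e‖ := by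
          rw [hT]
          exact (norm_add_le _ _).trans (add_le_add ((h3 _).trans (h2 _)) (h3 _))
      _ ≤ _ := by linarith
  smul_zero := smul_zero
  smul_add := smul_add
  add_smul := add_smul
  zero_smul := zero_smul ℂ
  norm_smul_le := norm_smul_le
  smul_assoc := by
    intro r a b
    obtain ⟨a, rfl⟩ := J.cls_surjective a; obtain ⟨b, rfl⟩ := J.cls_surjective b
    simp only [smul_eq_mul, ← cls_mul, ← cls_smul, smul_mul_assoc]
  smul_comm := by
    intro r a b
    obtain ⟨a, rfl⟩ := J.cls_surjective a; obtain ⟨b, rfl⟩ := J.cls_surjective b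
    simp only [smul_eq_mul, ← cls_mul, ← cls_smul, mul_smul_comm]
  star_smul := by
    intro r a
    obtain ⟨a, rfl⟩ := J.cls_surjective a
    simp only [← cls_smul, ← cls_star, star_smul]

/-- The quotient map `A → A / J`. -/
def proj : A →⋆ₙₐ[ℂ] J.QuotAlg where
  toFun := J.cls
  map_smul' _ _ := rfl
  map_zero' := rfl
  map_add' _ _ := rfl
  map_mul' _ _ := rfl
  map_star' _ := rfl

end
end ClosedIdeal

namespace ClosedIdeal

variable {A : Type u} [NonUnitalCStarAlgebra A]

/-- For `J ⊆ K`, the canonical map `A / J → A / K`. -/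
noncomputable def factor {J K : ClosedIdeal A} (h : ∀ a, a ∈ J → a ∈ K) :
    J.QuotAlg →⋆ₙₐ[ℂ] K.QuotAlg where
  toFun := Quotient.map id fun a b hab =>
    (Submodule.quotientRel_def _).2 (h _ ((Submodule.quotientRel_def _).1 hab))
  map_smul' c x := by obtain ⟨a, rfl⟩ := J.cls_surjective x; rfl
  map_zero' := rfl
  map_add' x y := by
    obtain ⟨a, rfl⟩ := J.cls_surjective x; obtain ⟨b, rfl⟩ := J.cls_surjective y; rfl
  map_mul' x y := by
    obtain ⟨a, rfl⟩ := J.cls_surjective x; obtain ⟨b, rfl⟩ := J.cls_surjective y; rfl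
  map_star' x := by obtain ⟨a, rfl⟩ := J.cls_surjective x; rfl

theorem factor_cls {J K : ClosedIdeal A} (h : ∀ a, a ∈ J → a ∈ K) (a : A) :
    factor h (J.cls a) = K.cls a := rfl

/-- The closed two-sided ideal whose underlying set is the closure of a two-sided ideal. -/
def ofClosure (S : Submodule ℂ A) (hl : ∀ (a : A), ∀ j ∈ S, a * j ∈ S)
    (hr : ∀ (a : A), ∀ j ∈ S, j * a ∈ S) : ClosedIdeal A where
  toSubmodule := S.topologicalClosure
  mul_mem_left' a j hj := by
    refine map_mem_closure (f := fun x : A => a * x) (by fun_prop) hj fun x hx => hl a x hx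
  mul_mem_right' {j} a hj := by
    refine map_mem_closure (f := fun x : A => x * a) (by fun_prop) hj fun x hx => hr a x hx
  isClosed' := S.isClosed_topologicalClosure

end ClosedIdeal

/-! ### Multipliers -/

namespace DoubleCentralizer

variable {A : Type u} [NonUnitalCStarAlgebra A]

theorem eq_of_forall_mul_eq {x y : A} (h : ∀ b : A, b * x = b * y) : x = y := by
  have := h (star (x - y))
  rw [← sub_eq_zero, ← mul_sub, CStarRing.star_mul_self_eq_zero_iff, sub_eq_zero] at this
  exact this

theorem eq_of_forall_mul_eq' {x y : A} (h : ∀ b : A, x * b = y * b) : x = y :=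
  star_injective <| eq_of_forall_mul_eq fun b => by
    simpa using congrArg star (h (star b))

theorem fst_mul (m : 𝓜(ℂ, A)) (a b : A) : m.fst (a * b) = m.fst a * b :=
  eq_of_forall_mul_eq fun c => by rw [← m.central, ← mul_assoc, m.central, mul_assoc]

theorem snd_mul (m : 𝓜(ℂ, A)) (a b : A) : m.snd (a * b) = a * m.snd b :=
  eq_of_forall_mul_eq' fun c => by rw [m.central, mul_assoc, ← m.central, mul_assoc]

theorem ext_fst {m n : 𝓜(ℂ, A)} (h : ∀ a, m.fst a = n.fst a) : m = n := by
  refine DoubleCentralizer.ext ℂ A m n (Prod.ext ?_ ?_)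
  · exact ContinuousLinearMap.ext h
  · refine ContinuousLinearMap.ext fun a => eq_of_forall_mul_eq' fun b => ?_
    rw [m.central, n.central, h]

theorem fst_mul_of_mem_center {m : 𝓜(ℂ, A)} (hm : m ∈ Subalgebra.center ℂ 𝓜(ℂ, A)) (a b : A) :
    m.fst (a * b) = a * m.fst b := by
  have h := Subalgebra.mem_center_iff.1 hm (a : 𝓜(ℂ, A))
  have := congrArg (fun n : 𝓜(ℂ, A) => n.fst b) h
  simpa using this.symm

theorem mem_center_of {m : 𝓜(ℂ, A)} (h : ∀ a b : A, m.fst (a * b) = a * m.fst b) :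
    m ∈ Subalgebra.center ℂ 𝓜(ℂ, A) := by
  refine Subalgebra.mem_center_iff.2 fun n => ext_fst fun a => ?_
  refine eq_of_forall_mul_eq fun b => ?_
  change b * n.fst (m.fst a) = b * m.fst (n.fst a)
  rw [← n.central, ← h, n.central, ← h]

end DoubleCentralizer

namespace ClosedIdeal

variable {A : Type u} [NonUnitalCStarAlgebra A] (J : ClosedIdeal A)

theorem fst_mem (m : 𝓜(ℂ, A)) {j : A} (hj : j ∈ J) : m.fst j ∈ J := by
  have hc : IsClosed {x : A | m.fst x ∈ J} := J.isClosed.preimage m.fst.continuous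
  suffices j ∈ {x : A | m.fst x ∈ J} from this
  rw [← hc.closure_eq, Metric.mem_closure_iff]
  intro ε hε
  obtain ⟨e, he, -, h, -⟩ := J.exists_approx (J.mul_mem_left (star j) hj) hε
  refine ⟨j * e, ?_, by rwa [dist_eq_norm]⟩
  change m.fst (j * e) ∈ J
  rw [DoubleCentralizer.fst_mul]
  exact J.mul_mem_left _ he

theorem snd_mem (m : 𝓜(ℂ, A)) {j : A} (hj : j ∈ J) : m.snd j ∈ J := by
  have := J.star_mem (J.fst_mem (star m) (J.star_mem hj))
  simpa using this

noncomputable section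

/-- A bounded operator on `A` that preserves `J` descends to `A / J`. -/
def mapCLM (T : A →L[ℂ] A) (hT : ∀ j ∈ J, T j ∈ J) : J.QuotAlg →L[ℂ] J.QuotAlg :=
  LinearMap.mkContinuous
    { toFun := Quotient.map T fun a b hab => (Submodule.quotientRel_def _).2 <| by
        have := hT _ ((Submodule.quotientRel_def _).1 hab)
        rwa [map_sub] at this
      map_add' := fun x y => by
        obtain ⟨a, rfl⟩ := J.cls_surjective x; obtain ⟨b, rfl⟩ := J.cls_surjective y
        exact congrArg J.cls (map_add T a b)
      map_smul' := fun c x => by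
        obtain ⟨a, rfl⟩ := J.cls_surjective x
        exact congrArg J.cls (map_smul T c a) }
    ‖T‖ fun x => by
      refine le_of_forall_pos_le_add fun ε hε => ?_
      obtain ⟨a, rfl, ha⟩ := exists_norm_lt x (ε := ε / (‖T‖ + 1)) (by positivity)
      calc ‖J.cls (T a)‖ ≤ ‖T a‖ := norm_mk_le _
        _ ≤ ‖T‖ * ‖a‖ := T.le_opNorm a
        _ ≤ ‖T‖ * (‖J.cls a‖ + ε / (‖T‖ + 1)) := by gcongr
        _ = ‖T‖ * ‖J.cls a‖ + ε * (‖T‖ / (‖T‖ + 1)) := by ring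
        _ ≤ ‖T‖ * ‖J.cls a‖ + ε := by
          gcongr
          exact mul_le_of_le_one_right hε.le ((div_le_one (by positivity)).2 (by linarith))

theorem mapCLM_cls (T : A →L[ℂ] A) (hT : ∀ j ∈ J, T j ∈ J) (a : A) :
    J.mapCLM T hT (J.cls a) = J.cls (T a) := rfl

/-- The canonical map `M(A) → M(A / J)`. -/
def mapMul (m : 𝓜(ℂ, A)) : 𝓜(ℂ, J.QuotAlg) where
  fst := J.mapCLM m.fst fun _ hj => J.fst_mem m hj
  snd := J.mapCLM m.snd fun _ hj => J.snd_mem m hj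
  central x y := by
    obtain ⟨a, rfl⟩ := J.cls_surjective x; obtain ⟨b, rfl⟩ := J.cls_surjective y
    exact congrArg J.cls (m.central a b)

theorem mapMul_fst_cls (m : 𝓜(ℂ, A)) (a : A) : (J.mapMul m).fst (J.cls a) = J.cls (m.fst a) := rfl
theorem mapMul_snd_cls (m : 𝓜(ℂ, A)) (a : A) : (J.mapMul m).snd (J.cls a) = J.cls (m.snd a) := rfl

theorem mapMul_ext {n : 𝓜(ℂ, J.QuotAlg)} {m : 𝓜(ℂ, A)}
    (h : ∀ a, n.fst (J.cls a) = J.cls (m.fst a)) : n = J.mapMul m :=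
  DoubleCentralizer.ext_fst fun x => by
    obtain ⟨a, rfl⟩ := J.cls_surjective x; exact h a

theorem mapMul_add (m n : 𝓜(ℂ, A)) : J.mapMul (m + n) = J.mapMul m + J.mapMul n :=
  (J.mapMul_ext fun _ => rfl).symm

theorem mapMul_zero : J.mapMul 0 = 0 := (J.mapMul_ext fun _ => rfl).symm

theorem mapMul_mul (m n : 𝓜(ℂ, A)) : J.mapMul (m * n) = J.mapMul m * J.mapMul n :=
  (J.mapMul_ext fun _ => rfl).symm

theorem mapMul_smul (c : ℂ) (m : 𝓜(ℂ, A)) : J.mapMul (c • m) = c • J.mapMul m :=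
  (J.mapMul_ext fun _ => rfl).symm

theorem mapMul_star (m : 𝓜(ℂ, A)) : J.mapMul (star m) = star (J.mapMul m) := by
  refine (J.mapMul_ext fun a => ?_).symm
  rw [DoubleCentralizer.star_fst, ← cls_star, mapMul_snd_cls, ← cls_star,
    DoubleCentralizer.star_fst]

end
end ClosedIdeal

/-! ### `C(X)`-algebras -/

/-- A `C(X)`-algebra over a compact Hausdorff space `X`: a C⋆-algebra `A` with a
⋆-homomorphism `θ` from `C(X)` to the center of the multiplier algebra `M(A)` such that
`θ(C(X)) A` is dense in `A`. -/
class CXAlgebra (X : Type u) [TopologicalSpace X] [CompactSpace X] [T2Space X]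
    (A : Type u) [NonUnitalCStarAlgebra A] where
  θ : C(X, ℂ) →⋆ₙₐ[ℂ] 𝓜(ℂ, A)
  θ_mem_center : ∀ f, θ f ∈ Subalgebra.center ℂ 𝓜(ℂ, A)
  dense : Dense {b : A | ∃ (f : C(X, ℂ)) (a : A), b = (θ f).fst a}

noncomputable section

section CX

variable (X : Type u) [TopologicalSpace X] [CompactSpace X] [T2Space X]
  {A : Type u} [NonUnitalCStarAlgebra A] [CXAlgebra X A]

/-- The product `f a = θ(f) a` for `f ∈ C(X)` and `a ∈ A`. -/
def CXAlgebra.act (f : C(X, ℂ)) (a : A) : A := (CXAlgebra.θ (X := X) (A := A) f).fst a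

/-- A ⋆-homomorphism of `C(X)`-algebras is one that is `C(X)`-linear. -/
def IsCXLinear {B : Type u} [NonUnitalCStarAlgebra B] [CXAlgebra X B] (φ : A →⋆ₙₐ[ℂ] B) : Prop :=
  ∀ (f : C(X, ℂ)) (a : A), φ (CXAlgebra.act X f a) = CXAlgebra.act X f (φ a)

variable (A)

/-- The linear span of the products `f a`, where `f ∈ C(X)` vanishes on `S` and `a ∈ A`. -/
def vanishingSpan (S : Set X) : Submodule ℂ A :=
  Submodule.span ℂ {b | ∃ (f : C(X, ℂ)) (a : A), (∀ x ∈ S, f x = 0) ∧ b = CXAlgebra.act X f a}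

/-- The closed two-sided ideal `C(X, S) A` of `A`, where `C(X, S)` consists of the functions
in `C(X)` that vanish on `S`. -/
def vanishingIdeal (S : Set X) : ClosedIdeal A :=
  ClosedIdeal.ofClosure (vanishingSpan X A S)
    (fun a j hj => by
      induction hj using Submodule.span_induction with
      | mem x hx =>
        obtain ⟨f, b, hf, rfl⟩ := hx
        refine Submodule.subset_span ⟨f, a * b, hf, ?_⟩
        exact (DoubleCentralizer.fst_mul_of_mem_center (CXAlgebra.θ_mem_center f) a b).symm
      | zero => rw [mul_zero]; exact zero_mem _
      | add x y _ _ hx hy => rw [mul_add]; exact add_mem hx hy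
      | smul c x _ hx => rw [mul_smul_comm]; exact Submodule.smul_mem _ c hx)
    (fun a j hj => by
      induction hj using Submodule.span_induction with
      | mem x hx =>
        obtain ⟨f, b, hf, rfl⟩ := hx
        exact Submodule.subset_span ⟨f, b * a, hf, (DoubleCentralizer.fst_mul _ b a).symm⟩
      | zero => rw [zero_mul]; exact zero_mem _
      | add x y _ _ hx hy => rw [add_mul]; exact add_mem hx hy
      | smul c x _ hx => rw [smul_mul_assoc]; exact Submodule.smul_mem _ c hx)

/-- The fiber `A(x) = A / C(X, {x}) A`. -/
abbrev Fiber (x : X) : Type u := (vanishingIdeal X A {x}).QuotAlg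

/-- A `C(X)`-algebra is continuous if `x ↦ ‖a(x)‖` is continuous for every `a ∈ A`. -/
def IsContinuousCXAlgebra : Prop :=
  ∀ a : A, Continuous fun x : X => ‖(vanishingIdeal X A {x}).proj a‖

end CX

section Restriction

variable {X W : Type u} [TopologicalSpace X] [CompactSpace X] [T2Space X]
  [TopologicalSpace W]

/-- The restriction `A(W)` of a `C(X)`-algebra `A` to a closed subset of `X`, given as the
range of an injective continuous map `i : W → X`. -/
abbrev Restriction (i : C(W, X)) (A : Type u) [NonUnitalCStarAlgebra A] [CXAlgebra X A] : Type u :=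
  (vanishingIdeal X A (Set.range i)).QuotAlg

variable (i : C(W, X)) (A : Type u) [NonUnitalCStarAlgebra A] [CXAlgebra X A]

/-- The restriction map `π_W : A → A(W)`. -/
def restrictionMap : A →⋆ₙₐ[ℂ] Restriction i A := (vanishingIdeal X A (Set.range i)).proj

theorem exists_extension_of_injective [CompactSpace W] {i : C(W, X)} (hi : Function.Injective i) (f : C(W, ℂ)) :
    ∃ g : C(X, ℂ), g.comp i = f :=
  ContinuousMap.exists_extension (i.continuous.isClosedEmbedding hi) f

/-- A continuous function on `X` that extends `f ∈ C(W)`. -/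
def extendFun [CompactSpace W] {i : C(W, X)} (hi : Function.Injective i) (f : C(W, ℂ)) : C(X, ℂ) :=
  (exists_extension_of_injective hi f).choose

theorem extendFun_comp [CompactSpace W] {i : C(W, X)} (hi : Function.Injective i) (f : C(W, ℂ)) :
    (extendFun hi f).comp i = f := (exists_extension_of_injective hi f).choose_spec

theorem mapMul_θ_eq {f g : C(X, ℂ)} (h : f.comp i = g.comp i) :
    (vanishingIdeal X A (Set.range i)).mapMul (CXAlgebra.θ f) =
      (vanishingIdeal X A (Set.range i)).mapMul (CXAlgebra.θ g) := by
  refine ClosedIdeal.mapMul_ext _ fun a => ?_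
  rw [ClosedIdeal.mapMul_fst_cls, ClosedIdeal.cls_eq_cls]
  refine subset_closure (Submodule.subset_span ⟨f - g, a, ?_, ?_⟩)
  · rintro _ ⟨w, rfl⟩
    have := congrArg (fun k : C(W, ℂ) => k w) h
    simpa [sub_eq_zero] using this
  · simp [CXAlgebra.act, map_sub]

/-- The `C(W)`-algebra structure on `A(W)`: `f ∈ C(W)` acts as any of its extensions to `X`. -/
instance restrictionCXAlgebra [CompactSpace W] [T2Space W] [hi : Fact (Function.Injective i)] :
    CXAlgebra W (Restriction i A) where
  θ :=
    { toFun := fun f => (vanishingIdeal X A (Set.range i)).mapMul (CXAlgebra.θ (extendFun hi.out f))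
      map_smul' := fun c f => by
        rw [MonoidHom.id_apply, ← ClosedIdeal.mapMul_smul, ← map_smul]
        refine mapMul_θ_eq i A ?_
        ext w
        have h1 := congrArg (fun k : C(W, ℂ) => k w) (extendFun_comp hi.out (c • f))
        have h2 := congrArg (fun k : C(W, ℂ) => k w) (extendFun_comp hi.out f)
        simp_all
      map_zero' := by
        rw [← ClosedIdeal.mapMul_zero, ← map_zero (CXAlgebra.θ (X := X) (A := A))]
        refine mapMul_θ_eq i A ?_
        rw [extendFun_comp]; rfl
      map_add' := fun f g => by
        rw [← ClosedIdeal.mapMul_add, ← map_add]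
        refine mapMul_θ_eq i A ?_
        ext w
        have h1 := congrArg (fun k : C(W, ℂ) => k w) (extendFun_comp hi.out (f + g))
        have h2 := congrArg (fun k : C(W, ℂ) => k w) (extendFun_comp hi.out f)
        have h3 := congrArg (fun k : C(W, ℂ) => k w) (extendFun_comp hi.out g)
        simp_all
      map_mul' := fun f g => by
        rw [← ClosedIdeal.mapMul_mul, ← map_mul]
        refine mapMul_θ_eq i A ?_
        ext w
        have h1 := congrArg (fun k : C(W, ℂ) => k w) (extendFun_comp hi.out (f * g))
        have h2 := congrArg (fun k : C(W, ℂ) => k w) (extendFun_comp hi.out f)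
        have h3 := congrArg (fun k : C(W, ℂ) => k w) (extendFun_comp hi.out g)
        simp_all
      map_star' := fun f => by
        rw [← ClosedIdeal.mapMul_star, ← map_star]
        refine mapMul_θ_eq i A ?_
        ext w
        have h1 := congrArg (fun k : C(W, ℂ) => k w) (extendFun_comp hi.out (star f))
        have h2 := congrArg (fun k : C(W, ℂ) => k w) (extendFun_comp hi.out f)
        simp_all }
  θ_mem_center f := by
    refine DoubleCentralizer.mem_center_of fun x y => ?_
    obtain ⟨a, rfl⟩ := ClosedIdeal.cls_surjective _ x
    obtain ⟨b, rfl⟩ := ClosedIdeal.cls_surjective _ y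
    exact congrArg (ClosedIdeal.cls _)
      (DoubleCentralizer.fst_mul_of_mem_center (CXAlgebra.θ_mem_center (extendFun hi.out f)) a b)
  dense := by
    have hs : DenseRange (restrictionMap i A) :=
      (ClosedIdeal.cls_surjective (vanishingIdeal X A (Set.range i))).denseRange
    have hc : Continuous (restrictionMap i A) :=
      AddMonoidHomClass.continuous_of_bound (restrictionMap i A) 1
        fun a => by rw [one_mul]; exact ClosedIdeal.norm_mk_le a
    refine (hs.dense_image hc (CXAlgebra.dense (X := X) (A := A))).mono ?_
    rintro _ ⟨_, ⟨f, a, rfl⟩, rfl⟩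
    refine ⟨f.comp i, restrictionMap i A a, ?_⟩
    have h := mapMul_θ_eq i A (f := extendFun hi.out (f.comp i)) (g := f) (extendFun_comp _ _)
    exact (congrArg (fun m => m.fst (restrictionMap i A a)) h).symm

end Restriction

/-! ### Classes of C⋆-algebras, semiprojectivity, exhaustive sequences -/

/-- A class of C⋆-algebras. -/
abbrev CStarClass : Type (u + 1) := ∀ (D : Type u) [NonUnitalCStarAlgebra D], Prop

/-- A C⋆-algebra is simple if it is nonzero and its only closed two-sided ideals are `0` and
itself. -/
def IsSimpleCStar (D : Type u) [NonUnitalCStarAlgebra D] : Prop :=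
  Nontrivial D ∧ ∀ J : ClosedIdeal D, (∀ a ∈ J, a = 0) ∨ ∀ a, a ∈ J

theorem ClosedIdeal.le_of_eq_closure {B : Type u} [NonUnitalCStarAlgebra B]
    {J : ℕ → ClosedIdeal B} {K : ClosedIdeal B}
    (hK : (K : Set B) = closure (⋃ n, (J n : Set B))) (n : ℕ) : ∀ b, b ∈ J n → b ∈ K :=
  fun b hb => by
    rw [← SetLike.mem_coe, hK]
    exact subset_closure (Set.mem_iUnion.2 ⟨n, hb⟩)

/-- A separable nonzero C⋆-algebra `D` is semiprojective if for every separable C⋆-algebra `B` and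
every increasing sequence of closed two-sided ideals `J n` of `B`, with `K` the closure of their
union, each ⋆-homomorphism `D → B / K` factors through a ⋆-homomorphism `D → B / J n` for
some `n`; that is, the map from the direct limit of the `Hom(D, B / J n)` to `Hom(D, B / K)` is
surjective. -/
def IsSemiprojective (D : Type u) [NonUnitalCStarAlgebra D] : Prop :=
  TopologicalSpace.SeparableSpace D ∧ Nontrivial D ∧
  ∀ (B : Type u) [NonUnitalCStarAlgebra B] [TopologicalSpace.SeparableSpace B]
    (J : ℕ → ClosedIdeal B) (_ : ∀ m n, m ≤ n → ∀ b ∈ J m, b ∈ J n)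
    (K : ClosedIdeal B) (hK : (K : Set B) = closure (⋃ n, (J n : Set B)))
    (φ : D →⋆ₙₐ[ℂ] K.QuotAlg),
    ∃ (n : ℕ) (ψ : D →⋆ₙₐ[ℂ] (J n).QuotAlg),
      (ClosedIdeal.factor (ClosedIdeal.le_of_eq_closure hK n)).comp ψ = φ

/-- Finite direct sums of semiprojective simple C⋆-algebras. -/
def IsSumOfSemiprojectiveSimple (D : Type u) [NonUnitalCStarAlgebra D] : Prop :=
  ∃ (n : ℕ) (S : Fin n → Type u) (_ : ∀ i, NonUnitalCStarAlgebra (S i)),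
    (∀ i, IsSimpleCStar (S i) ∧ IsSemiprojective (S i)) ∧ Nonempty (D ≃⋆ₐ[ℂ] ∀ i, S i)

/-- A C⋆-algebra `B` admits an exhaustive sequence of C⋆-subalgebras isomorphic to members
of `𝒞`. -/
def HasExhaustiveSequence (𝒞 : CStarClass.{u}) (B : Type u) [NonUnitalCStarAlgebra B] : Prop :=
  ∃ S : ℕ → NonUnitalStarSubalgebra ℂ B,
    (∀ n, IsClosed (S n : Set B)) ∧
    (∀ n, ∃ (D : Type u) (_ : NonUnitalCStarAlgebra D), 𝒞 D ∧ Nonempty (D ≃⋆ₐ[ℂ] S n)) ∧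
    ∀ (F : Finset B) (ε : ℝ), 0 < ε → ∃ n, ∀ a ∈ F, ∃ b ∈ S n, ‖a - b‖ < ε

/-! ### Category of a `C(X)`-algebra -/

section Cat

open TopologicalSpace

instance {X : Type u} [TopologicalSpace X] [CompactSpace X] (Y : Closeds X) : CompactSpace Y :=
  isCompact_iff_compactSpace.1 Y.isClosed.isCompact

/-- The inclusion of a closed set into a larger one. -/
def closedsInclusion {X : Type u} [TopologicalSpace X] {W Y : Closeds X} (h : W ≤ Y) : C(W, Y) where
  toFun w := ⟨w, h w.2⟩

instance {X : Type u} [TopologicalSpace X] {W Y : Closeds X} (h : W ≤ Y) :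
    Fact (Function.Injective (closedsInclusion h)) :=
  ⟨fun _ _ hab => Subtype.ext (congrArg (fun y : Y => (y : X)) hab)⟩

/-- The restriction of functions to a closed set. -/
def restrictFun {X : Type u} [TopologicalSpace X] (Y : Closeds X) (f : C(X, ℂ)) : C(Y, ℂ) where
  toFun y := f y

/-- The pullback `{(b, e) | η b = ψ e}` of two ⋆-homomorphisms. -/
def cstarPullback {B E D : Type u} [NonUnitalCStarAlgebra B] [NonUnitalCStarAlgebra E]
    [NonUnitalCStarAlgebra D] (η : B →⋆ₙₐ[ℂ] D) (ψ : E →⋆ₙₐ[ℂ] D) :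
    NonUnitalStarSubalgebra ℂ (B × E) where
  carrier := {p | η p.1 = ψ p.2}
  add_mem' {p q} hp hq := by simp_all
  zero_mem' := by simp
  mul_mem' {p q} hp hq := by simp_all
  smul_mem' c p hp := by simp_all
  star_mem' {p} hp := by simp_all [map_star]

/-- A `C(Z)`-algebra `E` is `𝒞`-elementary if there are a finite partition of `Z` into closed sets
`Z 1, …, Z r` with `r ≥ 1`, and members `D i` of `𝒞`, such that `E` is isomorphic as a
`C(Z)`-algebra to the direct sum of the `C(Z i) ⊗ D i`. Here `C(Z i) ⊗ D i` is the algebra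
`C(Z i, D i)` of continuous functions, on which `C(Z)` acts pointwise. -/
def IsElementary (𝒞 : CStarClass.{u}) (Z : Type u) [TopologicalSpace Z] [CompactSpace Z]
    [T2Space Z] (E : Type u) [NonUnitalCStarAlgebra E] [CXAlgebra Z E] : Prop :=
  ∃ (r : ℕ) (_ : 1 ≤ r) (P : Fin r → Closeds Z) (D : Fin r → Type u)
    (_ : ∀ i, NonUnitalCStarAlgebra (D i)),
    (⋃ i, (P i : Set Z)) = Set.univ ∧
    (∀ i j, i ≠ j → Disjoint (P i : Set Z) (P j : Set Z)) ∧
    (∀ i, 𝒞 (D i)) ∧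
    ∃ Φ : E ≃⋆ₐ[ℂ] (∀ i, C(P i, D i)),
      ∀ (f : C(Z, ℂ)) (e : E) (i : Fin r) (z : P i),
        Φ (CXAlgebra.act Z f e) i z = f z • Φ e i z

/-- `CatLE 𝒞 n X A` says that the category of the `C(X)`-algebra `A` with respect to `𝒞` is at
most `n`. For `n = 0` it says that `A` is `𝒞`-elementary. For `n + 1` it holds if the category is at
most `n`, or if `X = Y ∪ Z` with `Y` and `Z` closed and `A` is isomorphic, as a `C(X)`-algebra, to
the pullback `{(b, e) ∈ B ⊕ E | π(b) = γ(π(e))}`, where `B` is a `C(Y)`-algebra of category at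
most `n`, `E` is a `𝒞`-elementary `C(Z)`-algebra and `γ : E(Y ∩ Z) → B(Y ∩ Z)` is an injective
⋆-homomorphism of `C(Y ∩ Z)`-algebras. -/
def CatLE (𝒞 : CStarClass.{u}) : ℕ → ∀ (X : Type u) [TopologicalSpace X] [CompactSpace X]
    [T2Space X] (A : Type u) [NonUnitalCStarAlgebra A] [CXAlgebra X A], Prop
  | 0, X, _, _, _, A, _, _ => IsElementary 𝒞 X A
  | n + 1, X, _, _, _, A, _, _ =>
    CatLE 𝒞 n X A ∨
    ∃ (Y Z : Closeds X) (B E : Type u) (_ : NonUnitalCStarAlgebra B) (_ : NonUnitalCStarAlgebra E)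
      (_ : CXAlgebra Y B) (_ : CXAlgebra Z E)
      (γ : Restriction (closedsInclusion (inf_le_right : Y ⊓ Z ≤ Z)) E →⋆ₙₐ[ℂ]
        Restriction (closedsInclusion (inf_le_left : Y ⊓ Z ≤ Y)) B)
      (Φ : A ≃⋆ₐ[ℂ] cstarPullback (restrictionMap (closedsInclusion inf_le_left) B)
        (γ.comp (restrictionMap (closedsInclusion inf_le_right) E))),
      (Y : Set X) ∪ Z = Set.univ ∧
      CatLE 𝒞 n Y B ∧ IsElementary 𝒞 Z E ∧
      Function.Injective γ ∧ IsCXLinear (↥(Y ⊓ Z)) γ ∧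
      ∀ (f : C(X, ℂ)) (a : A),
        (Φ (CXAlgebra.act X f a) : B × E) =
          (CXAlgebra.act Y (restrictFun Y f) (Φ a : B × E).1,
            CXAlgebra.act Z (restrictFun Z f) (Φ a : B × E).2)

/-- The category of a `C(X)`-algebra with respect to `𝒞`. -/
def cat (𝒞 : CStarClass.{u}) (X : Type u) [TopologicalSpace X] [CompactSpace X]
    [T2Space X] (A : Type u) [NonUnitalCStarAlgebra A] [CXAlgebra X A] : ℕ∞ :=
  ⨅ (n : ℕ) (_ : CatLE 𝒞 n X A), (n : ℕ∞)

end Cat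

/-! ### Covering dimension -/

/-- Every finite open cover of `X` has a finite open refinement for which each point of `X` lies in
at most `n + 1` members. -/
def CoveringDimLE (X : Type u) [TopologicalSpace X] (n : ℕ) : Prop :=
  ∀ (k : ℕ) (U : Fin k → Set X), (∀ i, IsOpen (U i)) → (⋃ i, U i) = Set.univ →
    ∃ (l : ℕ) (V : Fin l → Set X), (∀ j, IsOpen (V j)) ∧ (⋃ j, V j) = Set.univ ∧
      (∀ j, ∃ i, V j ⊆ U i) ∧ ∀ x, {j | x ∈ V j}.ncard ≤ n + 1

open Classical in
/-- The (Lebesgue) covering dimension, which is `⊥` for the empty space. -/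
def coveringDim (X : Type u) [TopologicalSpace X] : WithBot ℕ∞ :=
  if IsEmpty X then ⊥ else ((⨅ (n : ℕ) (_ : CoveringDimLE X n), (n : ℕ∞) : ℕ∞) : WithBot ℕ∞)

/-! ### Inductive limits -/

/-- `A`, with the maps `φ k : B k → A`, is an inductive limit of the sequence
`μ k : B k → B (k + 1)` of C⋆-algebras. -/
structure IsCStarInductiveLimit {B : ℕ → Type u} [∀ k, NonUnitalCStarAlgebra (B k)]
    (μ : ∀ k, B k →⋆ₙₐ[ℂ] B (k + 1)) {A : Type u} [NonUnitalCStarAlgebra A]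
    (φ : ∀ k, B k →⋆ₙₐ[ℂ] A) : Prop where
  compatible : ∀ k, (φ (k + 1)).comp (μ k) = φ k
  universal : ∀ (D : Type u) [NonUnitalCStarAlgebra D] (ψ : ∀ k, B k →⋆ₙₐ[ℂ] D),
    (∀ k, (ψ (k + 1)).comp (μ k) = ψ k) →
      ∃! σ : A →⋆ₙₐ[ℂ] D, ∀ k, σ.comp (φ k) = ψ k

end

/-! Local structure. A subalgebra of the fiber `A(x)` isomorphic to some `D` in `𝒞` spreads to
nearby fibers: semiprojectivity lifts `D → A(x)` to sections over a neighbourhood of `x`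
(`LiftsAll.exists_sectionHom`). Injectivity survives on a smaller neighbourhood because, for a
finite sum of simple algebras, it only requires finitely many elements to have nonzero image, and
fiber norms are continuous.

Global structure. If the covering dimension is at most `d`, then `X` is covered by `d + 1` families
of disjoint small closed sets (`CoveringDimLE.exists_coloured_cover`). Each family gives a layer:
from the current subalgebra `B` of `A` one keeps the sections whose values over these sets lie in
the copies of the algebras `D`. The maps of a layer must consist of sections of `B`, not just of
`A`; they are perturbed into `B` by the stability result `exists_stable_sectionHom`, provided that
`B` approximates enough elements. Tolerances are therefore fixed from the last layer back to the
first (`exists_built`). A layer exhibits the refined algebra over the covered set as a pullback of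
the previous algebra and an elementary one, along an injective map. The first layer alone is
elementary, so `d + 1` layers give category at most `d` (`Built.catLE`).

Passage to the limit. The subalgebras so obtained approximate `A` ever better but are not nested.
They are weakly semiprojective relative to `C(X)`: a built algebra maps `C(X)`-linearly, close to
the identity on a given compact set, into every `C(X)`-subalgebra that approximates enough elements
of `A` (`Built.exists_approx_hom`, `Built.exists_hom`). Such a map is extended over one layer at a
time; stability is needed in a relative form, with the map prescribed where the layer meets the part
already treated. A one-sided approximate intertwining (`exists_limit_maps`) then identifies `A` with
the limit.

Stability itself is proved by contradiction, in algebras of bounded sequences. These are not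
separable, so the lifting property is first freed from separability (`IsSemiprojective.liftsAll`)
and extended to finite sums (`LiftsAll.prod`). -/

/-! ### ⋆-homomorphisms of C⋆-algebras -/

section StarHom

variable {A B : Type*} [NonUnitalCStarAlgebra A] [NonUnitalCStarAlgebra B]

/-- A linear, multiplicative, star-closed, total and single-valued relation is the graph of a
⋆-homomorphism. -/
theorem exists_starHom_of_rel (R : A → B → Prop) (total : ∀ a, ∃ b, R a b)
    (add : ∀ a a' b b', R a b → R a' b' → R (a + a') (b + b'))
    (smul : ∀ (c : ℂ) a b, R a b → R (c • a) (c • b))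
    (mul : ∀ a a' b b', R a b → R a' b' → R (a * a') (b * b'))
    (star' : ∀ a b, R a b → R (star a) (star b))
    (single : ∀ b, R 0 b → b = 0) :
    ∃ σ : A →⋆ₙₐ[ℂ] B, ∀ a b, R a b ↔ σ a = b := by
  choose σ hσ using total
  have uniq : ∀ a b b', R a b → R a b' → b = b' := fun a b b' h h' => by
    have := single (b + (-1 : ℂ) • b') (by simpa using add _ _ _ _ h (smul (-1) _ _ h'))
    rw [neg_smul, one_smul, ← sub_eq_add_neg, sub_eq_zero] at this
    exact this
  have key : ∀ a b, R a b → σ a = b := fun a b h => uniq a _ _ (hσ a) h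
  refine ⟨{ toFun := σ
            map_smul' := fun c a => key _ _ (smul c _ _ (hσ a))
            map_zero' := single _ (hσ 0)
            map_add' := fun a b => key _ _ (add _ _ _ _ (hσ a) (hσ b))
            map_mul' := fun a b => key _ _ (mul _ _ _ _ (hσ a) (hσ b))
            map_star' := fun a => key _ _ (star' _ _ (hσ a)) }, fun a b => ⟨key a b, ?_⟩⟩
  rintro rfl
  exact hσ a

theorem starHom_norm_le (φ : A →⋆ₙₐ[ℂ] B) (a : A) : ‖φ a‖ ≤ ‖a‖ :=
  NonUnitalStarAlgHom.norm_apply_le φ a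

theorem starHom_continuous (φ : A →⋆ₙₐ[ℂ] B) : Continuous φ :=
  AddMonoidHomClass.continuous_of_bound φ 1 fun a => by rw [one_mul]; exact starHom_norm_le φ a

end StarHom

/-! ### Preimages and kernels as closed ideals, and maps out of quotients. -/

namespace ClosedIdeal

variable {A B C : Type u} [NonUnitalCStarAlgebra A] [NonUnitalCStarAlgebra B]
  [NonUnitalCStarAlgebra C]

theorem proj_apply (J : ClosedIdeal A) (a : A) : J.proj a = J.cls a := rfl

/-- The preimage of a closed ideal under a ⋆-homomorphism. -/
def comap (φ : A →⋆ₙₐ[ℂ] B) (J : ClosedIdeal B) : ClosedIdeal A where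
  carrier := {a | φ a ∈ J}
  add_mem' ha hb := by simpa using add_mem ha hb
  zero_mem' := by simp
  smul_mem' c a ha := by simpa using J.smul_mem c ha
  mul_mem_left' a j hj := by simpa using J.mul_mem_left (φ a) hj
  mul_mem_right' a hj := by simpa using J.mul_mem_right (φ a) hj
  isClosed' := J.isClosed.preimage (starHom_continuous φ)

/-- The zero ideal. -/
def zero (B : Type u) [NonUnitalCStarAlgebra B] : ClosedIdeal B where
  carrier := {0}
  add_mem' ha hb := by simp_all
  zero_mem' := rfl
  smul_mem' c a ha := by simp_all
  mul_mem_left' a j hj := by simp_all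
  mul_mem_right' a hj := by simp_all
  isClosed' := isClosed_singleton

/-- The kernel of a ⋆-homomorphism. -/
def ker (φ : A →⋆ₙₐ[ℂ] B) : ClosedIdeal A := (zero B).comap φ

theorem mem_ker {φ : A →⋆ₙₐ[ℂ] B} {a : A} : a ∈ ker φ ↔ φ a = 0 := Iff.rfl

/-- The map from a quotient induced by a ⋆-homomorphism that vanishes on the ideal. -/
noncomputable def lift (J : ClosedIdeal A) (φ : A →⋆ₙₐ[ℂ] B) (h : ∀ a ∈ J, φ a = 0) :
    J.QuotAlg →⋆ₙₐ[ℂ] B where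
  toFun := Quotient.lift φ fun a b hab => by
    have := h _ ((Submodule.quotientRel_def _).1 hab)
    rwa [map_sub, sub_eq_zero] at this
  map_smul' c x := by obtain ⟨a, rfl⟩ := J.cls_surjective x; exact map_smul φ c a
  map_zero' := map_zero φ
  map_add' x y := by
    obtain ⟨a, rfl⟩ := J.cls_surjective x; obtain ⟨b, rfl⟩ := J.cls_surjective y
    exact map_add φ a b
  map_mul' x y := by
    obtain ⟨a, rfl⟩ := J.cls_surjective x; obtain ⟨b, rfl⟩ := J.cls_surjective y
    exact map_mul φ a b
  map_star' x := by obtain ⟨a, rfl⟩ := J.cls_surjective x; exact map_star φ a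

theorem lift_injective (J : ClosedIdeal A) (φ : A →⋆ₙₐ[ℂ] B) (h : ∀ a ∈ J, φ a = 0)
    (h' : ∀ a, φ a = 0 → a ∈ J) : Function.Injective (J.lift φ h) := by
  refine (injective_iff_map_eq_zero _).2 fun x hx => ?_
  obtain ⟨a, rfl⟩ := J.cls_surjective x
  exact cls_eq_zero.2 (h' a hx)

/-- The norm of the image is the quotient norm modulo the kernel. -/
theorem norm_cls_eq (J : ClosedIdeal A) (φ : A →⋆ₙₐ[ℂ] B) (h : ∀ a, a ∈ J ↔ φ a = 0) (a : A) :
    ‖J.cls a‖ = ‖φ a‖ :=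
  (NonUnitalStarAlgHom.norm_map (J.lift φ fun a => (h a).1)
    (lift_injective J φ _ fun a => (h a).2) (J.cls a)).symm

end ClosedIdeal

/-! ### Consequences of the isometry of `A / ker π` with the range of `π`. -/

section StarHom

variable {A B : Type u} [NonUnitalCStarAlgebra A] [NonUnitalCStarAlgebra B]

/-- The norm of `π a` is the quotient norm of `a` modulo the kernel, an infimum over the elements
with the same image. -/
theorem exists_norm_lift (π : A →⋆ₙₐ[ℂ] B) (a : A) {ε : ℝ} (hε : 0 < ε) :
    ∃ a', π a' = π a ∧ ‖a'‖ < ‖π a‖ + ε := by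
  obtain ⟨a', h, h'⟩ := ClosedIdeal.exists_norm_lt ((ClosedIdeal.ker π).cls a) hε
  rw [ClosedIdeal.norm_cls_eq (ClosedIdeal.ker π) π (fun _ => Iff.rfl) a] at h'
  refine ⟨a', ?_, h'⟩
  rw [ClosedIdeal.cls_eq_cls, ClosedIdeal.mem_ker, map_sub, sub_eq_zero] at h
  exact h

/-- The induced injection of `A / ker π` has the same range and is isometric on a complete space. -/
theorem isClosed_range_starHom (π : A →⋆ₙₐ[ℂ] B) : IsClosed (Set.range π) := by
  let p := (ClosedIdeal.ker π).lift π fun a => id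
  have hp : Isometry p := NonUnitalStarAlgHom.isometry p
    (ClosedIdeal.lift_injective _ π _ fun a => id)
  have : Set.range π = Set.range p := by
    ext b
    constructor
    · rintro ⟨a, rfl⟩; exact ⟨(ClosedIdeal.ker π).cls a, rfl⟩
    · rintro ⟨x, rfl⟩
      obtain ⟨a, rfl⟩ := ClosedIdeal.cls_surjective _ x
      exact ⟨a, rfl⟩
  rw [this]
  exact hp.isClosedEmbedding.isClosed_range

end StarHom

/-! ### Semiprojectivity without separability -/

/-- Maps from `D` into quotients of `B` lift to the stages of an increasing sequence of ideals. -/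
def LiftsInto (D B : Type u) [NonUnitalCStarAlgebra D] [NonUnitalCStarAlgebra B] : Prop :=
  ∀ (J : ℕ → ClosedIdeal B) (_ : ∀ m n, m ≤ n → ∀ b ∈ J m, b ∈ J n)
    (K : ClosedIdeal B) (hK : (K : Set B) = closure (⋃ n, (J n : Set B)))
    (φ : D →⋆ₙₐ[ℂ] K.QuotAlg),
    ∃ (n : ℕ) (ψ : D →⋆ₙₐ[ℂ] (J n).QuotAlg),
      (ClosedIdeal.factor (ClosedIdeal.le_of_eq_closure hK n)).comp ψ = φ

/-- The lifting property of semiprojective C⋆-algebras, for all C⋆-algebras `B`. -/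
def LiftsAll (D : Type u) [NonUnitalCStarAlgebra D] : Prop :=
  ∀ (B : Type u) [NonUnitalCStarAlgebra B], LiftsInto D B

section Lifting

variable {D B C : Type u} [NonUnitalCStarAlgebra D] [NonUnitalCStarAlgebra B]
  [NonUnitalCStarAlgebra C]

theorem ClosedIdeal.mem_of_closure {J : ℕ → ClosedIdeal B} {K : ClosedIdeal B}
    (hK : (K : Set B) = closure (⋃ n, (J n : Set B))) {b : B} (hb : b ∈ K) {ε : ℝ} (hε : 0 < ε) :
    ∃ n, ∃ j ∈ J n, ‖b - j‖ < ε := by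
  rw [← SetLike.mem_coe, hK, Metric.mem_closure_iff] at hb
  obtain ⟨j, hj, h⟩ := hb ε hε
  obtain ⟨n, hn⟩ := Set.mem_iUnion.1 hj
  exact ⟨n, j, hn, by rwa [← dist_eq_norm]⟩

theorem ClosedIdeal.eq_closure_of {J : ℕ → ClosedIdeal B} {K : ClosedIdeal B}
    (h1 : ∀ n, ∀ b ∈ J n, b ∈ K) (h2 : ∀ b ∈ K, ∀ ε > 0, ∃ n, ∃ j ∈ J n, ‖b - j‖ < ε) :
    (K : Set B) = closure (⋃ n, (J n : Set B)) := by
  refine Set.Subset.antisymm (fun b hb => ?_) ?_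
  · rw [Metric.mem_closure_iff]
    intro ε hε
    obtain ⟨n, j, hj, h⟩ := h2 b hb ε hε
    exact ⟨j, Set.mem_iUnion.2 ⟨n, hj⟩, by rwa [dist_eq_norm]⟩
  · refine closure_minimal (Set.iUnion_subset fun n b hb => h1 n b hb) K.isClosed

/-- The approximant in `J n` need not come from `C`. However, `C / ι⁻¹(J n)` embeds isometrically in
`B / J n`, so the distance from `c` to `ι⁻¹(J n)` equals that from `ι c` to `J n`. -/
theorem ClosedIdeal.comap_eq_closure {J : ℕ → ClosedIdeal B} {K : ClosedIdeal B}
    (hK : (K : Set B) = closure (⋃ n, (J n : Set B))) (ι : C →⋆ₙₐ[ℂ] B) :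
    (K.comap ι : Set C) = closure (⋃ n, ((J n).comap ι : Set C)) := by
  refine ClosedIdeal.eq_closure_of (fun n c hc => ClosedIdeal.le_of_eq_closure hK n _ hc)
    fun c hc ε hε => ?_
  obtain ⟨n, j, hj, h⟩ := ClosedIdeal.mem_of_closure hK hc hε
  refine ⟨n, ?_⟩
  have h1 : ‖((J n).comap ι).cls c‖ = ‖(J n).cls (ι c)‖ :=
    ClosedIdeal.norm_cls_eq ((J n).comap ι) ((J n).proj.comp ι)
      (fun a => (ClosedIdeal.cls_eq_zero (J := J n) (a := ι a)).symm) c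
  have h2 : (J n).cls (ι c) = (J n).cls (ι c - j) := by
    rw [ClosedIdeal.cls_eq_cls]; simpa using hj
  have h3 : ‖((J n).comap ι).cls c‖ < ε := by
    rw [h1, h2]; exact (ClosedIdeal.norm_mk_le _).trans_lt h
  obtain ⟨c', hc', hn⟩ := ClosedIdeal.exists_norm_lt (((J n).comap ι).cls c) (sub_pos.2 h3)
  refine ⟨c - c', ClosedIdeal.cls_eq_cls.1 hc'.symm, ?_⟩
  simp only [sub_sub_cancel]; linarith

/-- A lifting problem whose range comes from `C` has a solution that comes from `C`. -/
theorem LiftsInto.exists_lift_of_range (hD : LiftsInto D C) (ι : C →⋆ₙₐ[ℂ] B)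
    {J : ℕ → ClosedIdeal B} (hJ : ∀ m n, m ≤ n → ∀ b ∈ J m, b ∈ J n)
    {K : ClosedIdeal B} (hK : (K : Set B) = closure (⋃ n, (J n : Set B)))
    (φ : D →⋆ₙₐ[ℂ] K.QuotAlg) (hφ : ∀ d, ∃ c, K.cls (ι c) = φ d) :
    ∃ (n : ℕ) (ψ : D →⋆ₙₐ[ℂ] (J n).QuotAlg),
      (ClosedIdeal.factor (ClosedIdeal.le_of_eq_closure hK n)).comp ψ = φ ∧
        ∀ d, ∃ c, ψ d = (J n).cls (ι c) := by
  -- `C / ι⁻¹(K)` embeds in `B / K` with an image containing the range of `φ`. This turns the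
  -- lifting problem into one over `C`.
  let q : (K.comap ι).QuotAlg →⋆ₙₐ[ℂ] K.QuotAlg :=
    (K.comap ι).lift (K.proj.comp ι) fun a ha => ClosedIdeal.cls_eq_zero.2 ha
  have hq : Function.Injective q :=
    ClosedIdeal.lift_injective _ _ _ fun a ha => (ClosedIdeal.cls_eq_zero (a := ι a)).1 ha
  obtain ⟨φ', hφ'⟩ := exists_starHom_of_rel (fun d x => q x = φ d)
    (fun d => by obtain ⟨c, hc⟩ := hφ d; exact ⟨(K.comap ι).cls c, hc⟩)
    (fun a a' b b' h h' => by rw [map_add, map_add, h, h'])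
    (fun c a b h => by rw [map_smul, map_smul, h])
    (fun a a' b b' h h' => by rw [map_mul, map_mul, h, h'])
    (fun a b h => by rw [map_star, map_star, h])
    (fun b h => hq (by rw [h, map_zero, map_zero]))
  obtain ⟨n, ψ, hψ⟩ := hD (fun n => (J n).comap ι) (fun m n h c hc => hJ m n h _ hc) (K.comap ι)
    (ClosedIdeal.comap_eq_closure hK ι) φ'
  refine ⟨n, (((J n).comap ι).lift ((J n).proj.comp ι)
    fun a ha => ClosedIdeal.cls_eq_zero.2 ha).comp ψ, ?_, fun d => ?_⟩
  · ext d
    rw [← (hφ' d (φ' d)).2 rfl, ← hψ]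
    obtain ⟨c, hc⟩ := ClosedIdeal.cls_surjective _ (ψ d)
    simp only [NonUnitalStarAlgHom.comp_apply, ← hc]
    rfl
  · obtain ⟨c, hc⟩ := ClosedIdeal.cls_surjective _ (ψ d)
    exact ⟨c, by simp only [NonUnitalStarAlgHom.comp_apply, ← hc]; rfl⟩

/-- Every element is the product of a nonempty word in `T`, and there are countably many words. -/
theorem countable_subsemigroup_closure {M : Type*} [Semigroup M] {T : Set M} (hT : T.Countable) :
    (Subsemigroup.closure T : Set M).Countable := by
  have := hT.to_subtype
  let g : M → T → M := fun x t => x * t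
  let f : T × List T → M := fun p => p.2.foldl g p.1
  have hf : ∀ (l : List T) (x y : M), l.foldl g (x * y) = x * l.foldl g y := by
    intro l
    induction l with
    | nil => intro x y; rfl
    | cons t l ih => intro x y; simp only [List.foldl_cons, g, mul_assoc, ih]
  refine (Set.countable_range f).mono fun m hm => ?_
  induction hm using Subsemigroup.closure_induction with
  | mem x hx => exact ⟨(⟨x, hx⟩, []), rfl⟩
  | mul x y _ _ hx hy =>
    obtain ⟨⟨t, l⟩, rfl⟩ := hx
    obtain ⟨⟨t', l'⟩, rfl⟩ := hy
    refine ⟨(t, l ++ t' :: l'), ?_⟩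
    simp only [f, List.foldl_append, List.foldl_cons]
    exact hf l' _ _

/-- The generated ⋆-algebra is the linear span of the multiplicative semigroup generated by `S` and
its adjoints, which is countable. -/
theorem exists_separable_subalgebra (S : Set B) (hS : S.Countable) :
    ∃ C : NonUnitalStarSubalgebra ℂ B, IsClosed (C : Set B) ∧ S ⊆ C ∧
      TopologicalSpace.SeparableSpace C := by
  let C := (NonUnitalStarAlgebra.adjoin ℂ S).topologicalClosure
  refine ⟨C, NonUnitalStarSubalgebra.isClosed_topologicalClosure _,
    (NonUnitalStarAlgebra.subset_adjoin ℂ S).trans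
      (NonUnitalStarSubalgebra.le_topologicalClosure _), ?_⟩
  have h1 : (C : Set B) = closure (NonUnitalStarAlgebra.adjoin ℂ S : Set B) := rfl
  have h2 : ((NonUnitalStarAlgebra.adjoin ℂ S : NonUnitalStarSubalgebra ℂ B) : Set B) =
      Submodule.span ℂ (Subsemigroup.closure (S ∪ star S) : Set B) := by
    have := NonUnitalAlgebra.adjoin_eq_span (R := ℂ) (S ∪ star S)
    exact congrArg (fun p : Submodule ℂ B => (p : Set B)) this
  have h3 : (Subsemigroup.closure (S ∪ star S) : Set B).Countable := by
    exact countable_subsemigroup_closure (hS.union (by rw [← Set.image_star]; exact hS.image star))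
  have : TopologicalSpace.IsSeparable (C : Set B) := by
    rw [h1, h2]
    exact h3.isSeparable.span.closure
  exact this.separableSpace

/-- Since `D` is separable, the range of `φ` comes from a separable subalgebra of `B`: take the one
generated by lifts of the images of a dense sequence. The lifting problem is then solved inside it.
-/
theorem IsSemiprojective.liftsAll (hD : IsSemiprojective D) : LiftsAll D := by
  obtain ⟨hs, -, hD⟩ := hD
  intro B _ J hJ K hK φ
  choose l hl using K.cls_surjective
  obtain ⟨C, hC, hSC, hCs⟩ := exists_separable_subalgebra
    (Set.range fun n => l (φ (TopologicalSpace.denseSeq D n))) (Set.countable_range _)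
  let _ : NonUnitalCStarAlgebra C := NonUnitalStarSubalgebra.nonUnitalCStarAlgebra (h_closed := hC) C
  let ι : C →⋆ₙₐ[ℂ] B := NonUnitalStarSubalgebraClass.subtype C
  obtain ⟨n, ψ, hψ, -⟩ := LiftsInto.exists_lift_of_range (C := C) (hD C) ι hJ hK φ fun d => by
    have hcl := isClosed_range_starHom (K.proj.comp ι)
    refine (hcl.preimage (starHom_continuous φ)).closure_subset_iff.2 ?_
      ((TopologicalSpace.denseRange_denseSeq D).closure_eq ▸ Set.mem_univ d)
    rintro _ ⟨n, rfl⟩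
    exact ⟨⟨_, hSC ⟨n, rfl⟩⟩, hl _⟩
  exact ⟨n, ψ, hψ⟩

theorem LiftsAll.of_equiv (hD : LiftsAll D) (e : C ≃⋆ₐ[ℂ] D) : LiftsAll C := by
  intro B _ J hJ K hK φ
  obtain ⟨n, ψ, hψ⟩ := hD B J hJ K hK (φ.comp (e.symm : D →⋆ₙₐ[ℂ] C))
  refine ⟨n, ψ.comp (e : C →⋆ₙₐ[ℂ] D), ?_⟩
  rw [← NonUnitalStarAlgHom.comp_assoc, hψ]
  ext c
  simp

end Lifting

/-! ### Strictly positive elements -/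

section StrictlyPositive

variable {D : Type u} [NonUnitalCStarAlgebra D]

/-- Multiply Bernoulli's inequality `1 + k x ≤ (1 + x) ^ k` by `(1 - x) ^ k` and use `(1 - x) (1 +
x) ≤ 1`. -/
theorem mul_one_sub_pow_le {x : ℝ} (h0 : 0 ≤ x) (h1 : x ≤ 1) {k : ℕ} (hk : 0 < k) :
    x * (1 - x) ^ k ≤ 1 / k := by
  have hb := one_add_mul_le_pow (a := x) (by linarith) k
  have h3 : (1 - x) ^ k * (1 + x) ^ k ≤ 1 := by
    rw [← mul_pow]; exact pow_le_one₀ (by nlinarith) (by nlinarith)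
  have h4 : 0 ≤ (1 - x) ^ k := pow_nonneg (by linarith) k
  have hk' : (0 : ℝ) < k := Nat.cast_pos.2 hk
  rw [le_div_iff₀ hk']
  nlinarith [mul_le_mul_of_nonneg_left hb h4]

/-- With `y` a geometric sum in `1 - h` applied to `d`, one has `d - h y = (1 - h) ^ m d`. As `c d
d* ≤ h`, `c` times its squared norm is at most the norm of `(1 - h) ^ m h (1 - h) ^ m`, which is
small by functional calculus. -/
theorem exists_mul_approx [PartialOrder D] [StarOrderedRing D] {h d : D} (h0 : 0 ≤ h) (h1 : ‖h‖ ≤ 1)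
    {c : ℝ} (hc : 0 < c) (hd : c • (d * star d) ≤ h) {ε : ℝ} (hε : 0 < ε) :
    ∃ y, ‖d - h * y‖ < ε := by
  let _ := CStarAlgebra.spectralOrder (Unitization ℂ D)
  have _ := CStarAlgebra.spectralOrderedRing (Unitization ℂ D)
  set x : Unitization ℂ D := (h : Unitization ℂ D) with hx
  have hx0 : 0 ≤ x := by
    obtain ⟨b, rfl⟩ := CStarAlgebra.nonneg_iff_eq_star_mul_self.1 h0
    rw [hx, Unitization.inr_mul, Unitization.inr_star]; exact star_mul_self_nonneg _
  have hxs : IsSelfAdjoint x := .of_nonneg hx0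
  have hx1 : x ≤ 1 := by
    rw [← CStarAlgebra.norm_le_one_iff_of_nonneg _ hx0, Unitization.norm_inr]; exact h1
  -- This makes the bound `1 / (2 m)` on `c ‖(1 - h) ^ m d‖ ^ 2` smaller than `c ε ^ 2`.
  obtain ⟨m, hm⟩ := exists_nat_gt (1 / (c * ε ^ 2))
  have hm0 : 0 < m := by
    have : 0 < 1 / (c * ε ^ 2) := by positivity
    exact_mod_cast this.trans hm
  set e := (1 - x) ^ m with he
  have hes : star e = e := by
    rw [he, star_pow, star_sub, star_one, hxs.star_eq]
  obtain ⟨y, hy⟩ : ∃ y : D, (∑ i ∈ Finset.range m, (1 - x) ^ i) * (d : Unitization ℂ D) = y := by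
    generalize (∑ i ∈ Finset.range m, (1 - x) ^ i) = u
    refine ⟨u.fst • d + u.snd * d, ?_⟩
    ext <;> simp
  refine ⟨y, ?_⟩
  have h2 : ((d - h * y : D) : Unitization ℂ D) = e * d := by
    have := mul_neg_geom_sum (1 - x) m
    rw [sub_sub_cancel] at this
    rw [Unitization.inr_sub, Unitization.inr_mul, ← hy, ← hx, ← mul_assoc, this, sub_mul, one_mul,
      sub_sub_cancel]
  have h3 : ‖e * x * e‖ ≤ 1 / (2 * m : ℕ) := by
    have h5 : e * x * e = cfc (fun t : ℝ => t * (1 - t) ^ (2 * m)) x := by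
      have e1 : cfc (fun t : ℝ => (1 - t)) x = 1 - x := by
        rw [cfc_sub .., cfc_const_one ℝ x, cfc_id' ℝ x]
      rw [cfc_mul .., cfc_id' ℝ x, cfc_pow .., e1, he]
      have hcm : Commute (1 - x) x := (Commute.one_left x).sub_left (Commute.refl x)
      rw [(hcm.pow_left m).eq, mul_assoc, ← pow_add, two_mul]
    rw [h5]
    refine norm_cfc_le (by positivity) fun t ht => ?_
    have t0 : 0 ≤ t := spectrum_nonneg_of_nonneg hx0 ht
    have t1 : t ≤ 1 := by
      have := (CFC.le_one_iff x (R := ℝ)).1 hx1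
      exact this t ht
    rw [Real.norm_of_nonneg (mul_nonneg t0 (pow_nonneg (by linarith) _))]
    exact_mod_cast mul_one_sub_pow_le t0 t1 (k := 2 * m) (by omega)
  have h4 : c * ‖e * (d : Unitization ℂ D)‖ ^ 2 ≤ 1 / (2 * m : ℕ) := by
    have h6 : c • ((d : Unitization ℂ D) * star (d : Unitization ℂ D)) ≤ x := by
      rw [← sub_nonneg] at hd ⊢
      obtain ⟨b, hb⟩ := CStarAlgebra.nonneg_iff_eq_star_mul_self.1 hd
      have : x - c • ((d : Unitization ℂ D) * star (d : Unitization ℂ D)) = star (b : Unitization ℂ D) * b := by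
        rw [hx, ← Unitization.inr_star, ← Unitization.inr_mul, ← Unitization.inr_star,
          ← Unitization.inr_mul, ← hb, Unitization.inr_sub, Unitization.inr_smul]
      rw [this]; exact star_mul_self_nonneg _
    have h7 := star_left_conjugate_le_conjugate h6 e
    rw [hes] at h7
    refine le_trans ?_ h3
    refine le_trans (le_of_eq ?_) (CStarAlgebra.norm_le_norm_of_nonneg_of_le (a := e * (c • ((d : Unitization ℂ D) * star (d : Unitization ℂ D))) * e) ?_ h7)
    · rw [mul_smul_comm, smul_mul_assoc, norm_smul, Real.norm_of_nonneg hc.le, sq,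
        ← CStarRing.norm_self_mul_star, star_mul, hes]
      simp only [mul_assoc]
    · have := star_left_conjugate_nonneg (smul_nonneg hc.le (mul_star_self_nonneg (d : Unitization ℂ D))) e
      rwa [hes] at this
  rw [← Unitization.norm_inr (𝕜 := ℂ), h2]
  refine lt_of_pow_lt_pow_left₀ 2 hε.le ?_
  have h8 : (1 : ℝ) / (2 * m : ℕ) < c * ε ^ 2 := by
    have hm' : (0 : ℝ) < m := Nat.cast_pos.2 hm0
    rw [div_lt_iff₀ (by positivity)] at hm ⊢
    push_cast
    nlinarith [mul_pos hc (pow_pos hε 2)]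
  exact lt_of_mul_lt_mul_left (h4.trans_lt h8) hc.le

/-- A separable C⋆-algebra `D` has a positive element `h` for which `h D h` is dense. -/
theorem exists_strictlyPositive [TopologicalSpace.SeparableSpace D] :
    ∃ k : D, ∀ d : D, ∀ ε > 0, ∃ y, ‖d - star k * k * y * (star k * k)‖ < ε := by
  let _ := CStarAlgebra.spectralOrder D
  have _ := CStarAlgebra.spectralOrderedRing D
  let a := TopologicalSpace.denseSeq D
  -- The weights bound the `n`-th term by `(1 / 2) ^ (n + 1)`, so the sum `h` exists, has norm at
  -- most one and dominates a multiple of each `a n (a n)*`.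
  let c : ℕ → ℝ := fun n => (1 / 2) ^ (n + 1) / (1 + ‖a n‖ ^ 2)
  have hc : ∀ n, 0 < c n := fun n => by positivity
  let f : ℕ → D := fun n => c n • (a n * star (a n))
  have hf0 : ∀ n, 0 ≤ f n := fun n => smul_nonneg (hc n).le (mul_star_self_nonneg _)
  have hfn : ∀ n, ‖f n‖ ≤ (1 / 2) * (1 / 2) ^ n := fun n => by
    rw [norm_smul, Real.norm_of_nonneg (hc n).le, CStarRing.norm_self_mul_star]
    have : c n * (‖a n‖ * ‖a n‖) = (1 / 2) ^ (n + 1) * (‖a n‖ ^ 2 / (1 + ‖a n‖ ^ 2)) := by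
      simp only [c]; ring
    rw [this, pow_succ']
    refine mul_le_of_le_one_right (by positivity) ?_
    rw [div_le_one (by positivity)]; linarith
  have hgs : HasSum (fun n : ℕ => (1 / 2 : ℝ) * (1 / 2) ^ n) 1 := by
    have := (hasSum_geometric_of_lt_one (r := (1 / 2 : ℝ)) (by norm_num) (by norm_num)).mul_left (1/2)
    norm_num at this ⊢
    exact this
  have hfs : Summable f := .of_norm_bounded hgs.summable hfn
  set h := ∑' n, f n with hh
  have hfh : ∀ n, f n ≤ h := fun n => hfs.le_tsum n fun m _ => hf0 m
  have hh0 : 0 ≤ h := (hf0 0).trans (hfh 0)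
  have hh1 : ‖h‖ ≤ 1 := by
    have := tsum_of_norm_bounded hgs hfn
    exact this
  have key : ∀ d : D, ∀ ε > 0, ∃ y, ‖d - h * y‖ < ε := by
    intro d ε hε
    obtain ⟨n, hn⟩ := (TopologicalSpace.denseRange_denseSeq D).exists_dist_lt d (half_pos hε)
    obtain ⟨y, hy⟩ := exists_mul_approx hh0 hh1 (hc n) (hfh n) (half_pos hε)
    refine ⟨y, ?_⟩
    rw [dist_eq_norm] at hn
    calc ‖d - h * y‖ = ‖(d - a n) + (a n - h * y)‖ := by rw [sub_add_sub_cancel]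
      _ ≤ _ := norm_add_le _ _
      _ < ε := by linarith
  obtain ⟨k, hk⟩ := CStarAlgebra.nonneg_iff_eq_star_mul_self.1 hh0
  refine ⟨k, fun d ε hε => ?_⟩
  rw [← hk]
  -- A one-sided approximation `h y` of `d`, followed by one of the adjoint of `y`, gives a
  -- two-sided one because `h` is self-adjoint.
  obtain ⟨y, hy⟩ := key d (ε / 2) (half_pos hε)
  obtain ⟨z, hz⟩ := key (star y) (ε / 2) (half_pos hε)
  have hhs : star h = h := by rw [hk]; simp
  refine ⟨star z, ?_⟩
  have hz' : ‖y - star z * h‖ < ε / 2 := by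
    rw [← norm_star, star_sub, star_mul, star_star, hhs]; exact hz
  calc ‖d - h * star z * h‖ = ‖(d - h * y) + h * (y - star z * h)‖ := by
        congr 1; noncomm_ring
    _ ≤ ‖d - h * y‖ + ‖h‖ * ‖y - star z * h‖ := (norm_add_le _ _).trans
        (by gcongr; exact norm_mul_le _ _)
    _ < ε := by nlinarith [norm_nonneg (y - star z * h)]

end StrictlyPositive

/-! ### Finite direct sums -/

section Sums

variable {D₁ D₂ : Type u} [NonUnitalCStarAlgebra D₁] [NonUnitalCStarAlgebra D₂]

/-- The two-sided annihilator of a set and its adjoint. -/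
def cstarAnnihilator {B : Type u} [NonUnitalCStarAlgebra B] (S : Set B) :
    NonUnitalStarSubalgebra ℂ B where
  carrier := {x | ∀ s ∈ S, x * s = 0 ∧ s * x = 0 ∧ star x * s = 0 ∧ s * star x = 0}
  add_mem' ha hb s hs := by
    obtain ⟨h1, h2, h3, h4⟩ := ha s hs
    obtain ⟨g1, g2, g3, g4⟩ := hb s hs
    simp [add_mul, mul_add, *]
  zero_mem' := by simp
  mul_mem' {a b} ha hb s hs := by
    obtain ⟨h1, h2, h3, h4⟩ := ha s hs
    obtain ⟨g1, g2, g3, g4⟩ := hb s hs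
    refine ⟨by rw [mul_assoc, g1, mul_zero], by rw [← mul_assoc, h2, zero_mul], ?_, ?_⟩
    · rw [star_mul, mul_assoc, h3, mul_zero]
    · rw [star_mul, ← mul_assoc, g4, zero_mul]
  smul_mem' c a ha s hs := by
    obtain ⟨h1, h2, h3, h4⟩ := ha s hs
    simp [smul_mul_assoc, mul_smul_comm, *]
  star_mem' {a} ha s hs := by
    obtain ⟨h1, h2, h3, h4⟩ := ha s hs
    simp [*]

theorem isClosed_cstarAnnihilator {B : Type u} [NonUnitalCStarAlgebra B] (S : Set B) :
    IsClosed (cstarAnnihilator S : Set B) := by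
  have : (cstarAnnihilator S : Set B) = ⋂ s ∈ S, {x : B | x * s = 0} ∩ {x | s * x = 0} ∩
      {x | star x * s = 0} ∩ {x | s * star x = 0} := by
    ext x
    simp only [Set.mem_iInter, Set.mem_inter_iff, Set.mem_ofPred_eq, and_assoc]
    rfl
  rw [this]
  refine isClosed_biInter fun s _ => ?_
  refine ((IsClosed.inter ?_ ?_).inter ?_).inter ?_ <;>
    exact isClosed_eq (by fun_prop) continuous_const

/-- Products `k y k` are dense in `D` and are sent to classes of elements `b z b` of `H`. As the
image of `H` in the quotient is closed, it contains the range of `φ`. -/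
theorem exists_lift_in_closed_subalgebra {D B : Type u} [NonUnitalCStarAlgebra D]
    [NonUnitalCStarAlgebra B] (hD : LiftsAll D) (H : NonUnitalStarSubalgebra ℂ B)
    (hH : IsClosed (H : Set B))
    {J : ℕ → ClosedIdeal B} (hJ : ∀ m n, m ≤ n → ∀ b ∈ J m, b ∈ J n)
    {K : ClosedIdeal B} (hK : (K : Set B) = closure (⋃ n, (J n : Set B)))
    (φ : D →⋆ₙₐ[ℂ] K.QuotAlg) (k : D) (hk : ∀ d : D, ∀ ε > 0, ∃ y, ‖d - k * y * k‖ < ε)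
    (b : B) (hb : K.cls b = φ k) (hbH : ∀ y, b * y * b ∈ H) :
    ∃ (n : ℕ) (ψ : D →⋆ₙₐ[ℂ] (J n).QuotAlg),
      (ClosedIdeal.factor (ClosedIdeal.le_of_eq_closure hK n)).comp ψ = φ ∧
        ∀ d, ∃ c ∈ H, ψ d = (J n).cls c := by
  let _ : NonUnitalCStarAlgebra H := NonUnitalStarSubalgebra.nonUnitalCStarAlgebra (h_closed := hH) H
  let ι : H →⋆ₙₐ[ℂ] B := NonUnitalStarSubalgebraClass.subtype H
  obtain ⟨n, ψ, h1, h2⟩ := LiftsInto.exists_lift_of_range (hD H) ι hJ hK φ fun d => by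
    have hcl := isClosed_range_starHom (K.proj.comp ι)
    have : φ d ∈ Set.range (K.proj.comp ι) := by
      rw [← hcl.closure_eq, Metric.mem_closure_iff]
      intro ε hε
      obtain ⟨y, hy⟩ := hk d ε hε
      obtain ⟨z, hz⟩ := K.cls_surjective (φ y)
      refine ⟨K.cls (b * z * b), ⟨⟨_, hbH z⟩, rfl⟩, ?_⟩
      rw [ClosedIdeal.cls_mul, ClosedIdeal.cls_mul, hz, hb, ← map_mul, ← map_mul, dist_eq_norm,
        ← map_sub]
      exact (starHom_norm_le φ _).trans_lt hy
    exact this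
  exact ⟨n, ψ, h1, fun d => by obtain ⟨c, hc⟩ := h2 d; exact ⟨c, c.2, hc⟩⟩

/-- The restrictions of `φ` to the summands lift separately; the point is to make the lifts
orthogonal. Strictly positive elements of the summands have orthogonal images, which lift to
orthogonal positive elements. The two lifts are then chosen in subalgebras of `B` that annihilate
each other. -/
theorem LiftsAll.prod [TopologicalSpace.SeparableSpace D₁] [TopologicalSpace.SeparableSpace D₂]
    (h₁ : LiftsAll D₁) (h₂ : LiftsAll D₂) : LiftsAll (D₁ × D₂) := by
  intro B _ J hJ K hK φ
  let _ := CStarAlgebra.spectralOrder B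
  have _ := CStarAlgebra.spectralOrderedRing B
  let _ := CStarAlgebra.spectralOrder K.QuotAlg
  have _ := CStarAlgebra.spectralOrderedRing K.QuotAlg
  obtain ⟨k₁, hk₁⟩ := exists_strictlyPositive (D := D₁)
  obtain ⟨k₂, hk₂⟩ := exists_strictlyPositive (D := D₂)
  let ι₁ : D₁ →⋆ₙₐ[ℂ] D₁ × D₂ := NonUnitalStarAlgHom.inl ℂ D₁ D₂
  let ι₂ : D₂ →⋆ₙₐ[ℂ] D₁ × D₂ := NonUnitalStarAlgHom.inr ℂ D₁ D₂
  let φ₁ := φ.comp ι₁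
  let φ₂ := φ.comp ι₂
  have h12 : ∀ x y, φ₁ x * φ₂ y = 0 := fun x y => by
    have : ι₁ x * ι₂ y = 0 := Prod.ext (mul_zero x) (zero_mul y)
    calc φ₁ x * φ₂ y = φ (ι₁ x * ι₂ y) := (map_mul φ _ _).symm
      _ = 0 := by rw [this, map_zero]
  have hsa : ∀ x : D₁, star (φ₁ (star x * x)) = φ₁ (star x * x) := fun x => by
    rw [← map_star]; simp
  have hsa' : ∀ x : D₂, star (φ₂ (star x * x)) = φ₂ (star x * x) := fun x => by
    rw [← map_star]; simp
  have hpos : ∀ x : D₁, 0 ≤ φ₁ (star x * x) := fun x => by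
    rw [map_mul, map_star]; exact star_mul_self_nonneg _
  have hpos' : ∀ x : D₂, 0 ≤ φ₂ (star x * x) := fun x => by
    rw [map_mul, map_star]; exact star_mul_self_nonneg _
  -- A self-adjoint lift of the difference splits into orthogonal parts. By uniqueness of such a
  -- decomposition in the quotient, `b⁺` and `b⁻` lift the two strictly positive images.
  obtain ⟨b₀, hb₀⟩ := K.cls_surjective (φ₁ (star k₁ * k₁) - φ₂ (star k₂ * k₂))
  set b : B := (1 / 2 : ℂ) • (b₀ + star b₀) with hbdef
  have hbs : IsSelfAdjoint b := by
    rw [IsSelfAdjoint, hbdef, star_smul, star_add, star_star, add_comm]; simp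
  have hb : K.cls b = φ₁ (star k₁ * k₁) - φ₂ (star k₂ * k₂) := by
    rw [hbdef, ClosedIdeal.cls_smul, ClosedIdeal.cls_add, ClosedIdeal.cls_star, hb₀, star_sub,
      hsa, hsa', ← two_smul ℂ, smul_smul]
    norm_num
  have hproj : ∀ x : B, 0 ≤ x → 0 ≤ K.cls x := fun x hx => by
    obtain ⟨y, rfl⟩ := CStarAlgebra.nonneg_iff_eq_star_mul_self.1 hx
    rw [ClosedIdeal.cls_mul, ClosedIdeal.cls_star]; exact star_mul_self_nonneg _
  have hb' : K.cls b = K.cls b⁺ - K.cls b⁻ := by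
    conv_lhs => rw [← CFC.posPart_sub_negPart b hbs]
    exact map_sub K.proj _ _
  obtain ⟨p1, p2⟩ := CFC.posPart_negPart_unique hb' (by
    rw [← ClosedIdeal.cls_mul, CFC.posPart_mul_negPart]; exact map_zero K.proj)
    (hproj _ (CFC.posPart_nonneg b)) (hproj _ (CFC.negPart_nonneg b))
  obtain ⟨q1, q2⟩ := CFC.posPart_negPart_unique hb (h12 _ _) (hpos _) (hpos' _)
  have e1 : K.cls b⁺ = φ₁ (star k₁ * k₁) := p1.symm.trans q1
  have e2 : K.cls b⁻ = φ₂ (star k₂ * k₂) := p2.symm.trans q2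
  have bp : star b⁺ = b⁺ := (IsSelfAdjoint.of_nonneg (CFC.posPart_nonneg b)).star_eq
  have bn : star b⁻ = b⁻ := (IsSelfAdjoint.of_nonneg (CFC.negPart_nonneg b)).star_eq
  have pn := CFC.posPart_mul_negPart b
  have np := CFC.negPart_mul_posPart b
  let H₁ := cstarAnnihilator {b⁻}
  -- A double annihilator: `H₁` contains `b⁺ B b⁺` since `b⁻` kills it, `H₂` contains `b⁻ B b⁻`, and
  -- `H₁ H₂ = 0` by construction.
  let H₂ := cstarAnnihilator (H₁ : Set B)
  have hH₁ : ∀ y, b⁺ * y * b⁺ ∈ H₁ := by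
    rintro y _ rfl
    simp only [star_mul, bp, mul_assoc, pn, mul_zero, true_and]
    simp only [← mul_assoc, np, zero_mul, true_and]
  have hH₂ : ∀ y, b⁻ * y * b⁻ ∈ H₂ := by
    intro y x hx
    obtain ⟨x1, x2, x3, x4⟩ := hx b⁻ rfl
    simp only [star_mul, bn, mul_assoc, x2, mul_zero, true_and]
    simp only [← mul_assoc, x1, zero_mul, true_and]
  obtain ⟨n₁, ψ₁, f₁, g₁⟩ := exists_lift_in_closed_subalgebra h₁ H₁ (isClosed_cstarAnnihilator _)
    hJ hK φ₁ _ hk₁ _ e1 hH₁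
  obtain ⟨n₂, ψ₂, f₂, g₂⟩ := exists_lift_in_closed_subalgebra h₂ H₂ (isClosed_cstarAnnihilator _)
    hJ hK φ₂ _ hk₂ _ e2 hH₂
  let n := max n₁ n₂
  let χ₁ := (ClosedIdeal.factor (hJ n₁ n (le_max_left _ _))).comp ψ₁
  let χ₂ := (ClosedIdeal.factor (hJ n₂ n (le_max_right _ _))).comp ψ₂
  have c12 : ∀ x y, χ₁ x * χ₂ y = 0 ∧ χ₂ y * χ₁ x = 0 := fun x y => by
    obtain ⟨c, hc, hc'⟩ := g₁ x
    obtain ⟨d, hd, hd'⟩ := g₂ y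
    simp only [χ₁, χ₂, NonUnitalStarAlgHom.comp_apply, hc', hd', ClosedIdeal.factor_cls,
      ← ClosedIdeal.cls_mul]
    obtain ⟨z1, z2, -, -⟩ := hd c hc
    rw [z1, z2]
    exact ⟨map_zero (J n).proj, map_zero (J n).proj⟩
  have k₁ : ∀ x, ClosedIdeal.factor (ClosedIdeal.le_of_eq_closure hK n) (χ₁ x) = φ₁ x := fun x => by
    rw [← f₁]
    simp only [χ₁, NonUnitalStarAlgHom.comp_apply]
    obtain ⟨c, -, hc'⟩ := g₁ x
    rw [hc']; rfl
  have k₂ : ∀ x, ClosedIdeal.factor (ClosedIdeal.le_of_eq_closure hK n) (χ₂ x) = φ₂ x := fun x => by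
    rw [← f₂]
    simp only [χ₂, NonUnitalStarAlgHom.comp_apply]
    obtain ⟨c, -, hc'⟩ := g₂ x
    rw [hc']; rfl
  refine ⟨n, { toFun := fun p => χ₁ p.1 + χ₂ p.2
               map_smul' := fun c p => by simp
               map_zero' := by simp
               map_add' := fun p q => by simp only [Prod.fst_add, Prod.snd_add, map_add]; abel
               map_mul' := fun p q => by
                simp only [Prod.fst_mul, Prod.snd_mul, map_mul, add_mul, mul_add, (c12 _ _).1,
                  (c12 _ _).2]
                abel
               map_star' := fun p => by simp [map_star] }, ?_⟩
  refine NonUnitalStarAlgHom.ext fun p => ?_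
  have e : ClosedIdeal.factor (ClosedIdeal.le_of_eq_closure hK n) (χ₁ p.1 + χ₂ p.2) = φ p := by
    rw [map_add, k₁, k₂]
    change φ (ι₁ p.1) + φ (ι₂ p.2) = φ p
    rw [← map_add]
    congr 1
    ext <;> simp [ι₁, ι₂]
  exact e

/-- The splitting of a finite product. -/
def piFinSuccStarEquiv {n : ℕ} (S : Fin (n + 1) → Type u) [∀ i, NonUnitalCStarAlgebra (S i)] :
    (∀ i, S i) ≃⋆ₐ[ℂ] S 0 × ∀ i : Fin n, S i.succ where
  toFun f := (f 0, fun i => f i.succ)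
  invFun p := Fin.cons p.1 p.2
  left_inv f := Fin.cons_self_tail f
  right_inv p := by ext <;> simp
  map_add' _ _ := rfl
  map_mul' _ _ := rfl
  map_star' _ := rfl
  map_smul' _ _ := rfl

theorem LiftsAll.pi {n : ℕ} (S : Fin n → Type u) [∀ i, NonUnitalCStarAlgebra (S i)]
    [∀ i, TopologicalSpace.SeparableSpace (S i)] (hS : ∀ i, LiftsAll (S i)) :
    LiftsAll (∀ i, S i) := by
  induction n with
  | zero =>
    intro B _ J hJ K hK φ
    refine ⟨0, 0, NonUnitalStarAlgHom.ext fun d => ?_⟩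
    have : d = 0 := Subsingleton.elim _ _
    rw [this, map_zero, map_zero]
  | succ n ih =>
    exact ((hS 0).prod (ih (fun i => S i.succ) fun i => hS i.succ)).of_equiv (piFinSuccStarEquiv S)

theorem starEquiv_continuous (e : D₁ ≃⋆ₐ[ℂ] D₂) : Continuous e :=
  starHom_continuous (e : D₁ →⋆ₙₐ[ℂ] D₂)

/-- Finite sums of semiprojective simple C⋆-algebras are separable and have the lifting property,
and injectivity of ⋆-homomorphisms is detected by finitely many elements. -/
theorem IsSumOfSemiprojectiveSimple.properties (hD : IsSumOfSemiprojectiveSimple D₁) :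
    TopologicalSpace.SeparableSpace D₁ ∧ LiftsAll D₁ ∧
      ∃ T : Finset D₁, 0 ∉ T ∧ ∀ (B : Type u) [NonUnitalCStarAlgebra B] (φ : D₁ →⋆ₙₐ[ℂ] B),
        (∀ t ∈ T, φ t ≠ 0) → Function.Injective φ := by
  classical
  obtain ⟨n, S, inst, hS, ⟨e⟩⟩ := hD
  have hsep : ∀ i, TopologicalSpace.SeparableSpace (S i) := fun i => (hS i).2.1
  refine ⟨?_, (LiftsAll.pi S fun i => (hS i).2.liftsAll).of_equiv e, ?_⟩
  · exact (e.symm.surjective.denseRange).separableSpace (starEquiv_continuous e.symm)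
  have hne : ∀ i, ∃ s : S i, s ≠ 0 := fun i => by
    have := (hS i).1.1
    exact exists_ne 0
  choose s hs using hne
  let ι : ∀ i, S i →⋆ₙₐ[ℂ] D₁ := fun i =>
    (e.symm : (∀ i, S i) →⋆ₙₐ[ℂ] D₁).comp
      { toFun := Pi.single i
        map_smul' := fun c x => by rw [MonoidHom.id_apply, Pi.single_smul]
        map_zero' := Pi.single_zero i
        map_add' := fun x y => Pi.single_add i x y
        map_mul' := fun x y => Pi.single_mul i x y
        map_star' := fun x => by
          ext j
          by_cases h : j = i
          · subst h; simp
          · simp [h] }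
  have hι : ∀ i x, e (ι i x) = Pi.single i x := fun i x => e.apply_symm_apply _
  refine ⟨Finset.univ.image fun i => ι i (s i), ?_, fun B _ φ hφ => ?_⟩
  · rw [Finset.mem_image]
    rintro ⟨i, -, h⟩
    have := hι i (s i)
    rw [h, map_zero] at this
    exact hs i (by simpa using (congrFun this i).symm)
  · refine (injective_iff_map_eq_zero φ).2 fun d hd => ?_
    apply e.injective
    rw [map_zero]
    ext i
    -- If `φ d = 0`, this product puts the `i`-th coordinate of `d`, times its adjoint, into the
    -- kernel of `φ` on the `i`-th summand. By simplicity that kernel is zero or everything, and the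
    -- test element excludes the latter.
    have h1 : d * ι i (star (e d i)) = ι i (e d i * star (e d i)) := by
      apply EquivLike.injective e
      rw [map_mul, hι, hι]
      ext j
      by_cases h : j = i
      · subst h; simp
      · simp [h]
    have h2 : φ (ι i (e d i * star (e d i))) = 0 := by rw [← h1, map_mul, hd, zero_mul]
    rcases (hS i).1.2 (ClosedIdeal.ker (φ.comp (ι i))) with h | h
    · have := h _ h2
      rwa [CStarRing.mul_star_self_eq_zero_iff] at this
    · exact absurd (h (s i)) (hφ _ (Finset.mem_image_of_mem _ (Finset.mem_univ i)))

end Sums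

/-! ### Bounded families -/

section BoundedFamilies

open scoped ENNReal

variable {I : Type u} {F : I → Type u} [∀ i, NonUnitalCStarAlgebra (F i)]
  {D : Type u} [NonUnitalCStarAlgebra D]

/-- The ⋆-homomorphism into the algebra of bounded families with given components. -/
noncomputable def lpHom (ψ : ∀ i, D →⋆ₙₐ[ℂ] F i) : D →⋆ₙₐ[ℂ] lp F ∞ where
  toFun d := ⟨fun i => ψ i d, memℓp_infty ⟨‖d‖, by
    rintro _ ⟨i, rfl⟩; exact starHom_norm_le (ψ i) d⟩⟩
  map_smul' c d := Subtype.ext (funext fun i => map_smul (ψ i) c d)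
  map_zero' := Subtype.ext (funext fun i => map_zero (ψ i))
  map_add' a b := Subtype.ext (funext fun i => map_add (ψ i) a b)
  map_mul' a b := Subtype.ext (funext fun i => map_mul (ψ i) a b)
  map_star' a := Subtype.ext (funext fun i => map_star (ψ i) a)

theorem lpHom_apply (ψ : ∀ i, D →⋆ₙₐ[ℂ] F i) (d : D) (i : I) : lpHom ψ d i = ψ i d := rfl

variable (F) in
/-- The coordinates of a bounded family. -/
noncomputable def lpEval (i : I) : lp F ∞ →⋆ₙₐ[ℂ] F i where
  toFun a := a i
  map_smul' _ _ := rfl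
  map_zero' := rfl
  map_add' _ _ := rfl
  map_mul' _ _ := rfl
  map_star' _ := rfl

theorem lpEval_apply (i : I) (a : lp F ∞) : lpEval F i a = a i := rfl

theorem lp_norm_le {a : lp F ∞} {c : ℝ} (hc : 0 ≤ c) (h : ∀ i, ‖a i‖ ≤ c) : ‖a‖ ≤ c :=
  lp.norm_le_of_forall_le hc h

theorem lp_norm_apply_le (a : lp F ∞) (i : I) : ‖a i‖ ≤ ‖a‖ :=
  lp.norm_apply_le_norm ENNReal.top_ne_zero a i

end BoundedFamilies

/-! ### Bounded sequences modulo null sequences, and stability of ⋆-homomorphisms. -/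

section SequenceAlgebras

open scoped ENNReal

/-- The ideal of sequences that converge to zero. -/
noncomputable def c0Ideal (A : ULift.{u} ℕ → Type u) [∀ i, NonUnitalCStarAlgebra (A i)] :
    ClosedIdeal (lp A ∞) where
  carrier := {a | Tendsto (fun n : ℕ => ‖a ⟨n⟩‖) atTop (𝓝 0)}
  add_mem' {a b} ha hb := by
    refine squeeze_zero (fun _ => norm_nonneg _) (fun n => norm_add_le (a ⟨n⟩) (b ⟨n⟩)) ?_
    simpa using ha.add hb
  zero_mem' := by
    simp
  smul_mem' c a ha := by
    simpa [norm_smul] using Tendsto.const_mul ‖c‖ ha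
  mul_mem_left' a j hj := by
    refine squeeze_zero (fun _ => norm_nonneg _) (fun n => (norm_mul_le (a ⟨n⟩) (j ⟨n⟩)).trans
      (mul_le_mul_of_nonneg_right (lp_norm_apply_le a _) (norm_nonneg _))) ?_
    simpa using Tendsto.const_mul ‖a‖ hj
  mul_mem_right' {j} a hj := by
    refine squeeze_zero (fun _ => norm_nonneg _) (fun n => (norm_mul_le (j ⟨n⟩) (a ⟨n⟩)).trans
      (mul_le_mul_of_nonneg_left (lp_norm_apply_le a _) (norm_nonneg _))) ?_
    simpa using Tendsto.mul_const ‖a‖ hj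
  isClosed' := by
    refine isClosed_of_closure_subset fun a ha => Metric.tendsto_atTop.2 fun ε hε => ?_
    obtain ⟨b, hb, hab⟩ := Metric.mem_closure_iff.1 ha (ε / 2) (half_pos hε)
    obtain ⟨N, hN⟩ := Metric.tendsto_atTop.1 hb (ε / 2) (half_pos hε)
    refine ⟨N, fun n hn => ?_⟩
    have h1 := hN n hn
    rw [dist_zero_right, norm_norm] at h1 ⊢
    have h2 : ‖a ⟨n⟩ - b ⟨n⟩‖ ≤ ‖a - b‖ := lp_norm_apply_le (a - b) ⟨n⟩
    rw [dist_eq_norm] at hab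
    have h3 := norm_le_norm_add_norm_sub' (a ⟨n⟩) (b ⟨n⟩)
    linarith

theorem mem_c0Ideal {A : ULift.{u} ℕ → Type u} [∀ i, NonUnitalCStarAlgebra (A i)] {a : lp A ∞} :
    a ∈ c0Ideal A ↔ Tendsto (fun n : ℕ => ‖a ⟨n⟩‖) atTop (𝓝 0) := Iff.rfl

/-- This makes a lifting problem out of `S`: its values lie in the range of `T`, a copy of `P / ker
T`. -/
theorem exists_hom_to_quot_ker {P Q D : Type u} [NonUnitalCStarAlgebra P] [NonUnitalCStarAlgebra Q]
    [NonUnitalCStarAlgebra D] (T : P →⋆ₙₐ[ℂ] Q) (S : D →⋆ₙₐ[ℂ] Q) (h : ∀ d, ∃ b, T b = S d) :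
    ∃ φ : D →⋆ₙₐ[ℂ] (ClosedIdeal.ker T).QuotAlg,
      ∀ d b, φ d = (ClosedIdeal.ker T).cls b → T b = S d := by
  let q := (ClosedIdeal.ker T).lift T fun _ h => h
  have hq : Function.Injective q := ClosedIdeal.lift_injective _ _ _ fun a h => h
  obtain ⟨φ, hφ⟩ := exists_starHom_of_rel (fun d x => q x = S d)
    (fun d => by obtain ⟨c, hc⟩ := h d; exact ⟨(ClosedIdeal.ker T).cls c, hc⟩)
    (fun a a' b b' h h' => by rw [map_add, map_add, h, h'])
    (fun c a b h => by rw [map_smul, map_smul, h])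
    (fun a a' b b' h h' => by rw [map_mul, map_mul, h, h'])
    (fun a b h => by rw [map_star, map_star, h])
    (fun b h => hq (by rw [h, map_zero, map_zero]))
  exact ⟨φ, fun d b h => (hφ d _).2 h⟩

/-- Stability of ⋆-homomorphisms out of an algebra with the lifting property: if `ψ : D → A` maps
enough elements close to the image of `B`, in a way compatible with a given `ρ : D → C` that is
liftable along `π : B → C`, then `ρ` lifts to a ⋆-homomorphism `D → B` close to `ψ`. -/
theorem LiftsAll.exists_stable {D : Type u} [NonUnitalCStarAlgebra D]
    [TopologicalSpace.SeparableSpace D] (hD : LiftsAll D) (F : Finset D) {ε : ℝ} (hε : 0 < ε) :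
    ∃ (G : Finset D) (δ : ℝ), 0 < δ ∧
      ∀ (A B C : Type u) [NonUnitalCStarAlgebra A] [NonUnitalCStarAlgebra B]
        [NonUnitalCStarAlgebra C] (j : B →⋆ₙₐ[ℂ] A) (π : B →⋆ₙₐ[ℂ] C) (ψ : D →⋆ₙₐ[ℂ] A)
        (ρ : D →⋆ₙₐ[ℂ] C), Function.Injective j → (∀ d, ∃ b, π b = ρ d) →
        (∀ g ∈ G, ∃ b, ‖ψ g - j b‖ < δ ∧ π b = ρ g) →
        ∃ ψ' : D →⋆ₙₐ[ℂ] B, (∀ d, π (ψ' d) = ρ d) ∧ ∀ f ∈ F, ‖j (ψ' f) - ψ f‖ < ε := by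
  classical
  -- Counterexamples for the first `n + 1` terms of a dense sequence and the tolerance `1 / (n + 1)`
  -- are assembled into algebras of bounded sequences.
  by_contra! hcon
  let a := TopologicalSpace.denseSeq D
  have ha : DenseRange a := TopologicalSpace.denseRange_denseSeq D
  choose A B C iA iB iC j π ψ ρ hj hπ happ hno using
    fun n : ULift.{u} ℕ => hcon ((Finset.range (n.down + 1)).image a) (1 / ((n.down : ℝ) + 1)) (by positivity)
  let Jm : lp B ∞ →⋆ₙₐ[ℂ] lp A ∞ := lpHom fun n => (j n).comp (lpEval B n)
  let Pm : lp B ∞ →⋆ₙₐ[ℂ] lp C ∞ := lpHom fun n => (π n).comp (lpEval B n)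
  -- `T b = S d` says that `b` follows `ψ d` asymptotically but lifts `ρ d` exactly in every
  -- coordinate.
  let T : lp B ∞ →⋆ₙₐ[ℂ] (c0Ideal A).QuotAlg × lp C ∞ := ((c0Ideal A).proj.comp Jm).prod Pm
  let S : D →⋆ₙₐ[ℂ] (c0Ideal A).QuotAlg × lp C ∞ := ((c0Ideal A).proj.comp (lpHom ψ)).prod (lpHom ρ)
  have hTS : ∀ d b, T b = S d ↔
      Tendsto (fun n : ℕ => ‖j ⟨n⟩ (b ⟨n⟩) - ψ ⟨n⟩ d‖) atTop (𝓝 0) ∧ ∀ n, π n (b n) = ρ n d := by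
    intro d b
    have h1 : T b = S d ↔ (c0Ideal A).cls (Jm b) = (c0Ideal A).cls (lpHom ψ d) ∧ Pm b = lpHom ρ d :=
      Prod.ext_iff
    rw [h1, ClosedIdeal.cls_eq_cls, mem_c0Ideal]
    refine and_congr Iff.rfl ⟨fun h n => congrArg (fun c : lp C ∞ => c n) h, fun h => ?_⟩
    exact Subtype.ext (funext h)
  have htot : ∀ d, ∃ b, T b = S d := by
    intro d
    -- Approximate at the nearest available term `a i₀`, then correct by a lift of `ρ (d - a i₀)` of
    -- nearly minimal norm. The condition over `C` thus becomes exact, at a cost comparable to `‖d -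
    -- a i₀‖`.
    have step : ∀ n, ∃ b, π n b = ρ n d ∧ ∀ i ≤ n.down,
        ‖j n b - ψ n d‖ ≤ 2 / ((n.down : ℝ) + 1) + 2 * ‖d - a i‖ := by
      intro n
      obtain ⟨i₀, hi₀, hmin⟩ := Finset.exists_min_image (Finset.range (n.down + 1))
        (fun i => ‖d - a i‖) ⟨0, by simp⟩
      obtain ⟨b', hb', hb''⟩ := happ n (a i₀) (Finset.mem_image_of_mem _ hi₀)
      obtain ⟨c₀, hc₀⟩ := hπ n (d - a i₀)
      obtain ⟨c, hc, hc'⟩ := exists_norm_lift (π n) c₀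
        (show 0 < 1 / ((n.down : ℝ) + 1) by positivity)
      refine ⟨b' + c, by rw [map_add, hb'', hc, hc₀, ← map_add, add_sub_cancel], fun i hi => ?_⟩
      have e1 := hmin i (by simpa [Nat.lt_succ_iff] using hi)
      have e2 : ‖c‖ < ‖d - a i₀‖ + 1 / ((n.down : ℝ) + 1) := by
        rw [hc₀] at hc'
        exact hc'.trans_le (by gcongr; exact starHom_norm_le _ _)
      have e3 := starHom_norm_le (j n) c
      have e4 := starHom_norm_le (ψ n) (d - a i₀)
      rw [norm_sub_rev] at hb'
      calc ‖j n (b' + c) - ψ n d‖ = ‖(j n b' - ψ n (a i₀)) + (j n c - ψ n (d - a i₀))‖ := by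
            rw [map_add, map_sub]; congr 1; abel
        _ ≤ ‖j n b' - ψ n (a i₀)‖ + (‖j n c‖ + ‖ψ n (d - a i₀)‖) :=
            (norm_add_le _ _).trans (by gcongr; exact norm_sub_le _ _)
        _ ≤ 1 / ((n.down : ℝ) + 1) + ((‖d - a i₀‖ + 1 / ((n.down : ℝ) + 1)) + ‖d - a i₀‖) := by
            gcongr; linarith
        _ = 2 / ((n.down : ℝ) + 1) + 2 * ‖d - a i₀‖ := by ring
        _ ≤ _ := by gcongr
    choose b hb hb' using step
    have hmem : Memℓp b ∞ := memℓp_infty ⟨‖d‖ + (2 + 2 * ‖d - a 0‖), by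
      rintro _ ⟨n, rfl⟩
      have h1 := hb' n 0 (Nat.zero_le _)
      have h2 : 2 / ((n.down : ℝ) + 1) ≤ 2 :=
        div_le_self (by norm_num) (by linarith [Nat.cast_nonneg (α := ℝ) n.down])
      have h3 := norm_le_norm_add_norm_sub' (j n (b n)) (ψ n d)
      have h4 := starHom_norm_le (ψ n) d
      have h5 := NonUnitalStarAlgHom.norm_map (j n) (hj n) (b n)
      change ‖b n‖ ≤ _
      linarith⟩
    refine ⟨⟨b, hmem⟩, (hTS d _).2 ⟨Metric.tendsto_atTop.2 fun η hη => ?_, hb⟩⟩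
    obtain ⟨i, hi⟩ := ha.exists_dist_lt d (show 0 < η / 4 by positivity)
    rw [dist_eq_norm] at hi
    obtain ⟨N, hN⟩ := exists_nat_gt (4 / η)
    refine ⟨max i N, fun n hn => ?_⟩
    rw [dist_zero_right, norm_norm]
    refine (hb' ⟨n⟩ i ((le_max_left _ _).trans hn)).trans_lt ?_
    have hn' : (N : ℝ) ≤ n := Nat.cast_le.2 ((le_max_right _ _).trans hn)
    have : 2 / ((n : ℝ) + 1) < η / 2 := by
      rw [div_lt_iff₀ hη] at hN
      rw [div_lt_iff₀ (by positivity)]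
      nlinarith
    change 2 / ((n : ℝ) + 1) + 2 * ‖d - a i‖ < η
    linarith
  obtain ⟨φ, hφ⟩ := exists_hom_to_quot_ker T S htot
  let tail : ℕ → (lp B ∞ →⋆ₙₐ[ℂ] lp B ∞) := fun m =>
    lpHom fun n => if m ≤ n.down then lpEval B n else 0
  let head : ℕ → (lp B ∞ →⋆ₙₐ[ℂ] lp B ∞) := fun m =>
    lpHom fun n => if m ≤ n.down then 0 else lpEval B n
  -- Sequences in the kernel of `π` that vanish from `m` on. Since the maps `j n` are isometric,
  -- `ker T` consists of the null sequences in the kernel of `π`, the closure of the union of these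
  -- ideals. A lift modulo `J N` is a genuine ⋆-homomorphism in every coordinate from `N` on.
  let J : ℕ → ClosedIdeal (lp B ∞) := fun m => ClosedIdeal.ker ((tail m).prod Pm)
  have hJmem : ∀ m b, b ∈ J m ↔ (∀ n, m ≤ n.down → b n = 0) ∧ Pm b = 0 := by
    intro m b
    have h1 : b ∈ J m ↔ tail m b = 0 ∧ Pm b = 0 := Prod.ext_iff
    rw [h1]
    refine and_congr ⟨fun h n hn => ?_, fun h => ?_⟩ Iff.rfl
    · have := congrArg (fun c : lp B ∞ => c n) h
      simpa [tail, lpHom_apply, hn, lpEval_apply] using this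
    · refine Subtype.ext (funext fun n => ?_)
      change tail m b n = 0
      by_cases hn : m ≤ n.down
      · simp [tail, lpHom_apply, hn, lpEval_apply, h n hn]
      · simp [tail, lpHom_apply, hn]
  have hKmem : ∀ b, b ∈ ClosedIdeal.ker T ↔
      Tendsto (fun n : ℕ => ‖b ⟨n⟩‖) atTop (𝓝 0) ∧ Pm b = 0 := by
    intro b
    have h1 : b ∈ ClosedIdeal.ker T ↔ (c0Ideal A).cls (Jm b) = 0 ∧ Pm b = 0 := Prod.ext_iff
    rw [h1, ClosedIdeal.cls_eq_zero, mem_c0Ideal]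
    have : ∀ n : ℕ, ‖Jm b ⟨n⟩‖ = ‖b ⟨n⟩‖ := fun n => NonUnitalStarAlgHom.norm_map (j _) (hj _) _
    simp only [this]
  have hK : (ClosedIdeal.ker T : Set (lp B ∞)) = closure (⋃ n, (J n : Set (lp B ∞))) := by
    refine ClosedIdeal.eq_closure_of (fun m b hb => ?_) fun b hb η hη => ?_
    · rw [hJmem] at hb
      refine (hKmem b).2 ⟨tendsto_const_nhds.congr' ?_, hb.2⟩
      filter_upwards [eventually_ge_atTop m] with n hn
      rw [hb.1 ⟨n⟩ hn, norm_zero]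
    · rw [hKmem] at hb
      obtain ⟨N, hN⟩ := Metric.tendsto_atTop.1 hb.1 (η / 2) (half_pos hη)
      refine ⟨N, head N b, (hJmem _ _).2 ⟨fun n hn => by simp [head, lpHom_apply, hn], ?_⟩, ?_⟩
      · refine Subtype.ext (funext fun n => ?_)
        have h0 : π n (b n) = 0 := congrArg (fun c : lp C ∞ => c n) hb.2
        change π n (head N b n) = 0
        by_cases hn : N ≤ n.down
        · simp [head, lpHom_apply, hn]
        · simp [head, lpHom_apply, hn, lpEval_apply, h0]
      · refine (lp_norm_le (half_pos hη).le fun n => ?_).trans_lt (half_lt_self hη)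
        change ‖b n - head N b n‖ ≤ η / 2
        by_cases hn : N ≤ n.down
        · have := hN n.down hn
          rw [dist_zero_right, norm_norm] at this
          simpa [head, lpHom_apply, hn] using this.le
        · simpa [head, lpHom_apply, hn, lpEval_apply] using (half_pos hη).le
  obtain ⟨N, Ψ, hΨ⟩ := hD (lp B ∞) J (fun m n hmn b hb => by
    rw [hJmem] at hb ⊢
    exact ⟨fun k hk => hb.1 k (hmn.trans hk), hb.2⟩) (ClosedIdeal.ker T) hK φ
  have hΨ' : ∀ d b, Ψ d = (J N).cls b → T b = S d := fun d b h => by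
    refine hφ d b ?_
    rw [← hΨ, NonUnitalStarAlgHom.comp_apply, h]
    rfl
  choose b hb using fun d => (J N).cls_surjective (Ψ d)
  have hev : ∀ᶠ n : ℕ in atTop, ∀ f ∈ F, ‖j ⟨n⟩ (b f ⟨n⟩) - ψ ⟨n⟩ f‖ < ε := by
    refine (Finset.eventually_all F).2 fun f _ => ?_
    exact ((hTS f _).1 (hΨ' f _ (hb f).symm)).1.eventually (gt_mem_nhds hε)
  obtain ⟨n, hn, hnN⟩ := (hev.and (eventually_ge_atTop N)).exists
  let ψ' : D →⋆ₙₐ[ℂ] B ⟨n⟩ := ((J N).lift (lpEval B ⟨n⟩) fun c hc => ((hJmem _ _).1 hc).1 _ hnN).comp Ψ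
  have hψ' : ∀ d, ψ' d = b d ⟨n⟩ := fun d => by
    simp only [ψ', NonUnitalStarAlgHom.comp_apply, ← hb d]
    rfl
  obtain ⟨f, hf, hf'⟩ := hno ⟨n⟩ ψ' fun d => by
    rw [hψ']
    exact ((hTS d _).1 (hΨ' d _ (hb d).symm)).2 _
  rw [hψ'] at hf'
  exact absurd (hn f hf) (not_lt.2 hf')

end SequenceAlgebras

/-! ### The action of `C(X)` and evaluation in the fibers -/

section Action

variable (X : Type u) [TopologicalSpace X] [CompactSpace X] [T2Space X]
  {A : Type u} [NonUnitalCStarAlgebra A] [CXAlgebra X A]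

namespace CXAlgebra

theorem act_add (f : C(X, ℂ)) (a b : A) : act X f (a + b) = act X f a + act X f b := map_add _ a b

theorem act_sub (f : C(X, ℂ)) (a b : A) : act X f (a - b) = act X f a - act X f b := map_sub _ a b

theorem act_zero (f : C(X, ℂ)) : act X f (0 : A) = 0 := map_zero _

theorem act_smul (f : C(X, ℂ)) (c : ℂ) (a : A) : act X f (c • a) = c • act X f a := map_smul _ c a

theorem add_act (f g : C(X, ℂ)) (a : A) : act X (f + g) a = act X f a + act X g a := by
  simp [act, map_add]

theorem sub_act (f g : C(X, ℂ)) (a : A) : act X (f - g) a = act X f a - act X g a := by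
  simp [act, map_sub]

theorem smul_act (c : ℂ) (f : C(X, ℂ)) (a : A) : act X (c • f) a = c • act X f a := by
  simp [act, map_smul]

theorem mul_act (f g : C(X, ℂ)) (a : A) : act X (f * g) a = act X f (act X g a) := by
  simp [act, map_mul]

theorem act_mul_left (f : C(X, ℂ)) (a b : A) : act X f (a * b) = act X f a * b :=
  DoubleCentralizer.fst_mul _ a b

theorem act_mul_right (f : C(X, ℂ)) (a b : A) : act X f (a * b) = a * act X f b :=
  DoubleCentralizer.fst_mul_of_mem_center (θ_mem_center f) a b

theorem star_act (f : C(X, ℂ)) (a : A) : star (act X f a) = act X (star f) (star a) := by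
  have h1 : (θ (X := X) (A := A) f).fst a = (θ f).snd a :=
    DoubleCentralizer.eq_of_forall_mul_eq' fun b => by
      rw [DoubleCentralizer.central]
      exact (act_mul_left X f a b).symm.trans (act_mul_right X f a b)
  simp only [act, map_star, DoubleCentralizer.star_fst, star_star]
  rw [h1]

theorem norm_act_le (f : C(X, ℂ)) (a : A) : ‖act X f a‖ ≤ ‖f‖ * ‖a‖ := by
  refine ((θ (X := X) (A := A) f).fst.le_opNorm a).trans ?_
  rw [DoubleCentralizer.norm_fst]
  gcongr
  exact NonUnitalStarAlgHom.norm_apply_le _ f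

theorem continuous_act (f : C(X, ℂ)) : Continuous fun a : A => act X f a :=
  (θ (X := X) (A := A) f).fst.continuous

theorem one_act (a : A) : act X (1 : C(X, ℂ)) a = a := by
  have hc : IsClosed {a : A | act X (1 : C(X, ℂ)) a = a} :=
    isClosed_eq (continuous_act X 1) continuous_id
  refine closure_minimal ?_ hc (CXAlgebra.dense (X := X) (A := A) a)
  rintro _ ⟨f, a, rfl⟩
  change act X 1 (act X f a) = act X f a
  rw [← mul_act, one_mul]

/-- A `C(X)`-algebra structure from a family of operators. -/
@[reducible]
def ofAct {R : Type u} [NonUnitalCStarAlgebra R] (T : C(X, ℂ) → R →L[ℂ] R)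
    (add : ∀ f g a, T (f + g) a = T f a + T g a) (smul : ∀ (c : ℂ) f a, T (c • f) a = c • T f a)
    (mul : ∀ f g a, T (f * g) a = T f (T g a)) (star' : ∀ f a, star (T f a) = T (star f) (star a))
    (left : ∀ f a b, T f (a * b) = T f a * b) (right : ∀ f a b, T f (a * b) = a * T f b)
    (one : ∀ a, T 1 a = a) : CXAlgebra X R where
  θ :=
    { toFun := fun f => ⟨(T f, T f), fun x y => (left f x y).symm.trans (right f x y)⟩
      map_smul' := fun c f => DoubleCentralizer.ext_fst fun a => smul c f a
      map_zero' := DoubleCentralizer.ext_fst fun a => by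
        have := smul 0 0 a
        rw [zero_smul, zero_smul] at this
        exact this
      map_add' := fun f g => DoubleCentralizer.ext_fst fun a => add f g a
      map_mul' := fun f g => DoubleCentralizer.ext_fst fun a => mul f g a
      map_star' := fun f => DoubleCentralizer.ext_fst fun a => by
        rw [DoubleCentralizer.star_fst]
        change T (star f) a = star (T f (star a))
        rw [star', star_star] }
  θ_mem_center f := DoubleCentralizer.mem_center_of fun a b => right f a b
  dense := by
    have : {b : R | ∃ (f : C(X, ℂ)) (a : R), b = T f a} = Set.univ :=
      Set.eq_univ_of_forall fun a => ⟨1, a, (one a).symm⟩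
    exact this ▸ dense_univ

end CXAlgebra

open CXAlgebra

variable (A) in
/-- The evaluation `a ↦ a(x)`. -/
noncomputable def fiberMap (x : X) : A →⋆ₙₐ[ℂ] Fiber X A x := (vanishingIdeal X A {x}).proj

theorem fiberMap_surjective (x : X) : Function.Surjective (fiberMap X A x) :=
  (vanishingIdeal X A {x}).cls_surjective

theorem fiberMap_eq_zero {x : X} {a : A} : fiberMap X A x a = 0 ↔ a ∈ vanishingIdeal X A {x} :=
  ClosedIdeal.cls_eq_zero

theorem act_mem_vanishingIdeal {S : Set X} {f : C(X, ℂ)} (hf : ∀ x ∈ S, f x = 0) (a : A) :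
    act X f a ∈ vanishingIdeal X A S :=
  subset_closure (Submodule.subset_span ⟨f, a, hf, rfl⟩)

theorem fiberMap_act (x : X) (f : C(X, ℂ)) (a : A) :
    fiberMap X A x (act X f a) = f x • fiberMap X A x a := by
  rw [← map_smul, ← sub_eq_zero, ← map_sub, fiberMap_eq_zero]
  have : act X f a - f x • a = act X (f - f x • 1) a := by
    rw [sub_act, smul_act, one_act]
  rw [this]
  exact act_mem_vanishingIdeal X (by simp) a

variable {X}

/-- A real function as a complex one. -/
def toComplexFun {X : Type u} [TopologicalSpace X] (g : C(X, ℝ)) : C(X, ℂ) := ⟨fun x => (g x : ℂ), by fun_prop⟩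

@[simp] theorem toComplexFun_apply {X : Type u} [TopologicalSpace X] (g : C(X, ℝ)) (x : X) :
    toComplexFun g x = (g x : ℂ) := rfl

theorem norm_toComplexFun_le {X : Type u} [TopologicalSpace X] [CompactSpace X] {g : C(X, ℝ)} {c : ℝ}
    (hc : 0 ≤ c) (h : ∀ x, |g x| ≤ c) :
    ‖toComplexFun g‖ ≤ c :=
  (ContinuousMap.norm_le _ hc).2 fun x => by simpa using h x

/-- Finite partitions of unity on a closed set. -/
theorem exists_partition {T : Set X} (hT : IsClosed T) (U : X → Set X)
    (hU : ∀ x ∈ T, IsOpen (U x) ∧ x ∈ U x) :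
    ∃ (ι : Type u) (_ : Fintype ι) (p : ι → X) (g : ι → C(X, ℝ)), (∀ i, p i ∈ T) ∧
      (∀ i y, 0 ≤ g i y) ∧ (∀ y, ∑ i, g i y ≤ 1) ∧ (∀ y ∈ T, ∑ i, g i y = 1) ∧
      ∀ i, ∀ y ∉ U (p i), g i y = 0 := by
  obtain ⟨s, hs⟩ := hT.isCompact.elim_nhds_subcover' (fun x _ => U x)
    fun x hx => (hU x hx).1.mem_nhds (hU x hx).2
  have hcov : T ⊆ ⋃ i : s, U (i : T) := by
    intro x hx
    have := hs hx
    simp only [Set.mem_iUnion] at this ⊢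
    obtain ⟨i, hi, h⟩ := this
    exact ⟨⟨i, hi⟩, h⟩
  obtain ⟨f, hf⟩ := PartitionOfUnity.exists_isSubordinate_of_locallyFinite hT
    (fun i : s => U (i : T)) (fun i => (hU _ (i : T).2).1) (locallyFinite_of_finite _) hcov
  refine ⟨s, inferInstance, fun i => (i : T), fun i => f i, fun i => (i : T).2, fun i y => f.nonneg i y, fun y => ?_,
    fun y hy => ?_, fun i y hy => ?_⟩
  · rw [← finsum_eq_sum_of_fintype]; exact f.sum_le_one y
  · rw [← finsum_eq_sum_of_fintype]; exact f.sum_eq_one hy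
  · by_contra h
    exact hy (hf i (subset_tsupport _ h))

theorem exists_urysohn {S T : Set X} (hS : IsClosed S) (hT : IsClosed T) (h : Disjoint S T) :
    ∃ g : C(X, ℝ), (∀ x ∈ S, g x = 0) ∧ (∀ x ∈ T, g x = 1) ∧ (∀ x, 0 ≤ g x ∧ g x ≤ 1) ∧
      ‖toComplexFun g‖ ≤ 1 := by
  obtain ⟨g, h0, h1, h2⟩ := exists_continuous_zero_one_of_isClosed hS hT h
  exact ⟨g, fun x hx => h0 hx, fun x hx => h1 hx, fun x => h2 x,
    norm_toComplexFun_le zero_le_one fun x => by rw [abs_of_nonneg (h2 x).1]; exact (h2 x).2⟩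

/-- Elements of the ideal at `x` become small when cut down to a small neighbourhood of `x`. -/
theorem exists_nhds_norm_act_le {x : X} {a : A} (ha : a ∈ vanishingIdeal X A {x}) {ε : ℝ}
    (hε : 0 < ε) : ∃ U ∈ 𝓝 x, ∀ h : C(X, ℂ), ‖h‖ ≤ 1 → (∀ y ∉ U, h y = 0) → ‖act X h a‖ < ε := by
  have key : ∀ b ∈ vanishingSpan X A {x}, ∀ ε > 0, ∃ U ∈ 𝓝 x, ∀ h : C(X, ℂ), ‖h‖ ≤ 1 →
      (∀ y ∉ U, h y = 0) → ‖act X h b‖ < ε := by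
    intro b hb
    induction hb using Submodule.span_induction with
    | mem b hb =>
      obtain ⟨f, a', hf, rfl⟩ := hb
      intro ε hε
      refine ⟨{y | ‖f y‖ < ε / (2 * (‖a'‖ + 1))}, ?_, fun h h1 h2 => ?_⟩
      · refine (isOpen_lt (by fun_prop) continuous_const).mem_nhds ?_
        change ‖f x‖ < _
        rw [hf x rfl, norm_zero]; positivity
      · rw [← mul_act]
        have : ‖h * f‖ ≤ ε / (2 * (‖a'‖ + 1)) := by
          refine (ContinuousMap.norm_le _ (by positivity)).2 fun y => ?_
          rw [ContinuousMap.mul_apply, norm_mul]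
          by_cases hy : ‖f y‖ < ε / (2 * (‖a'‖ + 1))
          · have := (h.norm_coe_le_norm y).trans h1
            calc ‖h y‖ * ‖f y‖ ≤ 1 * ‖f y‖ := by gcongr
              _ ≤ _ := by rw [one_mul]; exact hy.le
          · rw [h2 y hy, norm_zero, zero_mul]; positivity
        calc ‖act X (h * f) a'‖ ≤ ‖h * f‖ * ‖a'‖ := norm_act_le X _ _
          _ ≤ ε / (2 * (‖a'‖ + 1)) * ‖a'‖ := by gcongr
          _ = ε / 2 * (‖a'‖ / (‖a'‖ + 1)) := by field_simp
          _ ≤ ε / 2 * 1 := by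
            gcongr
            exact (div_le_one (by positivity)).2 (by linarith)
          _ < ε := by linarith
    | zero => exact fun ε hε => ⟨Set.univ, univ_mem, fun h _ _ => by rw [act_zero, norm_zero]; exact hε⟩
    | add b c _ _ hb hc =>
      intro ε hε
      obtain ⟨U, hU, hU'⟩ := hb (ε / 2) (half_pos hε)
      obtain ⟨V, hV, hV'⟩ := hc (ε / 2) (half_pos hε)
      refine ⟨U ∩ V, inter_mem hU hV, fun h h1 h2 => ?_⟩
      rw [act_add]
      have e1 := hU' h h1 fun y hy => h2 y fun hy' => hy hy'.1
      have e2 := hV' h h1 fun y hy => h2 y fun hy' => hy hy'.2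
      linarith [norm_add_le (act X h b) (act X h c)]
    | smul c b _ hb =>
      intro ε hε
      obtain ⟨U, hU, hU'⟩ := hb (ε / (‖c‖ + 1)) (by positivity)
      refine ⟨U, hU, fun h h1 h2 => ?_⟩
      rw [act_smul, norm_smul]
      have := hU' h h1 h2
      rw [lt_div_iff₀ (by positivity)] at this
      nlinarith [norm_nonneg (act X h b)]
  have ha' : a ∈ closure (vanishingSpan X A {x} : Set A) := ha
  obtain ⟨b, hb, hab⟩ := Metric.mem_closure_iff.1 ha' (ε / 2) (half_pos hε)
  obtain ⟨U, hU, hU'⟩ := key b hb (ε / 2) (half_pos hε)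
  refine ⟨U, hU, fun h h1 h2 => ?_⟩
  rw [dist_eq_norm] at hab
  have e1 : ‖act X h (a - b)‖ ≤ ‖a - b‖ := (norm_act_le X _ _).trans (by nlinarith [norm_nonneg (a - b)])
  have e2 := hU' h h1 h2
  calc ‖act X h a‖ = ‖act X h (a - b) + act X h b‖ := by rw [act_sub, sub_add_cancel]
    _ ≤ _ := norm_add_le _ _
    _ < ε := by linarith

/-- For self-adjoint `b` vanishing in all fibers, cut-offs of `b` near each point have norm at most
`ε`. A partition of unity gives `‖b ^ n‖ ≤ N ε ^ n`, where the number `N` of its members does not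
depend on `n`. Comparing along `n = 2 ^ m`, where the C⋆-identity gives `‖b ^ n‖ = ‖b‖ ^ n`, yields
`‖b‖ ≤ ε`. -/
theorem eq_zero_of_fiberMap_eq_zero {a : A} (ha : ∀ x, fiberMap X A x a = 0) : a = 0 := by
  have main : ∀ b : A, star b = b → (∀ x, fiberMap X A x b = 0) → ∀ ε > 0, ‖b‖ ≤ ε := by
    intro b hbs hb ε hε
    have h1 : ∀ x, ∃ (U : Set X) (g : C(X, ℝ)), IsOpen U ∧ x ∈ U ∧ (∀ y ∈ U, g y = 1) ∧
        ‖act X (toComplexFun g) b‖ ≤ ε := by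
      intro x
      obtain ⟨U, hU, hU'⟩ := exists_nhds_norm_act_le ((fiberMap_eq_zero X).1 (hb x)) hε
      obtain ⟨V, hV, hVc, hVU⟩ := exists_mem_nhds_isClosed_subset (interior_mem_nhds.2 hU)
      obtain ⟨g, g0, g1, -, gn⟩ := exists_urysohn (isOpen_interior (s := U)).isClosed_compl hVc
        (Set.disjoint_left.2 fun y hy hy' => hy (hVU hy'))
      refine ⟨interior V, g, isOpen_interior, mem_interior_iff_mem_nhds.2 hV,
        fun y hy => g1 y (interior_subset hy), (hU' _ gn fun y hy => ?_).le⟩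
      rw [toComplexFun_apply, g0 y fun hy' => hy (interior_subset hy'), Complex.ofReal_zero]
    choose U g hUo hxU hg hgn using h1
    obtain ⟨ι, _, p, k, -, k0, -, k1, kU⟩ := exists_partition isClosed_univ U
      fun x _ => ⟨hUo x, hxU x⟩
    let M := 𝓜(ℂ, A)
    let t : C(X, ℂ) → M := fun f => θ f
    have ht1 : t 1 = 1 := DoubleCentralizer.ext_fst fun a => one_act X a
    have hsum : ∑ i, t (toComplexFun (k i)) = 1 := by
      rw [← map_sum, ← ht1]
      congr 1
      ext y
      simp only [ContinuousMap.coe_sum, Finset.sum_apply, toComplexFun_apply, ContinuousMap.one_apply]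
      exact_mod_cast k1 y trivial
    let c : M := (b : 𝓜(ℂ, A))
    have hcn : ∀ z : A, ‖((z : 𝓜(ℂ, A)) : M)‖ = ‖z‖ := fun z => by
      rw [← DoubleCentralizer.norm_fst, DoubleCentralizer.coe_fst]
      exact ContinuousLinearMap.opNorm_mul_apply ℂ A z
    have hcs : IsSelfAdjoint c := by
      refine DoubleCentralizer.ext_fst fun a => ?_
      rw [DoubleCentralizer.star_fst]
      change star ((star a) * b) = b * a
      rw [star_mul, star_star, hbs]
    have hcomm : ∀ f, Commute (t f) c := fun f =>
      (Subalgebra.mem_center_iff.1 (θ_mem_center f) c).symm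
    have hpow : ∀ (f : C(X, ℂ)) (n : ℕ), t (f ^ (n + 1)) = t f ^ (n + 1) := fun f n => by
      induction n with
      | zero => simp
      | succ n ih => rw [pow_succ, pow_succ (t f), ← ih]; exact map_mul _ _ _
    have hkey : ∀ n : ℕ, ‖c ^ (n + 1)‖ ≤ Fintype.card ι * ε ^ (n + 1) := by
      intro n
      -- Each `k i` vanishes outside the set where `g (p i) = 1`, so powers of `g (p i)` can be
      -- inserted freely; the multipliers involved are central.
      have e1 : c ^ (n + 1) = ∑ i, t (toComplexFun (k i)) * (t (toComplexFun (g (p i))) * c) ^ (n + 1) := by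
        calc c ^ (n + 1) = (∑ i, t (toComplexFun (k i))) * c ^ (n + 1) := by rw [hsum, one_mul]
          _ = _ := by
            rw [Finset.sum_mul]
            refine Finset.sum_congr rfl fun i _ => ?_
            rw [(hcomm _).mul_pow, ← hpow, ← mul_assoc]
            congr 1
            have : toComplexFun (k i) = toComplexFun (k i) * toComplexFun (g (p i)) ^ (n + 1) := by
              ext y
              by_cases hy : y ∈ U (p i)
              · simp [hg _ y hy]
              · simp [kU i y hy]
            conv_lhs => rw [this]
            exact map_mul _ _ _
      rw [e1]
      refine (norm_sum_le _ _).trans ?_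
      have : ∀ i ∈ Finset.univ, ‖t (toComplexFun (k i)) * (t (toComplexFun (g (p i))) * c) ^ (n + 1)‖ ≤
          ε ^ (n + 1) := by
        intro i _
        have n1 : ‖t (toComplexFun (k i))‖ ≤ 1 := by
          refine (NonUnitalStarAlgHom.norm_apply_le (θ (X := X) (A := A)) _).trans ?_
          refine norm_toComplexFun_le zero_le_one fun y => ?_
          rw [abs_of_nonneg (k0 i y), ← k1 y trivial]
          exact Finset.single_le_sum (f := fun j => k j y) (fun j _ => k0 j y) (Finset.mem_univ i)
        have n2 : ‖t (toComplexFun (g (p i))) * c‖ ≤ ε := by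
          have : t (toComplexFun (g (p i))) * c =
              ((act X (toComplexFun (g (p i))) b : A) : 𝓜(ℂ, A)) :=
            DoubleCentralizer.ext_fst fun a => act_mul_left X _ b a
          rw [this, hcn]; exact hgn _
        calc _ ≤ ‖t (toComplexFun (k i))‖ * ‖(t (toComplexFun (g (p i))) * c) ^ (n + 1)‖ := norm_mul_le _ _
          _ ≤ 1 * ε ^ (n + 1) := by
            gcongr
            exact (norm_pow_le' _ (Nat.succ_pos n)).trans (by gcongr)
          _ = _ := one_mul _
      refine (Finset.sum_le_sum this).trans (le_of_eq ?_)
      simp [Finset.card_univ]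
    by_contra hlt
    rw [not_le] at hlt
    have hq : 1 < ‖b‖ / ε := (one_lt_div hε).2 hlt
    obtain ⟨m, hm⟩ := pow_unbounded_of_one_lt (Fintype.card ι : ℝ) hq
    have hm2 : m ≤ 2 ^ m := Nat.lt_two_pow_self.le
    have h3 : ‖c ^ 2 ^ m‖ = ‖b‖ ^ 2 ^ m := by
      have := hcs.nnnorm_pow_two_pow m
      have := congrArg (fun r : NNReal => (r : ℝ)) this
      simp only [coe_nnnorm, NNReal.coe_pow] at this
      rw [this, hcn]
    obtain ⟨n, hn⟩ : ∃ n, 2 ^ m = n + 1 := Nat.exists_eq_succ_of_ne_zero (by positivity)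
    have h4 := hkey n
    rw [← hn, h3] at h4
    have h5 : (Fintype.card ι : ℝ) < (‖b‖ / ε) ^ 2 ^ m :=
      hm.trans_le (pow_le_pow_right₀ hq.le hm2)
    rw [div_pow, lt_div_iff₀ (by positivity)] at h5
    linarith
  have h2 : ‖star a * a‖ ≤ 0 := le_of_forall_pos_le_add fun ε hε => by
    rw [zero_add]
    exact main _ (by simp) (fun x => by rw [map_mul, ha, mul_zero]) ε hε
  rw [CStarRing.norm_star_mul_self] at h2
  have h3 : ‖a‖ = 0 := by nlinarith [norm_nonneg a]
  exact norm_eq_zero.1 h3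

/-- The norm of a `C(X)`-algebra is determined by the norms in the fibers. -/
theorem norm_le_of_fiberMap {a : A} {c : ℝ} (hc : 0 ≤ c) (h : ∀ x, ‖fiberMap X A x a‖ ≤ c) :
    ‖a‖ ≤ c := by
  have hinj : Function.Injective (lpHom fun x => fiberMap X A x) := by
    refine (injective_iff_map_eq_zero _).2 fun a ha =>
      eq_zero_of_fiberMap_eq_zero (X := X) fun x => ?_
    exact congrArg (fun s : lp (fun x => Fiber X A x) ⊤ => s x) ha
  rw [← NonUnitalStarAlgHom.norm_map _ hinj a]
  exact lp_norm_le hc h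

theorem norm_fiberMap_le (x : X) (a : A) : ‖fiberMap X A x a‖ ≤ ‖a‖ := starHom_norm_le _ a

end Action

/-! ### Closed `C(X)`-subalgebras and their sections over closed sets -/

/-- Closed ⋆-subalgebras of a `C(X)`-algebra that are stable under the action of `C(X)`. -/
structure SubCX (X : Type u) [TopologicalSpace X] [CompactSpace X] [T2Space X]
    (A : Type u) [NonUnitalCStarAlgebra A] [CXAlgebra X A] extends
    NonUnitalStarSubalgebra ℂ A where
  act_mem' : ∀ (f : C(X, ℂ)) {a : A}, a ∈ carrier → CXAlgebra.act X f a ∈ carrier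
  isClosed' : IsClosed carrier

section Sections

open CXAlgebra

variable {X : Type u} [TopologicalSpace X] [CompactSpace X] [T2Space X]
  {A : Type u} [NonUnitalCStarAlgebra A] [CXAlgebra X A]

namespace SubCX

instance : SetLike (SubCX X A) A where
  coe B := B.carrier
  coe_injective B C h := by
    cases B; cases C; congr; exact SetLike.coe_injective h

instance : NonUnitalSubringClass (SubCX X A) A where
  add_mem {B} := B.toNonUnitalStarSubalgebra.add_mem
  zero_mem B := B.toNonUnitalStarSubalgebra.zero_mem
  neg_mem {B} := fun h => neg_mem (s := B.toNonUnitalStarSubalgebra) h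
  mul_mem {B} := B.toNonUnitalStarSubalgebra.mul_mem

instance : SMulMemClass (SubCX X A) ℂ A where
  smul_mem {B} c _ h := B.toNonUnitalStarSubalgebra.smul_mem c h

instance : StarMemClass (SubCX X A) A where
  star_mem {B} _ h := star_mem (s := B.toNonUnitalStarSubalgebra) h

variable (B : SubCX X A)

theorem isClosed : IsClosed (B : Set A) := B.isClosed'

theorem act_mem (f : C(X, ℂ)) {a : A} (ha : a ∈ B) : act X f a ∈ B := B.act_mem' f ha

noncomputable instance : NonUnitalCStarAlgebra B :=
  NonUnitalStarSubalgebra.nonUnitalCStarAlgebra (h_closed := B.isClosed) B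

/-- The inclusion of a `C(X)`-subalgebra. -/
noncomputable def incl : B →⋆ₙₐ[ℂ] A := NonUnitalStarSubalgebraClass.subtype B

theorem incl_apply (b : B) : B.incl b = (b : A) := rfl

theorem norm_coe' (b : B) : ‖b‖ = ‖(b : A)‖ := rfl

noncomputable instance : CXAlgebra X B :=
  ofAct X (fun f => LinearMap.mkContinuous
      { toFun := fun b : B => (⟨act X f b, B.act_mem f b.2⟩ : B)
        map_add' := fun a b => Subtype.ext (act_add X f (a : A) b)
        map_smul' := fun c a => Subtype.ext (act_smul X f c (a : A)) } ‖f‖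
      fun b => norm_act_le X f (b : A))
    (fun f g a => Subtype.ext (add_act X f g (a : A)))
    (fun c f a => Subtype.ext (smul_act X c f (a : A)))
    (fun f g a => Subtype.ext (mul_act X f g (a : A)))
    (fun f a => Subtype.ext (star_act X f (a : A)))
    (fun f a b => Subtype.ext (act_mul_left X f (a : A) b))
    (fun f a b => Subtype.ext (act_mul_right X f (a : A) b))
    (fun a => Subtype.ext (one_act X (a : A)))

theorem coe_act (f : C(X, ℂ)) (b : B) : ((act X f b : B) : A) = act X f (b : A) := rfl

/-- The whole algebra. -/
def univ : SubCX X A where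
  toNonUnitalStarSubalgebra := ⊤
  act_mem' _ _ _ := trivial
  isClosed' := isClosed_univ

variable {B}

/-- Patch the local approximants with a partition of unity on `T`. In each fiber the error is a
convex combination of errors below `δ`. -/
theorem exists_approx_section {T : Set X} (hT : IsClosed T) (s : ∀ x, Fiber X A x) {δ : ℝ}
    (hs : ∀ x ∈ T, ∃ b ∈ B, ∀ᶠ y in 𝓝 x, y ∈ T → ‖s y - fiberMap X A y b‖ < δ) :
    ∃ b ∈ B, ∀ y ∈ T, ‖s y - fiberMap X A y b‖ ≤ δ := by
  have h1 : ∀ x, ∃ b ∈ B, x ∈ T → ∀ᶠ y in 𝓝 x, y ∈ T → ‖s y - fiberMap X A y b‖ < δ := fun x => by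
    by_cases hx : x ∈ T
    · obtain ⟨b, hb, h⟩ := hs x hx; exact ⟨b, hb, fun _ => h⟩
    · exact ⟨0, zero_mem _, fun h => absurd h hx⟩
  choose b hb hb' using h1
  let U : X → Set X := fun x => interior {y | y ∈ T → ‖s y - fiberMap X A y (b x)‖ < δ}
  obtain ⟨ι, _, p, g, hp, g0, -, g1, gU⟩ := exists_partition hT U
    fun x hx => ⟨isOpen_interior, mem_interior_iff_mem_nhds.2 (hb' x hx)⟩
  refine ⟨∑ i, act X (toComplexFun (g i)) (b (p i)), sum_mem fun i _ => B.act_mem _ (hb _),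
    fun y hy => ?_⟩
  have e1 : s y - fiberMap X A y (∑ i, act X (toComplexFun (g i)) (b (p i))) =
      ∑ i, (g i y : ℂ) • (s y - fiberMap X A y (b (p i))) := by
    rw [map_sum]
    simp only [smul_sub, Finset.sum_sub_distrib, fiberMap_act, toComplexFun_apply]
    rw [← Finset.sum_smul, ← Complex.ofReal_sum, g1 y hy, Complex.ofReal_one, one_smul]
  rw [e1]
  refine (norm_sum_le _ _).trans ?_
  calc ∑ i, ‖(g i y : ℂ) • (s y - fiberMap X A y (b (p i)))‖ ≤ ∑ i, g i y * δ := by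
        refine Finset.sum_le_sum fun i _ => ?_
        rw [norm_smul, Complex.norm_real, Real.norm_of_nonneg (g0 i y)]
        by_cases h : y ∈ U (p i)
        · have h2 := interior_subset h hy
          exact mul_le_mul_of_nonneg_left h2.le (g0 i y)
        · simp [gU i y h]
    _ = δ := by rw [← Finset.sum_mul, g1 y hy, one_mul]

theorem continuous_norm_fiberMap (hA : IsContinuousCXAlgebra X A) (a : A) :
    Continuous fun x => ‖fiberMap X A x a‖ := hA a

/-- By continuity of the fiber norms, the set where `b` has norm at least `c` is closed and misses
`T`; a Urysohn function cuts `b` off there. -/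
theorem exists_small_extension (hA : IsContinuousCXAlgebra X A) {T : Set X} (hT : IsClosed T) {b : A}
    (hb : b ∈ B) {c : ℝ}
    (hc : 0 < c) (h : ∀ x ∈ T, ‖fiberMap X A x b‖ < c) :
    ∃ b' ∈ B, (∀ x ∈ T, fiberMap X A x b' = fiberMap X A x b) ∧ ‖b'‖ ≤ c := by
  have hcl : IsClosed {x | c ≤ ‖fiberMap X A x b‖} :=
    isClosed_le continuous_const (continuous_norm_fiberMap hA b)
  obtain ⟨g, g0, g1, g2, -⟩ := exists_urysohn hcl hT
    (Set.disjoint_left.2 fun x hx hx' => not_lt.2 hx (h x hx'))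
  refine ⟨act X (toComplexFun g) b, B.act_mem _ hb, fun x hx => ?_,
    norm_le_of_fiberMap (X := X) hc.le fun x => ?_⟩
  · rw [fiberMap_act, toComplexFun_apply, g1 x hx, Complex.ofReal_one, one_smul]
  · rw [fiberMap_act, toComplexFun_apply, norm_smul, Complex.norm_real, Real.norm_of_nonneg (g2 x).1]
    by_cases hx : c ≤ ‖fiberMap X A x b‖
    · rw [g0 x hx, zero_mul]; exact hc.le
    · nlinarith [norm_nonneg (fiberMap X A x b), (g2 x).1, (g2 x).2]

/-- A section over a closed set that is locally approximable by elements of `B` is the restriction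
of an element of `B`. -/
theorem exists_section (hA : IsContinuousCXAlgebra X A) {T : Set X} (hT : IsClosed T)
    (s : ∀ x, Fiber X A x)
    (hs : ∀ x ∈ T, ∀ ε > 0, ∃ b ∈ B, ∀ᶠ y in 𝓝 x, y ∈ T → ‖s y - fiberMap X A y b‖ < ε) :
    ∃ b ∈ B, ∀ y ∈ T, fiberMap X A y b = s y := by
  have h1 : ∀ n : ℕ, ∃ b ∈ B, ∀ y ∈ T, ‖s y - fiberMap X A y b‖ ≤ (1 / 2) ^ n := fun n =>
    exists_approx_section hT s fun x hx => hs x hx _ (by positivity)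
  choose b hb hb' using h1
  -- Successive approximants are close over `T` only. Replacing their differences by elements of
  -- small norm with the same values over `T` makes the telescoping series converge in `A`.
  have h2 : ∀ n : ℕ, ∃ d ∈ B, (∀ x ∈ T, fiberMap X A x d = fiberMap X A x (b (n + 1) - b n)) ∧
      ‖d‖ ≤ 2 * (1 / 2) ^ n := fun n =>
    exists_small_extension hA hT (sub_mem (hb _) (hb _)) (by positivity) fun x hx => by
      have e1 := hb' n x hx
      have e2 := hb' (n + 1) x hx
      have e3 : (0 : ℝ) < (1 / 2) ^ n := by positivity
      rw [pow_succ] at e2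
      rw [map_sub, ← sub_sub_sub_cancel_left _ _ (s x)]
      refine (norm_sub_le _ _).trans_lt ?_
      linarith
  choose d hd hd' hdn using h2
  have hsum : Summable d := by
    refine .of_norm_bounded (g := fun n : ℕ => 2 * (1 / 2 : ℝ) ^ n) ?_ hdn
    exact (summable_geometric_of_lt_one (by norm_num) (by norm_num)).mul_left 2
  have hlim := hsum.hasSum.tendsto_sum_nat
  refine ⟨b 0 + ∑' n, d n, add_mem (hb 0) ?_, fun y hy => ?_⟩
  · exact B.isClosed.mem_of_tendsto hlim (Eventually.of_forall fun n => sum_mem fun i _ => hd i)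
  · have e1 : Tendsto (fun n => fiberMap X A y (b 0 + ∑ i ∈ Finset.range n, d i)) atTop
        (𝓝 (fiberMap X A y (b 0 + ∑' n, d n))) :=
      ((starHom_continuous (fiberMap X A y)).tendsto _).comp (tendsto_const_nhds.add hlim)
    have e2 : ∀ n, fiberMap X A y (b 0 + ∑ i ∈ Finset.range n, d i) = fiberMap X A y (b n) := by
      intro n
      rw [map_add, map_sum, Finset.sum_congr rfl fun i _ => hd' i y hy, ← map_sum, ← map_add,
        Finset.sum_range_sub, add_sub_cancel]
    simp only [e2] at e1
    refine tendsto_nhds_unique e1 (tendsto_iff_norm_sub_tendsto_zero.2 ?_)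
    refine squeeze_zero (fun _ => norm_nonneg _) (fun n => ?_)
      (tendsto_pow_atTop_nhds_zero_of_lt_one (r := (1 / 2 : ℝ)) (by norm_num) (by norm_num))
    rw [norm_sub_rev]; exact hb' n y hy

/-- Two of the local elements that agree at `x` are close in the fibers near `x`, and the sets not
containing `x` can be avoided. So any one of them that is valid at `x` approximates the section near
`x`. -/
theorem exists_glue (hA : IsContinuousCXAlgebra X A) {κ : Type*} [Finite κ] (T : κ → Set X)
    (hT : ∀ k, IsClosed (T k))
    (s : ∀ x, Fiber X A x) (hs : ∀ k, ∃ b ∈ B, ∀ y ∈ T k, fiberMap X A y b = s y) :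
    ∃ b ∈ B, ∀ k, ∀ y ∈ T k, fiberMap X A y b = s y := by
  choose b hb hb' using hs
  obtain ⟨c, hc, h⟩ := exists_section hA (B := B) (T := ⋃ k, T k) (isClosed_iUnion_of_finite hT) s fun x hx ε hε => by
    obtain ⟨k₀, hk₀⟩ := Set.mem_iUnion.1 hx
    refine ⟨b k₀, hb k₀, ?_⟩
    have h1 : ∀ k, ∀ᶠ y in 𝓝 x, y ∈ T k → ‖s y - fiberMap X A y (b k₀)‖ < ε := by
      intro k
      by_cases hk : x ∈ T k
      · have h2 : ∀ᶠ y in 𝓝 x, ‖fiberMap X A y (b k - b k₀)‖ < ε := by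
          refine (continuous_norm_fiberMap hA _).continuousAt.eventually_lt_const ?_
          simp only [map_sub]
          rw [hb' k x hk, hb' k₀ x hk₀, sub_self, norm_zero]; exact hε
        filter_upwards [h2] with y hy hyT
        rwa [← hb' k y hyT, ← map_sub]
      · filter_upwards [(hT k).isOpen_compl.mem_nhds hk] with y hy hyT
        exact absurd hyT hy
    filter_upwards [eventually_all.2 h1] with y hy hyT
    obtain ⟨k, hk⟩ := Set.mem_iUnion.1 hyT
    exact hy k hk
  exact ⟨c, hc, fun k y hy => h y (Set.mem_iUnion.2 ⟨k, hy⟩)⟩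

theorem exists_approx_of_fiberwise (hA : IsContinuousCXAlgebra X A) {T : Set X} (hT : IsClosed T)
    (a : A) {δ : ℝ}
    (h : ∀ x ∈ T, ∃ b ∈ B, ‖fiberMap X A x a - fiberMap X A x b‖ < δ) :
    ∃ b ∈ B, ∀ y ∈ T, ‖fiberMap X A y a - fiberMap X A y b‖ ≤ δ := by
  refine exists_approx_section hT (fun y => fiberMap X A y a) fun x hx => ?_
  obtain ⟨b, hb, h⟩ := h x hx
  refine ⟨b, hb, ?_⟩
  have : ∀ᶠ y in 𝓝 x, ‖fiberMap X A y (a - b)‖ < δ := by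
    refine (continuous_norm_fiberMap hA _).continuousAt.eventually_lt_const ?_
    simpa only [map_sub] using h
  filter_upwards [this] with y hy _
  rwa [← map_sub]

end SubCX

/-! ### Families of ⋆-homomorphisms into the fibers -/

/-- A family of ⋆-homomorphisms `D → A(x)` whose values on `P` are sections of `B`. -/
def IsSectionHom (B : SubCX X A) (P : Set X) {D : Type u} [NonUnitalCStarAlgebra D]
    (ψ : ∀ x, D →⋆ₙₐ[ℂ] Fiber X A x) : Prop :=
  ∀ d, ∃ b ∈ B, ∀ y ∈ P, fiberMap X A y b = ψ y d

/-- The ideal of the elements of `B` that vanish on `P`. -/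
noncomputable def SubCX.vanishing (B : SubCX X A) (P : Set X) : ClosedIdeal B := by
  classical
  exact ClosedIdeal.ker (lpHom fun x : X => if x ∈ P then (fiberMap X A x).comp B.incl else 0)

theorem SubCX.mem_vanishing {B : SubCX X A} {P : Set X} {b : B} :
    b ∈ B.vanishing P ↔ ∀ y ∈ P, fiberMap X A y (b : A) = 0 := by
  classical
  constructor
  · intro h y hy
    have := congrArg (fun s : lp (fun x => Fiber X A x) ⊤ => s y) (ClosedIdeal.mem_ker.1 h)
    simpa [lpHom_apply, hy, SubCX.incl_apply] using this
  · intro h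
    refine ClosedIdeal.mem_ker.2 (Subtype.ext (funext fun y => ?_))
    rw [lpHom_apply]
    by_cases hy : y ∈ P
    · simpa [hy, SubCX.incl_apply] using h y hy
    · simp [hy]

/-- Stability for families of ⋆-homomorphisms over a closed set `P`, relative to a subset `T`. -/
theorem exists_stable_sectionHom {D : Type u} [NonUnitalCStarAlgebra D]
    [TopologicalSpace.SeparableSpace D] (hD : LiftsAll D) (F : Finset D) {ε : ℝ} (hε : 0 < ε) :
    ∃ (G : Finset D) (δ : ℝ), 0 < δ ∧
      ∀ (B : SubCX X A) (P T : Set X) (_ : T ⊆ P) (ψ ρ : ∀ x, D →⋆ₙₐ[ℂ] Fiber X A x),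
        IsSectionHom B T ρ →
        (∀ g ∈ G, ∃ b ∈ B, (∀ y ∈ P, ‖ψ y g - fiberMap X A y b‖ ≤ δ) ∧
          ∀ y ∈ T, fiberMap X A y b = ρ y g) →
        ∃ ψ' : ∀ x, D →⋆ₙₐ[ℂ] Fiber X A x, IsSectionHom B P ψ' ∧ (∀ y ∈ T, ψ' y = ρ y) ∧
          ∀ f ∈ F, ∀ y ∈ P, ‖ψ' y f - ψ y f‖ < ε := by
  classical
  obtain ⟨G, δ, hδ, H⟩ := hD.exists_stable F hε
  refine ⟨G, δ / 2, half_pos hδ, fun B P T hTP ψ ρ hρ hG => ?_⟩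
  -- Stability is applied to the sections of `B` over `P` inside all bounded families of fiber
  -- elements, with restriction to `T` as the map `π`. Families are extended by zero off `P` and off
  -- `T`.
  let q : ∀ x, (B.vanishing P).QuotAlg →⋆ₙₐ[ℂ] Fiber X A x := fun x =>
    if h : x ∈ P then (B.vanishing P).lift ((fiberMap X A x).comp B.incl)
      fun b hb => SubCX.mem_vanishing.1 hb x h else 0
  have hq : ∀ x ∈ P, ∀ b : B, q x ((B.vanishing P).cls b) = fiberMap X A x b := fun x hx b => by
    simp only [q, dif_pos hx]; rfl
  have hq' : ∀ x ∉ P, ∀ z, q x z = 0 := fun x hx z => by simp [q, dif_neg hx]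
  let j := lpHom q
  let π := lpHom fun x => if x ∈ T then q x else 0
  let Ψ := lpHom fun x => if x ∈ P then ψ x else 0
  let R := lpHom fun x => if x ∈ T then ρ x else 0
  have hπ : ∀ (b : B) d, (∀ y ∈ T, fiberMap X A y (b : A) = ρ y d) → π ((B.vanishing P).cls b) = R d :=
    fun b d hb => Subtype.ext (funext fun y => by
      simp only [π, R, lpHom_apply]
      by_cases hy : y ∈ T
      · simp [hy, hq y (hTP hy), hb y hy]
      · simp [hy])
  have hinj : Function.Injective j := by
    refine (injective_iff_map_eq_zero _).2 fun z hz => ?_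
    obtain ⟨b, rfl⟩ := (B.vanishing P).cls_surjective z
    refine ClosedIdeal.cls_eq_zero.2 (SubCX.mem_vanishing.2 fun y hy => ?_)
    rw [← hq y hy b]
    exact congrArg (fun s : lp (fun x => Fiber X A x) ⊤ => s y) hz
  have htot : ∀ d, ∃ z, π z = R d := fun d => by
    obtain ⟨b, hb, h⟩ := hρ d
    exact ⟨(B.vanishing P).cls ⟨b, hb⟩, hπ ⟨b, hb⟩ d h⟩
  have happ : ∀ g ∈ G, ∃ z, ‖Ψ g - j z‖ < δ ∧ π z = R g := fun g hg => by
    obtain ⟨b, hb, h, h'⟩ := hG g hg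
    refine ⟨(B.vanishing P).cls ⟨b, hb⟩, ?_, hπ ⟨b, hb⟩ g h'⟩
    refine (lp_norm_le (half_pos hδ).le fun y => ?_).trans_lt (half_lt_self hδ)
    change ‖Ψ g y - q y _‖ ≤ _
    by_cases hy : y ∈ P
    · rw [hq y hy]
      simpa [Ψ, lpHom_apply, hy] using h y hy
    · rw [hq' y hy]
      simpa [Ψ, lpHom_apply, hy] using (half_pos hδ).le
  obtain ⟨ψ', h1, h2⟩ := H _ _ _ j π Ψ R hinj htot happ
  refine ⟨fun x => (q x).comp ψ', fun d => ?_, fun y hy => ?_, fun f hf y hy => ?_⟩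
  · obtain ⟨b, hb⟩ := (B.vanishing P).cls_surjective (ψ' d)
    refine ⟨b, b.2, fun y hy => ?_⟩
    rw [NonUnitalStarAlgHom.comp_apply, ← hb, hq y hy]
  · refine NonUnitalStarAlgHom.ext fun d => ?_
    have := congrArg (fun s : lp (fun x => Fiber X A x) ⊤ => s y) (h1 d)
    simpa [π, R, lpHom_apply, hy] using this
  · have := (lp_norm_apply_le (j (ψ' f) - Ψ f) y).trans_lt (h2 f hf)
    have e : (j (ψ' f) - Ψ f) y = q y (ψ' f) - ψ y f := by
      change q y (ψ' f) - Ψ f y = _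
      simp [Ψ, lpHom_apply, hy]
    rwa [e] at this

end Sections

/-! ### Layers -/

section Layers

open CXAlgebra

variable {X : Type u} [TopologicalSpace X] [CompactSpace X] [T2Space X]
  {A : Type u} [NonUnitalCStarAlgebra A] [CXAlgebra X A] {𝒞 : CStarClass.{u}}

theorem IsSectionHom.exists_of_continuousOn (hA : IsContinuousCXAlgebra X A) {B : SubCX X A}
    {P : Set X} (hP : IsClosed P) {D : Type u}
    [NonUnitalCStarAlgebra D] {ψ : ∀ x, D →⋆ₙₐ[ℂ] Fiber X A x} (h : IsSectionHom B P ψ) {e : X → D}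
    (he : ContinuousOn e P) : ∃ b ∈ B, ∀ y ∈ P, fiberMap X A y b = ψ y (e y) := by
  refine SubCX.exists_section hA hP (fun y => ψ y (e y)) fun x hx ε hε => ?_
  obtain ⟨b, hb, hb'⟩ := h (e x)
  refine ⟨b, hb, ?_⟩
  have h1 : ∀ᶠ y in 𝓝[P] x, dist (e y) (e x) < ε := Metric.tendsto_nhds.1 (he x hx) ε hε
  filter_upwards [eventually_nhdsWithin_iff.1 h1] with y hy hyP
  rw [hb' y hyP, ← map_sub]
  refine (starHom_norm_le _ _).trans_lt ?_
  rw [← dist_eq_norm]; exact hy hyP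

/-- Injective ⋆-homomorphisms are isometric. So the distance from `e y` to `e x` is the fiber norm
at `y` of `b` minus a section through the constant `e x`, and this depends continuously on `y`. -/
theorem IsSectionHom.exists_continuousOn (hA : IsContinuousCXAlgebra X A) {B : SubCX X A}
    {P : Set X} {D : Type u} [NonUnitalCStarAlgebra D] {ψ : ∀ x, D →⋆ₙₐ[ℂ] Fiber X A x}
    (h : IsSectionHom B P ψ) (hinj : ∀ y ∈ P, Function.Injective (ψ y)) {b : A}
    (hb : ∀ y ∈ P, fiberMap X A y b ∈ Set.range (ψ y)) :
    ∃ e : X → D, ContinuousOn e P ∧ ∀ y ∈ P, ψ y (e y) = fiberMap X A y b := by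
  have h1 : ∀ y, ∃ d, y ∈ P → ψ y d = fiberMap X A y b := fun y => by
    by_cases hy : y ∈ P
    · obtain ⟨d, hd⟩ := hb y hy; exact ⟨d, fun _ => hd⟩
    · exact ⟨0, fun h => absurd h hy⟩
  choose e he using h1
  refine ⟨e, fun x hx => Metric.tendsto_nhds.2 fun ε hε => ?_, he⟩
  obtain ⟨c, -, hc⟩ := h (e x)
  have h2 : ∀ᶠ y in 𝓝 x, ‖fiberMap X A y (b - c)‖ < ε := by
    refine (SubCX.continuous_norm_fiberMap hA _).continuousAt.eventually_lt_const ?_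
    simp only [map_sub]
    rw [hc x hx, ← he x hx, sub_self, norm_zero]; exact hε
  filter_upwards [eventually_nhdsWithin_of_eventually_nhds h2, self_mem_nhdsWithin] with y hy hyP
  rw [dist_eq_norm, ← NonUnitalStarAlgHom.norm_map (ψ y) (hinj y hyP), map_sub, he y hyP, ← hc y hyP,
    ← map_sub]
  exact hy

/-- Injective sections of `B` over a finite disjoint family of closed sets with domains in `𝒞`. -/
structure Layer (𝒞 : CStarClass.{u}) (B : SubCX X A) where
  r : ℕ
  one_le : 1 ≤ r
  P : Fin r → Set X
  isClosed : ∀ i, IsClosed (P i)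
  disjoint : ∀ i j, i ≠ j → Disjoint (P i) (P j)
  D : Fin r → Type u
  inst : ∀ i, NonUnitalCStarAlgebra (D i)
  mem : ∀ i, 𝒞 (D i)
  ψ : ∀ i x, D i →⋆ₙₐ[ℂ] Fiber X A x
  isSection : ∀ i, IsSectionHom B (P i) (ψ i)
  injective : ∀ i, ∀ y ∈ P i, Function.Injective (ψ i y)

attribute [instance] Layer.inst

namespace Layer

variable {B : SubCX X A} (L : Layer 𝒞 B)

/-- The union of the closed sets of a layer. -/
def support : Set X := ⋃ i, L.P i

theorem isClosed_support : IsClosed L.support := isClosed_iUnion_of_finite L.isClosed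

theorem eq_of_mem {i j : Fin L.r} {y : X} (hi : y ∈ L.P i) (hj : y ∈ L.P j) : i = j := by
  by_contra h
  exact Set.disjoint_left.1 (L.disjoint i j h) hi hj

/-- The elements of `B` whose values over the layer lie in the ranges of its maps. -/
noncomputable def refine : SubCX X A where
  carrier := {b | b ∈ B ∧ ∀ i, ∀ y ∈ L.P i, fiberMap X A y b ∈ Set.range (L.ψ i y)}
  add_mem' {a b} ha hb := ⟨add_mem ha.1 hb.1, fun i y hy => by
    obtain ⟨d, hd⟩ := ha.2 i y hy
    obtain ⟨e, he⟩ := hb.2 i y hy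
    exact ⟨d + e, by rw [map_add, map_add, hd, he]⟩⟩
  zero_mem' := ⟨zero_mem B, fun i y hy => ⟨0, by rw [map_zero, map_zero]⟩⟩
  mul_mem' {a b} ha hb := ⟨mul_mem ha.1 hb.1, fun i y hy => by
    obtain ⟨d, hd⟩ := ha.2 i y hy
    obtain ⟨e, he⟩ := hb.2 i y hy
    exact ⟨d * e, by rw [map_mul, map_mul, hd, he]⟩⟩
  smul_mem' c a ha := ⟨SMulMemClass.smul_mem c ha.1, fun i y hy => by
    obtain ⟨d, hd⟩ := ha.2 i y hy
    exact ⟨c • d, by rw [map_smul, map_smul, hd]⟩⟩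
  star_mem' {a} ha := ⟨star_mem ha.1, fun i y hy => by
    obtain ⟨d, hd⟩ := ha.2 i y hy
    exact ⟨star d, by rw [map_star, map_star, hd]⟩⟩
  act_mem' f a ha := ⟨B.act_mem f ha.1, fun i y hy => by
    obtain ⟨d, hd⟩ := ha.2 i y hy
    exact ⟨f y • d, by rw [map_smul, fiberMap_act, hd]⟩⟩
  isClosed' := by
    have : {b : A | b ∈ B ∧ ∀ i, ∀ y ∈ L.P i, fiberMap X A y b ∈ Set.range (L.ψ i y)} =
        (B : Set A) ∩ ⋂ i, ⋂ y ∈ L.P i, fiberMap X A y ⁻¹' Set.range (L.ψ i y) := by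
      ext b; simp
    change IsClosed {b : A | b ∈ B ∧ ∀ i, ∀ y ∈ L.P i, fiberMap X A y b ∈ Set.range (L.ψ i y)}
    rw [this]
    exact B.isClosed.inter (isClosed_iInter fun i => isClosed_biInter fun y _ =>
      (isClosed_range_starHom _).preimage (starHom_continuous _))

/-- The inclusion of the refined algebra. -/
noncomputable def refineIncl : L.refine →⋆ₙₐ[ℂ] B where
  toFun b := ⟨b, b.2.1⟩
  map_smul' _ _ := rfl
  map_zero' := rfl
  map_add' _ _ := rfl
  map_mul' _ _ := rfl
  map_star' _ := rfl

theorem exists_mem_refine (hA : IsContinuousCXAlgebra X A) (e : ∀ i, X → L.D i)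
    (he : ∀ i, ContinuousOn (e i) (L.P i)) :
    ∃ b ∈ L.refine, ∀ i, ∀ y ∈ L.P i, fiberMap X A y b = L.ψ i y (e i y) := by
  classical
  let s : ∀ x, Fiber X A x := fun x => if h : ∃ i, x ∈ L.P i then L.ψ h.choose x (e h.choose x) else 0
  have hs : ∀ i, ∀ y ∈ L.P i, s y = L.ψ i y (e i y) := fun i y hy => by
    have h : ∃ i, y ∈ L.P i := ⟨i, hy⟩
    have h2 : ∀ j, j = i → L.ψ j y (e j y) = L.ψ i y (e i y) := by rintro j rfl; rfl
    simp only [s, dif_pos h]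
    exact h2 _ (L.eq_of_mem h.choose_spec hy)
  obtain ⟨b, hb, hb'⟩ := SubCX.exists_glue hA (B := B) L.P L.isClosed s fun i => by
    obtain ⟨b, hb, hb'⟩ := (L.isSection i).exists_of_continuousOn hA (L.isClosed i) (he i)
    exact ⟨b, hb, fun y hy => by rw [hb' y hy, hs i y hy]⟩
  have hb2 : ∀ i, ∀ y ∈ L.P i, fiberMap X A y b = L.ψ i y (e i y) := fun i y hy => by
    rw [hb' i y hy, hs i y hy]
  exact ⟨b, ⟨hb, fun i y hy => ⟨_, (hb2 i y hy).symm⟩⟩, hb2⟩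

theorem exists_mem_refine_apply (hA : IsContinuousCXAlgebra X A) (i : Fin L.r) (d : L.D i) :
    ∃ b ∈ L.refine, ∀ y ∈ L.P i, fiberMap X A y b = L.ψ i y d := by
  classical
  obtain ⟨b, hb, h⟩ := L.exists_mem_refine hA (fun j _ => if h : i = j then h ▸ d else 0)
    fun j => continuousOn_const
  exact ⟨b, hb, fun y hy => by rw [h i y hy]; simp⟩

/-- A cut-off vanishing on the support satisfies the layer condition trivially, so refining costs
nothing in the other fibers. -/
theorem exists_mem_refine_of_notMem {y : X} (hy : y ∉ L.support) {b : A} (hb : b ∈ B) :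
    ∃ b' ∈ L.refine, fiberMap X A y b' = fiberMap X A y b := by
  obtain ⟨g, g0, g1, -, -⟩ := exists_urysohn L.isClosed_support (isClosed_singleton (x := y))
    (Set.disjoint_singleton_right.2 hy)
  refine ⟨act X (toComplexFun g) b, ⟨B.act_mem _ hb, fun i z hz => ⟨0, ?_⟩⟩, ?_⟩
  · rw [map_zero, fiberMap_act, toComplexFun_apply, g0 z (Set.mem_iUnion.2 ⟨i, hz⟩),
      Complex.ofReal_zero, zero_smul]
  · rw [fiberMap_act, toComplexFun_apply, g1 y rfl, Complex.ofReal_one, one_smul]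

end Layer

/-- The subalgebras obtained from `A` by `n` successive layers with supports covering `Y`. -/
inductive Built (𝒞 : CStarClass.{u}) : ℕ → Set X → SubCX X A → Prop
  | zero : Built 𝒞 0 ∅ SubCX.univ
  | succ {n : ℕ} {Y : Set X} {B : SubCX X A} (h : Built 𝒞 n Y B) (L : Layer 𝒞 B) :
      Built 𝒞 (n + 1) (Y ∪ L.support) L.refine

theorem Built.isClosed {n : ℕ} {Y : Set X} {B : SubCX X A} (h : Built 𝒞 n Y B) : IsClosed Y := by
  induction h with
  | zero => exact isClosed_empty
  | succ h L ih => exact ih.union L.isClosed_support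

end Layers

/-! ### Local approximation -/

section Approximation

open CXAlgebra

variable {X : Type u} [TopologicalSpace X] [CompactSpace X] [T2Space X]
  {A : Type u} [NonUnitalCStarAlgebra A] [CXAlgebra X A] {𝒞 : CStarClass.{u}}

/-- A ⋆-homomorphism into a fiber extends to nearby fibers. -/
theorem LiftsAll.exists_sectionHom [FirstCountableTopology X] (hA : IsContinuousCXAlgebra X A)
    {D : Type u} [NonUnitalCStarAlgebra D] (hD : LiftsAll D) {x : X} (ι : D →⋆ₙₐ[ℂ] Fiber X A x) :
    ∃ U ∈ 𝓝 x, ∃ ψ : ∀ y, D →⋆ₙₐ[ℂ] Fiber X A y, IsSectionHom SubCX.univ U ψ ∧ ψ x = ι := by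
  classical
  obtain ⟨V, hV, hbasis⟩ := (closed_nhds_basis x).exists_antitone_subbasis
  let B : SubCX X A := SubCX.univ
  let T : B →⋆ₙₐ[ℂ] Fiber X A x := (fiberMap X A x).comp B.incl
  obtain ⟨φ, hφ⟩ := exists_hom_to_quot_ker T ι fun d => by
    obtain ⟨a, ha⟩ := fiberMap_surjective X x (ι d)
    exact ⟨⟨a, trivial⟩, ha⟩
  -- An element vanishing at `x` is small in the nearby fibers, hence close to one that vanishes on
  -- a whole neighbourhood. The lifting property then extends `ι` from `x` to some `V n`.
  have hK : (ClosedIdeal.ker T : Set B) = closure (⋃ n, (B.vanishing (V n) : Set B)) := by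
    refine ClosedIdeal.eq_closure_of (fun n b hb => ?_) fun b hb ε hε => ?_
    · exact SubCX.mem_vanishing.1 hb x (mem_of_mem_nhds (hV n).1)
    · let O := {y | ‖fiberMap X A y (b : A)‖ < ε / 2}
      have hO : IsOpen O := isOpen_lt (SubCX.continuous_norm_fiberMap hA _) continuous_const
      have hxO : x ∈ O := by
        change ‖fiberMap X A x (b : A)‖ < ε / 2
        have : fiberMap X A x (b : A) = 0 := hb
        rw [this, norm_zero]; exact half_pos hε
      obtain ⟨n, -, hn⟩ := hbasis.1.mem_iff.1 (hO.mem_nhds hxO)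
      obtain ⟨g, g0, g1, g2, -⟩ := exists_urysohn (hV n).2 hO.isClosed_compl
        (Set.disjoint_left.2 fun y hy hy' => hy' (hn hy))
      refine ⟨n, act X (toComplexFun g) b, SubCX.mem_vanishing.2 fun y hy => ?_, ?_⟩
      · rw [SubCX.coe_act, fiberMap_act, toComplexFun_apply, g0 y hy, Complex.ofReal_zero, zero_smul]
      · rw [SubCX.norm_coe']
        refine (norm_le_of_fiberMap (X := X) (half_pos hε).le fun y => ?_).trans_lt (half_lt_self hε)
        have e1 : fiberMap X A y ((b - act X (toComplexFun g) b : B) : A) =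
            ((1 - g y : ℝ) : ℂ) • fiberMap X A y (b : A) := by
          change fiberMap X A y ((b : A) - act X (toComplexFun g) (b : A)) = _
          rw [map_sub, fiberMap_act, toComplexFun_apply, Complex.ofReal_sub, sub_smul,
            Complex.ofReal_one, one_smul]
        rw [e1, norm_smul, Complex.norm_real, Real.norm_of_nonneg (by linarith [(g2 y).2])]
        by_cases hy : y ∈ O
        · have hy' : ‖fiberMap X A y (b : A)‖ < ε / 2 := hy
          nlinarith [norm_nonneg (fiberMap X A y (b : A)), (g2 y).1, (g2 y).2]
        · rw [g1 y hy, sub_self, zero_mul]; exact (half_pos hε).le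
  obtain ⟨n, Ψ, hΨ⟩ := hD B (fun n => B.vanishing (V n)) (fun m n hmn b hb =>
    SubCX.mem_vanishing.2 fun y hy => SubCX.mem_vanishing.1 hb y (hbasis.antitone hmn hy)) _ hK φ
  let ψ : ∀ y, D →⋆ₙₐ[ℂ] Fiber X A y := fun y =>
    if h : y ∈ V n then ((B.vanishing (V n)).lift ((fiberMap X A y).comp B.incl)
      fun b hb => SubCX.mem_vanishing.1 hb y h).comp Ψ else 0
  have hψ : ∀ d b, Ψ d = (B.vanishing (V n)).cls b → ∀ y ∈ V n, ψ y d = fiberMap X A y (b : A) := by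
    intro d b hb y hy
    simp only [ψ, dif_pos hy, NonUnitalStarAlgHom.comp_apply, hb]
    rfl
  refine ⟨V n, (hV n).1, ψ, fun d => ?_, NonUnitalStarAlgHom.ext fun d => ?_⟩
  · obtain ⟨b, hb⟩ := (B.vanishing (V n)).cls_surjective (Ψ d)
    exact ⟨b, b.2, fun y hy => (hψ d b hb.symm y hy).symm⟩
  · obtain ⟨b, hb⟩ := (B.vanishing (V n)).cls_surjective (Ψ d)
    rw [hψ d b hb.symm x (mem_of_mem_nhds (hV n).1)]
    refine hφ d b ?_
    rw [← hΨ, NonUnitalStarAlgHom.comp_apply, ← hb]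
    rfl

/-- Take an algebra of the exhaustive sequence close to `F` at `x` and extend its inclusion to
nearby fibers. Closeness to `F` and nonvanishing on the finite test set for injectivity are open
conditions. -/
theorem exists_local_sectionHom [FirstCountableTopology X] (hA : IsContinuousCXAlgebra X A)
    (h𝒞 : ∀ (D : Type u) [NonUnitalCStarAlgebra D], 𝒞 D → IsSumOfSemiprojectiveSimple D)
    {x : X} (hx : HasExhaustiveSequence 𝒞 (Fiber X A x)) (F : Finset A) {ε : ℝ} (hε : 0 < ε) :
    ∃ (D : Type u) (_ : NonUnitalCStarAlgebra D) (U : Set X) (ψ : ∀ y, D →⋆ₙₐ[ℂ] Fiber X A y),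
      𝒞 D ∧ IsOpen U ∧ x ∈ U ∧ IsSectionHom SubCX.univ U ψ ∧
      (∀ y ∈ U, Function.Injective (ψ y)) ∧
      ∀ a ∈ F, ∃ d, ∀ y ∈ U, ‖fiberMap X A y a - ψ y d‖ < ε := by
  classical
  obtain ⟨S, -, hS, hS'⟩ := hx
  obtain ⟨n, hn⟩ := hS' (F.image (fiberMap X A x)) ε hε
  obtain ⟨D, instD, hD, ⟨e⟩⟩ := hS n
  obtain ⟨-, hlift, T, hT0, hT⟩ := (h𝒞 D hD).properties
  let ι : D →⋆ₙₐ[ℂ] Fiber X A x :=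
    (NonUnitalStarSubalgebraClass.subtype (S n)).comp (e : D →⋆ₙₐ[ℂ] S n)
  have hι : Function.Injective ι := Subtype.val_injective.comp (EquivLike.injective e)
  obtain ⟨U, hU, ψ, hψ, hψx⟩ := hlift.exists_sectionHom hA ι
  have hxU := mem_of_mem_nhds hU
  choose b hb hb' using hψ
  have hF : ∀ a, ∃ d, a ∈ F → ‖fiberMap X A x a - ι d‖ < ε := fun a => by
    by_cases ha : a ∈ F
    · obtain ⟨c, hc, hc'⟩ := hn _ (Finset.mem_image_of_mem _ ha)
      refine ⟨e.symm ⟨c, hc⟩, fun _ => ?_⟩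
      have : ι (e.symm ⟨c, hc⟩) = c := congrArg Subtype.val (e.apply_symm_apply ⟨c, hc⟩)
      rwa [this]
    · exact ⟨0, fun h => absurd h ha⟩
  choose d hd using hF
  let U' : Set X := interior U ∩ ((⋂ a ∈ F, {y | ‖fiberMap X A y (a - b (d a))‖ < ε}) ∩
    ⋂ t ∈ T, {y | 0 < ‖fiberMap X A y (b t)‖})
  have hU'U : U' ⊆ U := fun y hy => interior_subset hy.1
  refine ⟨D, instD, U', ψ, hD, ?_, ⟨mem_interior_iff_mem_nhds.2 hU, ?_, ?_⟩, fun d =>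
    ⟨b d, hb d, fun y hy => hb' d y (hU'U hy)⟩, fun y hy => hT _ _ fun t ht h => ?_, fun a ha => ⟨d a, fun y hy => ?_⟩⟩
  · refine isOpen_interior.inter (IsOpen.inter ?_ ?_)
    · exact isOpen_biInter_finset fun a _ =>
        isOpen_lt (SubCX.continuous_norm_fiberMap hA _) continuous_const
    · exact isOpen_biInter_finset fun a _ =>
        isOpen_lt continuous_const (SubCX.continuous_norm_fiberMap hA _)
  · refine Set.mem_iInter₂.2 fun a ha => ?_
    change ‖fiberMap X A x (a - b (d a))‖ < ε
    rw [map_sub, hb' _ x hxU, hψx]; exact hd a ha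
  · refine Set.mem_iInter₂.2 fun t ht => ?_
    change 0 < ‖fiberMap X A x (b t)‖
    rw [hb' _ x hxU, hψx, norm_pos_iff]
    intro h
    rw [← map_zero ι] at h
    exact hT0 (hι h ▸ ht)
  · have h1 : 0 < ‖fiberMap X A y (b t)‖ := Set.mem_iInter₂.1 hy.2.2 t ht
    rw [hb' t y (hU'U hy), h, norm_zero] at h1
    exact lt_irrefl _ h1
  · have h1 : ‖fiberMap X A y (a - b (d a))‖ < ε := Set.mem_iInter₂.1 hy.2.1 a ha
    rwa [map_sub, hb' _ y (hU'U hy)] at h1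

theorem exists_pos_forall_le {ι : Type*} (s : Finset ι) (f : ι → ℝ) (hf : ∀ i ∈ s, 0 < f i) :
    ∃ c, 0 < c ∧ ∀ i ∈ s, c ≤ f i := by
  classical
  induction s using Finset.induction_on with
  | empty => exact ⟨1, one_pos, by simp⟩
  | insert i s hi ih =>
    obtain ⟨c, hc, h⟩ := ih fun j hj => hf j (Finset.mem_insert_of_mem hj)
    refine ⟨min c (f i), lt_min hc (hf i (Finset.mem_insert_self i s)), fun j hj => ?_⟩
    rcases Finset.mem_insert.1 hj with rfl | hj
    · exact min_le_right _ _
    · exact (min_le_left _ _).trans (h j hj)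

/-- Existence of layers: if `B` approximates enough elements, then over sufficiently small closed
sets there is a layer of `B` that approximates a given finite set. -/
theorem exists_layer [FirstCountableTopology X] (hA : IsContinuousCXAlgebra X A)
    (h𝒞 : ∀ (D : Type u) [NonUnitalCStarAlgebra D], 𝒞 D → IsSumOfSemiprojectiveSimple D)
    (hfib : ∀ x : X, HasExhaustiveSequence 𝒞 (Fiber X A x)) (F : Finset A) {ε : ℝ} (hε : 0 < ε) :
    ∃ (F' : Finset A) (ε' : ℝ) (O : X → Set X), 0 < ε' ∧ (∀ x, IsOpen (O x) ∧ x ∈ O x) ∧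
      ∀ (B : SubCX X A) (r : ℕ) (_ : 1 ≤ r) (P : Fin r → Set X), (∀ i, IsClosed (P i)) →
        (∀ i j, i ≠ j → Disjoint (P i) (P j)) → (∀ i, ∃ x, P i ⊆ O x) →
        (∀ a ∈ F', ∀ y, ∃ b ∈ B, ‖fiberMap X A y a - fiberMap X A y b‖ < ε') →
        ∃ L : Layer 𝒞 B, L.support = ⋃ i, P i ∧
          ∀ a ∈ F, ∀ y ∈ L.support, ∃ b ∈ L.refine, ‖fiberMap X A y a - fiberMap X A y b‖ < ε := by
  classical
  choose D instD V ψ hD hVo hxV hψ hinj happ using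
    fun x => exists_local_sectionHom hA h𝒞 (hfib x) F (half_pos hε)
  have happ' : ∀ x a, ∃ d, a ∈ F → ∀ y ∈ V x, ‖fiberMap X A y a - ψ x y d‖ < ε / 2 := fun x a => by
    by_cases ha : a ∈ F
    · obtain ⟨d, hd⟩ := happ x a ha; exact ⟨d, fun _ => hd⟩
    · exact ⟨0, fun h => absurd h ha⟩
  choose d hd using happ'
  choose hsep hlift T hT0 hT using fun x => (h𝒞 (D x) (hD x)).properties
  choose c hc hcT using fun x => exists_pos_forall_le (T x) (fun t => ‖t‖)
    fun t ht => norm_pos_iff.2 fun h => hT0 x (h ▸ ht)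
  choose G δ hδ H using fun x => exists_stable_sectionHom (X := X) (A := A) (hlift x)
    (F.image (d x) ∪ T x) (lt_min (half_pos hε) (hc x))
  choose β _ hβ using hψ
  -- Compactness leaves finitely many model maps, so finitely many elements and one tolerance serve
  -- all small closed sets.
  obtain ⟨s, -, hs⟩ := isCompact_univ.elim_nhds_subcover V fun x _ => (hVo x).mem_nhds (hxV x)
  have hs' : ∀ x, ∃ k ∈ s, x ∈ V k := fun x => by simpa using hs (Set.mem_univ x)
  choose k hks hxk using hs'
  obtain ⟨ε', hε', hε'δ⟩ := exists_pos_forall_le s δ fun x _ => hδ x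
  refine ⟨s.biUnion fun x => (G x).image (β x), ε', fun x => V (k x), hε',
    fun x => ⟨hVo _, hxk x⟩, fun B r hr P hPc hPd hPO hB => ?_⟩
  choose p hp using hPO
  have h1 : ∀ i, ∃ ψ' : ∀ y, D (k (p i)) →⋆ₙₐ[ℂ] Fiber X A y, IsSectionHom B (P i) ψ' ∧
      (∀ y ∈ (∅ : Set X), ψ' y = 0) ∧
      ∀ f ∈ F.image (d (k (p i))) ∪ T (k (p i)), ∀ y ∈ P i,
        ‖ψ' y f - ψ (k (p i)) y f‖ < min (ε / 2) (c (k (p i))) := fun i => by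
    refine H (k (p i)) B (P i) ∅ (Set.empty_subset _) (ψ (k (p i))) (fun y => 0)
      (fun d => ⟨0, zero_mem _, by simp⟩) fun g hg => ?_
    obtain ⟨b, hb, hb'⟩ := SubCX.exists_approx_of_fiberwise hA (hPc i) (β (k (p i)) g)
      fun y _ => hB _ (Finset.mem_biUnion.2 ⟨_, hks _, Finset.mem_image_of_mem _ hg⟩) y
    refine ⟨b, hb, fun y hy => ?_, by simp⟩
    rw [← hβ _ g y (hp i hy)]
    exact (hb' y hy).trans (hε'δ _ (hks _))
  choose ψ' hψ'1 _ hψ'2 using h1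
  let L : Layer 𝒞 B :=
    { r := r, one_le := hr, P := P, isClosed := hPc, disjoint := hPd
      D := fun i => D (k (p i)), inst := fun i => instD _, mem := fun i => hD _
      ψ := ψ', isSection := hψ'1
      -- The model map is isometric and the perturbation moves each test element `t` by less than
      -- `‖t‖`, so its image stays nonzero.
      injective := fun i y hy => hT _ _ _ fun t ht h => by
        have e1 := hψ'2 i t (Finset.mem_union_right _ ht) y hy
        rw [h, zero_sub, norm_neg, NonUnitalStarAlgHom.norm_map _ (hinj _ y (hp i hy))] at e1
        exact absurd (hcT _ t ht) (not_le.2 (e1.trans_le (min_le_right _ _))) }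
  refine ⟨L, rfl, fun a ha y hy => ?_⟩
  obtain ⟨i, hi⟩ := Set.mem_iUnion.1 hy
  obtain ⟨b, hb, hb'⟩ := L.exists_mem_refine_apply hA i (d (k (p i)) a)
  refine ⟨b, hb, ?_⟩
  have e1 := hd (k (p i)) a ha y (hp i hi)
  have e2 := (hψ'2 i _ (Finset.mem_union_left _ (Finset.mem_image_of_mem _ ha)) y hi).trans_le
    (min_le_left _ _)
  rw [hb' y hi]
  rw [norm_sub_rev] at e2
  calc _ ≤ _ := norm_sub_le_norm_sub_add_norm_sub _ (ψ (k (p i)) y (d (k (p i)) a)) _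
    _ < ε := by
      change _ + ‖_ - ψ' i y _‖ < ε
      linarith

/-- Approximation by subalgebras built from layers over sufficiently fine closed covers. -/
theorem exists_built [FirstCountableTopology X] (hA : IsContinuousCXAlgebra X A)
    (h𝒞 : ∀ (D : Type u) [NonUnitalCStarAlgebra D], 𝒞 D → IsSumOfSemiprojectiveSimple D)
    (hfib : ∀ x : X, HasExhaustiveSequence 𝒞 (Fiber X A x)) (N : ℕ) (F : Finset A) {ε : ℝ}
    (hε : 0 < ε) :
    ∃ O : X → Set X, (∀ x, IsOpen (O x) ∧ x ∈ O x) ∧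
      ∀ (r : ℕ) (_ : 1 ≤ r) (P : Fin N → Fin r → Set X), (∀ c i, IsClosed (P c i)) →
        (∀ c i j, i ≠ j → Disjoint (P c i) (P c j)) → (∀ c i, ∃ x, P c i ⊆ O x) →
        ∃ (Y : Set X) (B : SubCX X A), Built 𝒞 N Y B ∧ Y = (⋃ c, ⋃ i, P c i) ∧
          ∀ a ∈ F, ∀ y, ∃ b ∈ B, ‖fiberMap X A y a - fiberMap X A y b‖ < ε := by
  classical
  induction N generalizing F ε with
  | zero =>
    refine ⟨fun _ => Set.univ, fun x => ⟨isOpen_univ, trivial⟩, fun r _ P _ _ _ =>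
      ⟨∅, SubCX.univ, .zero, by simp, fun a _ y => ⟨a, trivial, by simpa using hε⟩⟩⟩
  | succ N ih =>
    -- The demands `F'`, `ε'` of the last layer become targets for the first `N` layers.
    obtain ⟨F', ε', O, hε', hO, H⟩ := exists_layer hA h𝒞 hfib F hε
    obtain ⟨O', hO', H'⟩ := ih (F ∪ F') (lt_min hε hε')
    refine ⟨fun x => O x ∩ O' x, fun x => ⟨(hO x).1.inter (hO' x).1, (hO x).2, (hO' x).2⟩,
      fun r hr P hPc hPd hPO => ?_⟩
    obtain ⟨Y, B, hB, hY, hBF⟩ := H' r hr (fun c => P c.castSucc) (fun c => hPc _) (fun c => hPd _)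
      fun c i => (hPO _ i).imp fun x hx => hx.trans Set.inter_subset_right
    obtain ⟨L, hL, hLF⟩ := H B r hr (P (Fin.last N)) (hPc _) (hPd _)
      (fun i => (hPO _ i).imp fun x hx => hx.trans Set.inter_subset_left)
      fun a ha y => (hBF a (Finset.mem_union_right _ ha) y).imp
        fun b hb => ⟨hb.1, hb.2.trans_le (min_le_right _ _)⟩
    refine ⟨_, _, hB.succ L, ?_, fun a ha y => ?_⟩
    · rw [hY, hL]
      ext y
      simp only [Set.mem_union, Set.mem_iUnion]
      constructor
      · rintro (⟨c, h⟩ | h)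
        exacts [⟨_, h⟩, ⟨_, h⟩]
      · rintro ⟨c, h⟩
        induction c using Fin.lastCases with
        | last => exact Or.inr h
        | cast c => exact Or.inl ⟨c, h⟩
    · by_cases hy : y ∈ L.support
      · exact hLF a ha y hy
      · obtain ⟨b, hb, hb'⟩ := hBF a (Finset.mem_union_left _ ha) y
        obtain ⟨c, hc, hc'⟩ := L.exists_mem_refine_of_notMem hy hb
        exact ⟨c, hc, by rw [hc']; exact hb'.trans_le (min_le_left _ _)⟩

end Approximation

/-! ### Approximate homomorphisms between built subalgebras -/

section ApproxHom

open CXAlgebra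

variable {X : Type u} [TopologicalSpace X] [CompactSpace X] [T2Space X]
  {A : Type u} [NonUnitalCStarAlgebra A] [CXAlgebra X A] {𝒞 : CStarClass.{u}}

/-- A ⋆-homomorphism given on representatives. -/
theorem exists_starHom_of_range_le {B C D E : Type u} [NonUnitalCStarAlgebra B]
    [NonUnitalCStarAlgebra C] [NonUnitalCStarAlgebra D] [NonUnitalCStarAlgebra E]
    (f : D →⋆ₙₐ[ℂ] E) (g : B →⋆ₙₐ[ℂ] E) (m : B →⋆ₙₐ[ℂ] C) (hf : ∀ d, ∃ b, g b = f d)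
    (hm : ∀ b, g b = 0 → m b = 0) :
    ∃ ρ : D →⋆ₙₐ[ℂ] C, ∀ b d, g b = f d → ρ d = m b := by
  obtain ⟨ρ, hρ⟩ := exists_starHom_of_rel (fun d v => ∃ b, g b = f d ∧ m b = v)
    (fun d => by
      obtain ⟨b, hb⟩ := hf d
      exact ⟨_, b, hb, rfl⟩)
    (by
      rintro d d' _ _ ⟨b, hb, rfl⟩ ⟨b', hb', rfl⟩
      exact ⟨b + b', by rw [map_add, map_add, hb, hb'], map_add _ _ _⟩)
    (by
      rintro c d _ ⟨b, hb, rfl⟩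
      exact ⟨c • b, by rw [map_smul, map_smul, hb], map_smul _ _ _⟩)
    (by
      rintro d d' _ _ ⟨b, hb, rfl⟩ ⟨b', hb', rfl⟩
      exact ⟨b * b', by rw [map_mul, map_mul, hb, hb'], map_mul _ _ _⟩)
    (by
      rintro d _ ⟨b, hb, rfl⟩
      exact ⟨star b, by rw [map_star, map_star, hb], map_star _ _⟩)
    (by
      rintro _ ⟨b, hb, rfl⟩
      exact hm b (by rw [hb, map_zero]))
  exact ⟨ρ, fun b d h => (hρ d _).1 ⟨b, h, rfl⟩⟩

/-- The extension step for approximate homomorphisms: a map defined over `Y` extends over the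
support of a layer. -/
theorem Layer.exists_extend_hom (hA : IsContinuousCXAlgebra X A) {B B' : SubCX X A}
    (L : Layer 𝒞 B) {Y : Set X} (hY : IsClosed Y) (m : ∀ x, B →⋆ₙₐ[ℂ] Fiber X A x)
    (hm : IsSectionHom B' Y m) (hm0 : ∀ y ∈ Y, ∀ b : B, fiberMap X A y (b : A) = 0 → m y b = 0)
    (ψ' : ∀ i x, L.D i →⋆ₙₐ[ℂ] Fiber X A x) (hψ' : ∀ i, IsSectionHom B' (L.P i) (ψ' i))
    (hcomp : ∀ i, ∀ y ∈ L.P i, y ∈ Y → ∀ (b : B) (d : L.D i),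
      fiberMap X A y (b : A) = L.ψ i y d → ψ' i y d = m y b) :
    ∃ μ : ∀ x, L.refine →⋆ₙₐ[ℂ] Fiber X A x, IsSectionHom B' (Y ∪ L.support) μ ∧
      (∀ y ∈ Y ∪ L.support, ∀ b : L.refine, fiberMap X A y (b : A) = 0 → μ y b = 0) ∧
      (∀ y ∈ Y, ∀ b, μ y b = m y (L.refineIncl b)) ∧
      ∀ i, ∀ y ∈ L.P i, ∀ (b : L.refine) (d : L.D i),
        L.ψ i y d = fiberMap X A y (b : A) → μ y b = ψ' i y d := by
  -- Over `Y` keep `m`; over the rest of the support replace the values `L.ψ i y d` by `ψ' i y d`.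
  -- The hypothesis `hcomp` makes both rules agree where they overlap.
  have h1 : ∀ y, ∃ μ : L.refine →⋆ₙₐ[ℂ] Fiber X A y,
      (y ∈ Y → ∀ b, μ b = m y (L.refineIncl b)) ∧
      ∀ i, y ∈ L.P i → ∀ (b : L.refine) (d : L.D i),
        L.ψ i y d = fiberMap X A y (b : A) → μ b = ψ' i y d := fun y => by
    by_cases hy : y ∈ Y
    · refine ⟨(m y).comp L.refineIncl, fun _ b => rfl, fun i hi b d h => ?_⟩
      exact (hcomp i y hi hy (L.refineIncl b) d h.symm).symm
    · by_cases hy' : ∃ i, y ∈ L.P i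
      · obtain ⟨i, hi⟩ := hy'
        obtain ⟨ρ, hρ⟩ := exists_starHom_of_range_le ((fiberMap X A y).comp L.refine.incl)
          (L.ψ i y) (ψ' i y) (fun b => b.2.2 i y hi) fun d hd => by
            rw [L.injective i y hi (hd.trans (map_zero _).symm), map_zero]
        refine ⟨ρ, fun h => absurd h hy, fun j hj b d h => ?_⟩
        obtain rfl := L.eq_of_mem hi hj
        exact hρ d b h
      · exact ⟨0, fun h => absurd h hy, fun i hi => absurd ⟨i, hi⟩ hy'⟩
  choose μ hμY hμP using h1
  refine ⟨μ, fun b => ?_, ?_, hμY, fun i y hy => hμP y i hy⟩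
  · obtain ⟨b', hb', h⟩ := SubCX.exists_glue hA (B := B')
      (fun o : Option (Fin L.r) => o.elim Y L.P)
      (by rintro (_ | i); exacts [hY, L.isClosed i]) (fun y => μ y b) (by
        rintro (_ | i)
        · obtain ⟨b', hb', h⟩ := hm (L.refineIncl b)
          exact ⟨b', hb', fun y hy => by rw [h y hy, hμY y hy]⟩
        · obtain ⟨e, he, he'⟩ := (L.isSection i).exists_continuousOn hA (L.injective i)
            (b := (b : A)) (b.2.2 i)
          obtain ⟨b', hb', h⟩ := (hψ' i).exists_of_continuousOn hA (L.isClosed i) he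
          exact ⟨b', hb', fun y hy => by rw [h y hy, hμP y i hy b _ (he' y hy)]⟩)
    refine ⟨b', hb', fun y hy => ?_⟩
    rcases hy with hy | hy
    · exact h none y hy
    · obtain ⟨i, hi⟩ := Set.mem_iUnion.1 hy
      exact h (some i) y hi
  · rintro y (hy | hy) b hb
    · rw [hμY y hy]; exact hm0 y hy _ hb
    · obtain ⟨i, hi⟩ := Set.mem_iUnion.1 hy
      rw [hμP y i hi b 0 (by rw [map_zero, hb]), map_zero]

/-- Weak semiprojectivity, by induction on the layers. Over the new sets, the maps of the layer are
perturbed into `B'` by relative stability, keeping the values forced by the map already defined over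
`Y`. The condition that `μ y` kills what vanishes at `y` says that `μ` acts fiberwise; it makes the
forced values well defined and later yields `C(X)`-linearity. -/
theorem Built.exists_approx_hom (hA : IsContinuousCXAlgebra X A)
    (h𝒞 : ∀ (D : Type u) [NonUnitalCStarAlgebra D], 𝒞 D → IsSumOfSemiprojectiveSimple D)
    {n : ℕ} {Y : Set X} {B : SubCX X A} (h : Built 𝒞 n Y B) (S : Finset B) {ε : ℝ} (hε : 0 < ε) :
    ∃ (G : Finset A) (δ : ℝ), 0 < δ ∧ ∀ B' : SubCX X A, (∀ a ∈ G, ∃ b ∈ B', ‖a - b‖ < δ) →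
      ∃ μ : ∀ x, B →⋆ₙₐ[ℂ] Fiber X A x, IsSectionHom B' Y μ ∧
        (∀ y ∈ Y, ∀ b : B, fiberMap X A y (b : A) = 0 → μ y b = 0) ∧
        ∀ a ∈ S, ∀ y ∈ Y, ‖μ y a - fiberMap X A y (a : A)‖ ≤ ε := by
  classical
  induction h generalizing ε with
  | zero =>
    exact ⟨∅, 1, one_pos, fun B' _ => ⟨fun _ => 0, fun d => ⟨0, zero_mem _, by simp⟩, by simp, by simp⟩⟩
  | @succ n Y B hB L ih =>
    choose e he heq using fun (i : Fin L.r) (a : L.refine) =>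
      (L.isSection i).exists_continuousOn hA (L.injective i) (b := (a : A)) (a.2.2 i)
    -- Stability controls only finitely many elements of `L.D i`, but the elements of `S` trace
    -- compact sets there, so a finite net suffices.
    have hnet : ∀ i, ∃ N : Finset (L.D i), ∀ a ∈ S, ∀ y ∈ L.P i, ∃ d ∈ N, ‖e i a y - d‖ < ε / 4 := by
      intro i
      have hK : IsCompact (⋃ a ∈ S, e i a '' L.P i) :=
        S.isCompact_biUnion fun a _ => (L.isClosed i).isCompact.image_of_continuousOn (he i a)
      obtain ⟨t, -, ht, htK⟩ := hK.finite_cover_balls (show 0 < ε / 4 by positivity)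
      refine ⟨ht.toFinset, fun a ha y hy => ?_⟩
      obtain ⟨d, hd, hd'⟩ := Set.mem_iUnion₂.1
        (htK (Set.mem_iUnion₂.2 ⟨a, ha, Set.mem_image_of_mem _ hy⟩))
      exact ⟨d, by simpa using hd, by simpa [dist_eq_norm] using hd'⟩
    choose N hN using hnet
    have hstab : ∀ i, ∃ (G : Finset (L.D i)) (δ : ℝ), 0 < δ ∧
        ∀ (B : SubCX X A) (P T : Set X) (_ : T ⊆ P) (ψ ρ : ∀ x, L.D i →⋆ₙₐ[ℂ] Fiber X A x),
        IsSectionHom B T ρ →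
        (∀ g ∈ G, ∃ b ∈ B, (∀ y ∈ P, ‖ψ y g - fiberMap X A y b‖ ≤ δ) ∧
          ∀ y ∈ T, fiberMap X A y b = ρ y g) →
        ∃ ψ' : ∀ x, L.D i →⋆ₙₐ[ℂ] Fiber X A x, IsSectionHom B P ψ' ∧ (∀ y ∈ T, ψ' y = ρ y) ∧
          ∀ f ∈ N i, ∀ y ∈ P, ‖ψ' y f - ψ y f‖ < ε / 4 := fun i => by
      obtain ⟨hsep, hlift, -⟩ := (h𝒞 _ (L.mem i)).properties
      exact exists_stable_sectionHom hlift (N i) (by positivity)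
    choose G δ hδ H using hstab
    choose β hβB hβ using L.isSection
    obtain ⟨δ₀, hδ₀, hδ₀δ⟩ := exists_pos_forall_le Finset.univ δ fun i _ => hδ i
    obtain ⟨G', δ', hδ', H'⟩ := ih
      (S.image L.refineIncl ∪ Finset.univ.biUnion fun i => (G i).image fun g => (⟨β i g, hβB i g⟩ : B))
      (lt_min hε (show 0 < δ₀ / 4 by positivity))
    refine ⟨G' ∪ Finset.univ.biUnion fun i => (G i).image (β i), min δ' (δ₀ / 4),
      lt_min hδ' (by positivity), fun B' hB' => ?_⟩
    obtain ⟨m, hm, hm0, hmS⟩ := H' B' fun a ha =>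
      (hB' a (Finset.mem_union_left _ ha)).imp fun b hb => ⟨hb.1, hb.2.trans_le (min_le_left _ _)⟩
    -- The map prescribed on the overlap: represent `L.ψ i y d` by an element of `B` and apply `m
    -- y`.
    have hρ : ∀ i y, ∃ ρ : L.D i →⋆ₙₐ[ℂ] Fiber X A y, y ∈ L.P i ∩ Y →
        ∀ (b : B) (d : L.D i), fiberMap X A y (b : A) = L.ψ i y d → ρ d = m y b := fun i y => by
      by_cases hy : y ∈ L.P i ∩ Y
      · obtain ⟨ρ, hρ⟩ := exists_starHom_of_range_le (L.ψ i y) ((fiberMap X A y).comp B.incl) (m y)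
          (fun d => ⟨⟨β i d, hβB i d⟩, hβ i d y hy.1⟩) (hm0 y hy.2)
        exact ⟨ρ, fun _ b d h => hρ b d h⟩
      · exact ⟨0, fun h => absurd h hy⟩
    choose ρ hρ using hρ
    have hψ' : ∀ i, ∃ ψ' : ∀ x, L.D i →⋆ₙₐ[ℂ] Fiber X A x, IsSectionHom B' (L.P i) ψ' ∧
        (∀ y ∈ L.P i ∩ Y, ψ' y = ρ i y) ∧
          ∀ f ∈ N i, ∀ y ∈ L.P i, ‖ψ' y f - L.ψ i y f‖ < ε / 4 := fun i => by
      refine H i B' (L.P i) (L.P i ∩ Y) Set.inter_subset_left (L.ψ i) (ρ i) (fun d => ?_) fun g hg => ?_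
      · obtain ⟨b, hb, h⟩ := hm ⟨β i d, hβB i d⟩
        exact ⟨b, hb, fun y hy => by rw [h y hy.2, hρ i y hy ⟨β i d, hβB i d⟩ d (hβ i d y hy.1)]⟩
      · obtain ⟨b, hb, h⟩ := hm ⟨β i g, hβB i g⟩
        obtain ⟨c, hc, hcn⟩ := hB' (β i g) (Finset.mem_union_right _
          (Finset.mem_biUnion.2 ⟨i, Finset.mem_univ i, Finset.mem_image_of_mem _ hg⟩))
        replace hcn := hcn.trans_le (min_le_right _ _)
        -- Both `c` and the values `b` of `m` are within `δ₀ / 4` of `β i g` over the overlap.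
        -- Subtracting a small extension `x` of `c - b` makes `c` exact there while staying within
        -- `3 δ₀ / 4` of `β i g` everywhere.
        obtain ⟨x, hx, hx', hxn⟩ := SubCX.exists_small_extension hA ((L.isClosed i).inter hB.isClosed)
          (sub_mem hc hb) (show 0 < δ₀ / 2 by positivity) fun y hy => by
            have e1 := hmS ⟨β i g, hβB i g⟩ (Finset.mem_union_right _
              (Finset.mem_biUnion.2 ⟨i, Finset.mem_univ i, Finset.mem_image_of_mem _ hg⟩)) y hy.2
            replace e1 := e1.trans (min_le_right _ _)
            have e2 := (norm_fiberMap_le (X := X) y (β i g - c)).trans_lt hcn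
            rw [map_sub] at e2 ⊢
            rw [h y hy.2]
            have e3 := norm_sub_le_norm_sub_add_norm_sub (fiberMap X A y c) (fiberMap X A y (β i g))
              (m y ⟨β i g, hβB i g⟩)
            rw [norm_sub_rev] at e1 e2
            change ‖fiberMap X A y (β i g) - _‖ ≤ _ at e1
            linarith
        refine ⟨c - x, sub_mem hc hx, fun y hy => ?_, fun y hy => ?_⟩
        · refine le_trans ?_ (hδ₀δ i (Finset.mem_univ i))
          rw [← hβ i g y hy, ← map_sub]
          refine (norm_fiberMap_le (X := X) _ _).trans ?_
          rw [← sub_add]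
          exact (norm_add_le _ _).trans (by linarith)
        · rw [map_sub, hx' y hy, map_sub, sub_sub_cancel, h y hy.2,
            hρ i y hy ⟨β i g, hβB i g⟩ g (hβ i g y hy.1)]
    choose ψ' hψ'1 hψ'2 hψ'3 using hψ'
    obtain ⟨μ, hμ1, hμ2, hμ3, hμ4⟩ := L.exists_extend_hom hA hB.isClosed m hm hm0 ψ' hψ'1
      fun i y hi hy b d hd => by rw [hψ'2 i y ⟨hi, hy⟩, hρ i y ⟨hi, hy⟩ b d hd]
    refine ⟨μ, hμ1, hμ2, fun a ha y hy => ?_⟩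
    rcases hy with hy | hy
    · rw [hμ3 y hy]
      exact (hmS _ (Finset.mem_union_left _ (Finset.mem_image_of_mem _ ha)) y hy).trans (min_le_left _ _)
    · obtain ⟨i, hi⟩ := Set.mem_iUnion.1 hy
      obtain ⟨d, hd, hd'⟩ := hN i a ha y hi
      rw [hμ4 i y hi a _ (heq i a y hi), ← heq i a y hi]
      have e1 := hψ'3 i d hd y hi
      have e2 := (starHom_norm_le (ψ' i y) (e i a y - d)).trans_lt hd'
      have e3 := (starHom_norm_le (L.ψ i y) (e i a y - d)).trans_lt hd'
      rw [map_sub] at e2 e3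
      rw [norm_sub_rev] at e3
      have e4 := norm_sub_le_norm_sub_add_norm_sub (ψ' i y (e i a y)) (ψ' i y d) (L.ψ i y (e i a y))
      have e5 := norm_sub_le_norm_sub_add_norm_sub (ψ' i y d) (L.ψ i y d) (L.ψ i y (e i a y))
      linarith

end ApproxHom

/-! ### Algebras represented by sections -/

section Represents

open CXAlgebra

variable {X : Type u} [TopologicalSpace X] [CompactSpace X] [T2Space X]
  {A : Type u} [NonUnitalCStarAlgebra A] [CXAlgebra X A] {𝒞 : CStarClass.{u}}

/-- The `C(W)`-algebra `R` is identified, through the maps `ev`, with the sections of `B` pulled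
back along `i : W → X`. -/
structure Represents {W : Type u} [TopologicalSpace W] [CompactSpace W] [T2Space W] (i : W → X)
    (B : SubCX X A) (R : Type u) [NonUnitalCStarAlgebra R] [CXAlgebra W R]
    (ev : ∀ w, R →⋆ₙₐ[ℂ] Fiber X A (i w)) : Prop where
  act : ∀ f r w, ev w (act W f r) = f w • ev w r
  norm_le : ∀ r c, 0 ≤ c → (∀ w, ‖ev w r‖ ≤ c) → ‖r‖ ≤ c
  section_of : ∀ r, ∃ b ∈ B, ∀ w, fiberMap X A (i w) b = ev w r
  exists_of : ∀ b ∈ B, ∃ r, ∀ w, ev w r = fiberMap X A (i w) b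

theorem map_eq_zero_of_mem_vanishingIdeal {R C : Type u} [NonUnitalCStarAlgebra R]
    [CXAlgebra X R] [NonUnitalCStarAlgebra C] {S : Set X} (φ : R →⋆ₙₐ[ℂ] C)
    (h : ∀ (f : C(X, ℂ)) a, (∀ x ∈ S, f x = 0) → φ (act X f a) = 0) {a : R}
    (ha : a ∈ vanishingIdeal X R S) : φ a = 0 := by
  have hc : IsClosed {a : R | φ a = 0} := isClosed_eq (starHom_continuous φ) continuous_const
  refine closure_minimal ?_ hc ha
  intro b hb
  change b ∈ vanishingSpan X R S at hb
  change φ b = 0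
  induction hb using Submodule.span_induction with
  | mem x hx => obtain ⟨f, a, hf, rfl⟩ := hx; exact h f a hf
  | zero => exact map_zero φ
  | add x y _ _ hx hy => rw [map_add, hx, hy, add_zero]
  | smul c x _ hx => rw [map_smul, hx, smul_zero]

namespace Represents

variable {W : Type u} [TopologicalSpace W] [CompactSpace W] [T2Space W] {i : W → X}
  {B : SubCX X A} {R : Type u} [NonUnitalCStarAlgebra R] [CXAlgebra W R]
  {ev : ∀ w, R →⋆ₙₐ[ℂ] Fiber X A (i w)}

theorem ext (h : Represents i B R ev) {r r' : R} (h' : ∀ w, ev w r = ev w r') : r = r' := by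
  rw [← sub_eq_zero, ← norm_le_zero_iff]
  exact h.norm_le _ 0 le_rfl fun w => by rw [map_sub, h' w, sub_self, norm_zero]

/-- A section that vanishes on `S` is small near `S`, so multiplying it by a function that vanishes
on `S` and is one away from `S` changes it little. -/
theorem mem_vanishingIdeal (h : Represents i B R ev) (hA : IsContinuousCXAlgebra X A)
    (hi : Continuous i) {S : Set W} (hS : IsClosed S) {r : R} :
    r ∈ vanishingIdeal W R S ↔ ∀ w ∈ S, ev w r = 0 := by
  refine ⟨fun hr w hw => map_eq_zero_of_mem_vanishingIdeal (ev w)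
    (fun f a hf => by rw [h.act, hf w hw, zero_smul]) hr, fun hr => ?_⟩
  refine ClosedIdeal.mem_of_forall_approx _ fun ε hε => ?_
  obtain ⟨b, -, hb⟩ := h.section_of r
  have hO : IsOpen {w | ‖ev w r‖ < ε / 2} := by
    simp only [← hb]
    exact isOpen_lt ((SubCX.continuous_norm_fiberMap hA b).comp hi) continuous_const
  obtain ⟨g, g0, g1, g2, -⟩ := exists_urysohn hS hO.isClosed_compl
    (Set.disjoint_left.2 fun w hw hw' => hw' (by simpa [hr w hw] using hε))
  refine ⟨CXAlgebra.act W (toComplexFun g) r, act_mem_vanishingIdeal W (fun w hw => by simp [g0 w hw]) r,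
    (h.norm_le _ (ε / 2) (half_pos hε).le fun w => ?_).trans_lt (half_lt_self hε)⟩
  have e1 : ev w (r - CXAlgebra.act W (toComplexFun g) r) = ((1 - g w : ℝ) : ℂ) • ev w r := by
    rw [map_sub, h.act, toComplexFun_apply, Complex.ofReal_sub, sub_smul, Complex.ofReal_one, one_smul]
  rw [e1, norm_smul, Complex.norm_real, Real.norm_of_nonneg (by linarith [(g2 w).2])]
  by_cases hw : ‖ev w r‖ < ε / 2
  · nlinarith [norm_nonneg (ev w r), (g2 w).1, (g2 w).2]
  · rw [g1 w hw, sub_self, zero_mul]; exact (half_pos hε).le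

/-- Restriction of sections along `k : V → W`. -/
theorem exists_hom (h : Represents i B R ev) {V : Type u} [TopologicalSpace V] [CompactSpace V]
    [T2Space V] {k : V → W} {B' : SubCX X A} (hB : ∀ b ∈ B, b ∈ B') {R' : Type u}
    [NonUnitalCStarAlgebra R'] [CXAlgebra V R'] {ev' : ∀ v, R' →⋆ₙₐ[ℂ] Fiber X A (i (k v))}
    (h' : Represents (fun v => i (k v)) B' R' ev') :
    ∃ σ : R →⋆ₙₐ[ℂ] R', ∀ r v, ev' v (σ r) = ev (k v) r := by
  obtain ⟨σ, hσ⟩ := exists_starHom_of_range_le (lpHom fun v => ev (k v)) (lpHom ev')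
    (NonUnitalStarAlgHom.id ℂ R') (fun r => by
      obtain ⟨b, hb, hb'⟩ := h.section_of r
      obtain ⟨r', hr'⟩ := h'.exists_of b (hB b hb)
      exact ⟨r', Subtype.ext (funext fun v => by rw [lpHom_apply, lpHom_apply, hr', hb'])⟩)
    fun r hr => h'.ext fun v => by
      rw [map_zero]
      exact congrArg (fun s : lp (fun v => Fiber X A (i (k v))) ⊤ => s v) hr
  refine ⟨σ, fun r v => ?_⟩
  obtain ⟨b, hb, hb'⟩ := h.section_of r
  obtain ⟨r', hr'⟩ := h'.exists_of b (hB b hb)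
  rw [hσ r' r (Subtype.ext (funext fun v => by rw [lpHom_apply, lpHom_apply, hr', hb']))]
  change ev' v r' = _
  rw [hr', hb']

theorem exists_equiv (h : Represents i B R ev) {R' : Type u}
    [NonUnitalCStarAlgebra R'] [CXAlgebra W R'] {ev' : ∀ w, R' →⋆ₙₐ[ℂ] Fiber X A (i w)}
    (h' : Represents i B R' ev') :
    ∃ σ : R ≃⋆ₐ[ℂ] R', ∀ r w, ev' w (σ r) = ev w r := by
  obtain ⟨σ, hσ⟩ := h.exists_hom (k := id) (fun b hb => hb) h'
  refine ⟨StarAlgEquiv.ofBijective σ ⟨fun r r' hr => h.ext fun w => ?_, fun r' => ?_⟩, hσ⟩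
  · exact (hσ r w).symm.trans ((congrArg (ev' w) hr).trans (hσ r' w))
  · obtain ⟨b, hb, hb'⟩ := h'.section_of r'
    obtain ⟨r, hr⟩ := h.exists_of b hb
    exact ⟨r, h'.ext fun w => (hσ r w).trans ((hr w).trans (hb' w))⟩

end Represents

theorem SubCX.represents (B : SubCX X A) :
    Represents (fun x : X => x) B B fun x => (fiberMap X A x).comp B.incl where
  act f r w := fiberMap_act X w f (r : A)
  norm_le r _ hc h := norm_le_of_fiberMap (X := X) (a := (r : A)) hc h
  section_of r := ⟨r, r.2, fun _ => rfl⟩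
  exists_of b hb := ⟨⟨b, hb⟩, fun _ => rfl⟩

theorem SubCX.mem_vanishingIdeal (hA : IsContinuousCXAlgebra X A) {B : SubCX X A} {S : Set X}
    (hS : IsClosed S) {b : B} :
    b ∈ vanishingIdeal X B S ↔ ∀ x ∈ S, fiberMap X A x (b : A) = 0 :=
  B.represents.mem_vanishingIdeal hA continuous_id hS

theorem SubCX.isContinuous (hA : IsContinuousCXAlgebra X A) (B : SubCX X A) :
    IsContinuousCXAlgebra X B := fun b => by
  have : ∀ x, ‖(vanishingIdeal X B {x}).proj b‖ = ‖fiberMap X A x (b : A)‖ := fun x =>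
    ClosedIdeal.norm_cls_eq _ ((fiberMap X A x).comp B.incl)
      (fun a => by rw [SubCX.mem_vanishingIdeal hA isClosed_singleton]; simp [SubCX.incl_apply]) b
  simp only [this]
  exact SubCX.continuous_norm_fiberMap hA _

/-- Evaluation of elements of a restriction of `B`. -/
noncomputable def SubCX.restrictionEval (B : SubCX X A) {V : Type u} [TopologicalSpace V]
    (j : C(V, X)) (v : V) : Restriction j B →⋆ₙₐ[ℂ] Fiber X A (j v) :=
  (vanishingIdeal X B (Set.range j)).lift ((fiberMap X A (j v)).comp B.incl) fun _ ha =>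
    map_eq_zero_of_mem_vanishingIdeal ((fiberMap X A (j v)).comp B.incl) (fun f a hf => by
      rw [NonUnitalStarAlgHom.comp_apply, SubCX.incl_apply, SubCX.coe_act, fiberMap_act,
        hf _ ⟨v, rfl⟩, zero_smul]) ha

theorem act_restriction_cls {R V : Type u} [NonUnitalCStarAlgebra R] [CXAlgebra X R]
    [TopologicalSpace V] [CompactSpace V] [T2Space V] (j : C(V, X)) [hj : Fact (Function.Injective j)]
    (f : C(V, ℂ)) (r : R) :
    act V f (restrictionMap j R r) = restrictionMap j R (act X (extendFun hj.out f) r) := rfl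

theorem extendFun_apply {V : Type u} [TopologicalSpace V] [CompactSpace V] {j : C(V, X)}
    (hj : Function.Injective j) (f : C(V, ℂ)) (v : V) : extendFun hj f (j v) = f v :=
  congrArg (fun k : C(V, ℂ) => k v) (extendFun_comp hj f)

/-- The norm estimate is the substance: an element with fiber norms at most `c` over the closed set
has representatives of norm arbitrarily close to `c`, by a cut-off. -/
theorem SubCX.represents_restriction (hA : IsContinuousCXAlgebra X A) (B : SubCX X A) {V : Type u}
    [TopologicalSpace V] [CompactSpace V] [T2Space V] (j : C(V, X))
    [hj : Fact (Function.Injective j)] :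
    Represents j B (Restriction j B) (B.restrictionEval j) where
  act f r w := by
    obtain ⟨b, rfl⟩ := ClosedIdeal.cls_surjective _ r
    change fiberMap X A (j w) (CXAlgebra.act X (extendFun hj.out f) (b : A)) = f w • fiberMap X A (j w) (b : A)
    rw [fiberMap_act, extendFun_apply]
  norm_le r c hc h := by
    obtain ⟨b, rfl⟩ := ClosedIdeal.cls_surjective _ r
    have hcl : IsClosed (Set.range j) := (isCompact_range j.continuous).isClosed
    refine le_of_forall_pos_le_add fun ε hε => ?_
    obtain ⟨b', hb', h1, h2⟩ := SubCX.exists_small_extension hA hcl b.2 (c := c + ε)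
      (by positivity) (by
        rintro _ ⟨v, rfl⟩
        have h3 : ‖fiberMap X A (j v) (b : A)‖ ≤ c := h v
        linarith)
    have h3 : (vanishingIdeal X B (Set.range j)).cls b =
        (vanishingIdeal X B (Set.range j)).cls ⟨b', hb'⟩ := by
      refine ClosedIdeal.cls_eq_cls.2 ((SubCX.mem_vanishingIdeal hA hcl).2 fun x hx => ?_)
      change fiberMap X A x ((b : A) - b') = 0
      rw [map_sub, h1 x hx, sub_self]
    rw [h3]
    exact (ClosedIdeal.norm_mk_le _).trans h2
  section_of r := by
    obtain ⟨b, rfl⟩ := ClosedIdeal.cls_surjective _ r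
    exact ⟨b, b.2, fun _ => rfl⟩
  exists_of b hb := ⟨ClosedIdeal.cls _ ⟨b, hb⟩, fun _ => rfl⟩

end Represents

/-! ### The category of built subalgebras -/

section Category

open CXAlgebra TopologicalSpace

/-- The `C(Z)`-algebra `⨁ C(P k) ⊗ D k`, with pointwise action. -/
@[reducible] noncomputable def piCXAlgebra {Z : Type u} [TopologicalSpace Z] [CompactSpace Z] [T2Space Z]
    {r : ℕ} (P : Fin r → Closeds Z) (D : Fin r → Type u) [∀ k, NonUnitalCStarAlgebra (D k)] :
    CXAlgebra Z (∀ k, C(P k, D k)) :=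
  ofAct Z (fun f => LinearMap.mkContinuous
      { toFun := fun e k => ⟨fun z => f z • e k z, by fun_prop⟩
        map_add' := fun a b => by ext; simp
        map_smul' := fun c a => by ext k z; exact smul_comm (f z) c (a k z) } ‖f‖ fun e => by
      refine (pi_norm_le_iff_of_nonneg (by positivity)).2 fun k =>
        (ContinuousMap.norm_le _ (by positivity)).2 fun z => ?_
      change ‖f z • e k z‖ ≤ _
      rw [norm_smul]
      exact mul_le_mul (f.norm_coe_le_norm _) (((e k).norm_coe_le_norm z).trans (norm_le_pi_norm e k))
        (norm_nonneg _) (norm_nonneg _))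
    (fun f g a => by ext; simp [add_smul])
    (fun c f a => by ext; simp [mul_smul])
    (fun f g a => by ext; simp [mul_smul])
    (fun f a => by ext; simp [star_smul])
    (fun f a b => by ext k z; exact (smul_mul_assoc (f z) (a k z) (b k z)).symm)
    (fun f a b => by ext k z; exact (mul_smul_comm (f z) (a k z) (b k z)).symm)
    (fun a => by ext; simp)

theorem exists_continuousOn_range {K X D : Type*} [TopologicalSpace K] [TopologicalSpace X]
    [TopologicalSpace D] [Zero D] {j : K → X} (hj : IsEmbedding j) (f : C(K, D)) :
    ∃ g : X → D, ContinuousOn g (Set.range j) ∧ ∀ k, g (j k) = f k := by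
  have h : ∀ k, Function.extend j f 0 (j k) = f k := fun k => hj.injective.extend_apply f 0 k
  refine ⟨Function.extend j f 0, ?_, h⟩
  rintro _ ⟨k, rfl⟩
  rw [ContinuousWithinAt, ← hj.map_nhds_eq, tendsto_map'_iff, h]
  refine (f.continuous.tendsto k).congr fun k => (h k).symm

variable {X : Type u} [TopologicalSpace X] [CompactSpace X] [T2Space X]
  {A : Type u} [NonUnitalCStarAlgebra A] [CXAlgebra X A] {𝒞 : CStarClass.{u}}

/-- A layer of `B`, pulled back along an injective map onto its support, gives an elementary algebra
that represents the refined algebra over the support. -/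
theorem Layer.exists_elementary (hA : IsContinuousCXAlgebra X A) {B : SubCX X A} (L : Layer 𝒞 B)
    {Z : Type u} [TopologicalSpace Z] [CompactSpace Z] [T2Space Z] (i : Z → X)
    (hi : Continuous i) (hinj : Function.Injective i) (hr : Set.range i = L.support) :
    ∃ (E : Type u) (_ : NonUnitalCStarAlgebra E) (_ : CXAlgebra Z E)
      (ev : ∀ z, E →⋆ₙₐ[ℂ] Fiber X A (i z)), IsElementary 𝒞 Z E ∧ Represents i L.refine E ev := by
  let P : Fin L.r → Closeds Z := fun k => ⟨i ⁻¹' L.P k, (L.isClosed k).preimage hi⟩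
  have hP : ∀ z, ∃ k, i z ∈ L.P k := fun z => by
    have : i z ∈ L.support := hr ▸ Set.mem_range_self z
    exact Set.mem_iUnion.1 this
  choose κ hκ using hP
  let _ := piCXAlgebra P L.D
  have hev : ∀ z, ∃ ev : (∀ k, C(P k, L.D k)) →⋆ₙₐ[ℂ] Fiber X A (i z),
      ∀ e k (h : i z ∈ L.P k), ev e = L.ψ k (i z) (e k ⟨z, h⟩) := fun z => by
    refine ⟨(L.ψ (κ z) (i z)).comp
      { toFun := fun e => e (κ z) ⟨z, hκ z⟩
        map_smul' := fun _ _ => rfl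
        map_zero' := rfl
        map_add' := fun _ _ => rfl
        map_mul' := fun _ _ => rfl
        map_star' := fun _ => rfl }, fun e k h => ?_⟩
    obtain rfl := L.eq_of_mem (hκ z) h
    rfl
  choose ev hev using hev
  refine ⟨∀ k, C(P k, L.D k), inferInstance, inferInstance, ev,
    ⟨L.r, L.one_le, P, L.D, L.inst, ?_, ?_, L.mem, StarAlgEquiv.refl ℂ _, fun f e k z => rfl⟩, ?_⟩
  · exact Set.eq_univ_of_forall fun z => Set.mem_iUnion.2 ⟨κ z, hκ z⟩
  · exact fun k l hkl => (L.disjoint k l hkl).preimage i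
  · refine ⟨fun f r w => ?_, fun e c hc h => ?_, fun e => ?_, fun b hb => ?_⟩
    · rw [hev w _ _ (hκ w), hev w _ _ (hκ w), ← map_smul]; rfl
    · refine (pi_norm_le_iff_of_nonneg hc).2 fun k => (ContinuousMap.norm_le _ hc).2 fun z => ?_
      rw [← NonUnitalStarAlgHom.norm_map (L.ψ k (i z)) (L.injective k _ z.2), ← hev z.1 e k z.2]
      exact h z
    · have h1 : ∀ k, ∃ g : X → L.D k, ContinuousOn g (L.P k) ∧ ∀ z : P k, g (i z) = e k z := fun k => by
        have hj : IsEmbedding fun z : P k => i z :=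
          (hi.isClosedEmbedding hinj).isEmbedding.comp .subtypeVal
        obtain ⟨g, hg, hg'⟩ := exists_continuousOn_range hj (e k)
        refine ⟨g, hg.mono fun y hy => ?_, hg'⟩
        obtain ⟨z, rfl⟩ : y ∈ Set.range i := hr ▸ Set.mem_iUnion.2 ⟨k, hy⟩
        exact ⟨⟨z, hy⟩, rfl⟩
      choose g hg hg' using h1
      obtain ⟨b, hb, h⟩ := L.exists_mem_refine hA g hg
      refine ⟨b, hb, fun z => ?_⟩
      rw [h _ _ (hκ z), hev z e _ (hκ z), ← hg' (κ z) ⟨z, hκ z⟩]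
    · choose g hg hg' using fun k => (L.isSection k).exists_continuousOn hA (L.injective k) (hb.2 k)
      refine ⟨fun k => ⟨fun z => g k (i z), (hg k).comp_continuous (by fun_prop) fun z => z.2⟩,
        fun z => ?_⟩
      rw [hev z _ _ (hκ z)]
      exact hg' _ _ (hκ z)

theorem IsElementary.of_represents {B : SubCX X A} {W : Type u} [TopologicalSpace W]
    [CompactSpace W] [T2Space W] {i : W → X} {E R : Type u} [NonUnitalCStarAlgebra E]
    [CXAlgebra W E] [NonUnitalCStarAlgebra R] [CXAlgebra W R]
    {ev : ∀ w, E →⋆ₙₐ[ℂ] Fiber X A (i w)} {ev' : ∀ w, R →⋆ₙₐ[ℂ] Fiber X A (i w)}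
    (hE : IsElementary 𝒞 W E) (h : Represents i B E ev) (h' : Represents i B R ev') :
    IsElementary 𝒞 W R := by
  obtain ⟨r, hr, P, D, inst, h1, h2, h3, Φ, hΦ⟩ := hE
  obtain ⟨σ, hσ⟩ := h'.exists_equiv h
  refine ⟨r, hr, P, D, inst, h1, h2, h3, σ.trans Φ, fun f e k z => ?_⟩
  have : σ (act W f e) = act W f (σ e) := h.ext fun w => by rw [hσ, h.act, h'.act, hσ]
  change Φ (σ _) k z = f z • Φ (σ e) k z
  rw [this, hΦ]

/-- The pullback decomposition of the sections of a refined algebra. -/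
theorem Layer.exists_pullback (hA : IsContinuousCXAlgebra X A) {B : SubCX X A} (L : Layer 𝒞 B)
    {S : Set X} (hS : IsClosed S) {W : Type u} [TopologicalSpace W] [CompactSpace W] [T2Space W]
    {i : W → X} (hi : Continuous i) (hr : Set.range i = S ∪ L.support) (Y Z : Closeds W)
    (hY : (Y : Set W) = i ⁻¹' S) (hZ : (Z : Set W) = i ⁻¹' L.support)
    {R RB E : Type u} [NonUnitalCStarAlgebra R] [CXAlgebra W R] [NonUnitalCStarAlgebra RB]
    [CXAlgebra Y RB] [NonUnitalCStarAlgebra E] [CXAlgebra Z E]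
    {ev : ∀ w, R →⋆ₙₐ[ℂ] Fiber X A (i w)} {evB : ∀ y : Y, RB →⋆ₙₐ[ℂ] Fiber X A (i y)}
    {evE : ∀ z : Z, E →⋆ₙₐ[ℂ] Fiber X A (i z)} (h : Represents i L.refine R ev)
    (hB : Represents (fun y : Y => i y) B RB evB)
    (hE : Represents (fun z : Z => i z) L.refine E evE) :
    ∃ (γ : Restriction (closedsInclusion (inf_le_right : Y ⊓ Z ≤ Z)) E →⋆ₙₐ[ℂ]
        Restriction (closedsInclusion (inf_le_left : Y ⊓ Z ≤ Y)) RB)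
      (Φ : R ≃⋆ₐ[ℂ] cstarPullback (restrictionMap (closedsInclusion inf_le_left) RB)
        (γ.comp (restrictionMap (closedsInclusion inf_le_right) E))),
      Function.Injective γ ∧ IsCXLinear (↥(Y ⊓ Z)) γ ∧
      ∀ (f : C(W, ℂ)) (a : R),
        (Φ (CXAlgebra.act W f a) : RB × E) =
          (CXAlgebra.act Y (restrictFun Y f) (Φ a : RB × E).1,
            CXAlgebra.act Z (restrictFun Z f) (Φ a : RB × E).2) := by
  set jY : C(↥(Y ⊓ Z), Y) := closedsInclusion inf_le_left with hjY
  set jZ : C(↥(Y ⊓ Z), Z) := closedsInclusion inf_le_right with hjZ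
  have hcY : IsClosed (Set.range jY) := (isCompact_range jY.continuous).isClosed
  have hcZ : IsClosed (Set.range jZ) := (isCompact_range jZ.continuous).isClosed
  have memY : ∀ b : RB, restrictionMap jY RB b = 0 ↔ ∀ v, evB (jY v) b = 0 := fun b => by
    rw [restrictionMap, ClosedIdeal.proj_apply, ClosedIdeal.cls_eq_zero,
      hB.mem_vanishingIdeal hA (by fun_prop) hcY]
    simp only [Set.forall_mem_range]
  have memZ : ∀ e : E, e ∈ vanishingIdeal Z E (Set.range jZ) ↔ ∀ v, evE (jZ v) e = 0 := fun e => by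
    rw [hE.mem_vanishingIdeal hA (by fun_prop) hcZ]
    simp only [Set.forall_mem_range]
  -- Sections of the refined algebra are sections of `B`, so over `Y ∩ Z` each `e` is also the
  -- restriction of some `b`. This defines `γ`; injectivity holds because both sides are determined
  -- by the same values.
  have hres : ∀ e : E, ∃ b : RB, ∀ v, evB (jY v) b = evE (jZ v) e := fun e => by
    obtain ⟨c, hc, hc'⟩ := hE.section_of e
    obtain ⟨b, hb⟩ := hB.exists_of c hc.1
    exact ⟨b, fun v => (hb _).trans (hc' (jZ v))⟩
  obtain ⟨ρ, hρ⟩ := exists_starHom_of_range_le (lpHom fun v => evE (jZ v))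
    (lpHom (F := fun v : ↥(Y ⊓ Z) => Fiber X A (i (jZ v))) fun v => evB (jY v)) (restrictionMap jY RB)
    (fun e => (hres e).imp fun b hb => Subtype.ext (funext fun v => hb v))
    fun b hb => (memY b).2 fun v =>
      congrArg (fun s : lp (fun v => Fiber X A (i (jZ v))) ⊤ => s v) hb
  replace hρ : ∀ b e, (∀ v, evB (jY v) b = evE (jZ v) e) → ρ e = restrictionMap jY RB b :=
    fun b e h => hρ b e (Subtype.ext (funext fun v => h v))
  have hρ' : ∀ b e, ρ e = restrictionMap jY RB b → ∀ v, evB (jY v) b = evE (jZ v) e := by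
    intro b e hbe v
    obtain ⟨b', hb'⟩ := hres e
    rw [hρ b' e hb', ← sub_eq_zero, ← map_sub, memY] at hbe
    rw [← hb' v, ← sub_eq_zero, ← neg_sub, ← map_sub, hbe v, neg_zero]
  let γ := (vanishingIdeal Z E (Set.range jZ)).lift ρ fun e he => by
    rw [hρ 0 e fun v => (map_zero _).trans ((memZ e).1 he v).symm, map_zero]
  have hγ : ∀ e, γ (restrictionMap jZ E e) = ρ e := fun e => rfl
  obtain ⟨ΘB, hΘB⟩ := h.exists_hom (k := fun y : Y => (y : W)) (fun b hb => hb.1) hB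
  obtain ⟨ΘE, hΘE⟩ := h.exists_hom (k := fun z : Z => (z : W)) (fun b hb => hb) hE
  have hΘ : ∀ r, ΘB.prod ΘE r ∈ cstarPullback (restrictionMap jY RB) (γ.comp (restrictionMap jZ E)) :=
    fun r => by
      change restrictionMap jY RB (ΘB r) = ρ (ΘE r)
      exact (hρ _ _ fun v => by rw [hΘB, hΘE]; rfl).symm
  have hcover : ∀ w, w ∈ Y ∨ w ∈ Z := fun w => by
    have : i w ∈ S ∪ L.support := hr ▸ Set.mem_range_self w
    rw [← SetLike.mem_coe, ← SetLike.mem_coe, hY, hZ]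
    exact this
  let Θ := NonUnitalStarAlgHom.codRestrict (ΘB.prod ΘE) _ hΘ
  have hbij : Function.Bijective Θ := by
    refine ⟨fun r r' hrr => h.ext fun w => ?_, ?_⟩
    · have h1 : ΘB r = ΘB r' := congrArg (fun p => (Subtype.val p).1) hrr
      have h2 : ΘE r = ΘE r' := congrArg (fun p => (Subtype.val p).2) hrr
      rcases hcover w with hw | hw
      · rw [← hΘB r ⟨w, hw⟩, h1, hΘB]
      · rw [← hΘE r ⟨w, hw⟩, h2, hΘE]
    · rintro ⟨⟨b, e⟩, hbe⟩
      replace hbe : restrictionMap jY RB b = ρ e := hbe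
      have hagree := hρ' b e hbe.symm
      obtain ⟨c, hcB, hc⟩ := hB.section_of b
      obtain ⟨d, hdL, hd⟩ := hE.section_of e
      have hdL' := hdL.1
      classical
      -- Surjectivity: a compatible pair glues to a section of `B`. Over the support it agrees with
      -- `d`, so it satisfies the layer condition.
      obtain ⟨x, hx, hx'⟩ := SubCX.exists_glue hA (B := B)
        (fun o : Bool => bif o then S else L.support)
        (by rintro (_ | _); exacts [L.isClosed_support, hS])
        (fun x => if x ∈ S then fiberMap X A x c else fiberMap X A x d) (by
          rintro (_ | _)
          · refine ⟨d, hdL', fun y hy => ?_⟩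
            replace hy : y ∈ L.support := hy
            split_ifs with hyS
            · obtain ⟨w, rfl⟩ : y ∈ Set.range i := hr ▸ Or.inr hy
              have hwY : w ∈ Y := by rw [← SetLike.mem_coe, hY]; exact hyS
              have hwZ : w ∈ Z := by rw [← SetLike.mem_coe, hZ]; exact hy
              exact (hd ⟨w, hwZ⟩).trans
                ((hagree ⟨w, hwY, hwZ⟩).symm.trans (hc ⟨w, hwY⟩).symm)
            · rfl
          · exact ⟨c, hcB, fun y hy => (if_pos (show y ∈ S from hy)).symm⟩)
      have hx1 : ∀ y ∈ S, fiberMap X A y x = fiberMap X A y c := fun y hy => by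
        rw [hx' true y hy, if_pos hy]
      have hx2 : ∀ w, w ∈ Z → fiberMap X A (i w) x = fiberMap X A (i w) d := fun w hw => by
        by_cases hyS : i w ∈ S
        · have hwY : w ∈ Y := by rw [← SetLike.mem_coe, hY]; exact hyS
          rw [hx1 _ hyS]
          exact (hc ⟨w, hwY⟩).trans ((hagree ⟨w, hwY, hw⟩).trans (hd ⟨w, hw⟩).symm)
        · have hw' : i w ∈ L.support := by rw [← SetLike.mem_coe, hZ] at hw; exact hw
          rw [hx' false _ hw', if_neg hyS]
      have hxL : x ∈ L.refine := ⟨hx, fun k y hy => by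
        have hyL : y ∈ L.support := Set.mem_iUnion.2 ⟨k, hy⟩
        obtain ⟨w, rfl⟩ : y ∈ Set.range i := hr ▸ Or.inr hyL
        have hwZ : w ∈ Z := by rw [← SetLike.mem_coe, hZ]; exact hyL
        rw [hx2 w hwZ]
        exact hdL.2 k _ hy⟩
      obtain ⟨r, hr'⟩ := h.exists_of x hxL
      refine ⟨r, Subtype.ext (Prod.ext (hB.ext fun y => ?_) (hE.ext fun z => ?_))⟩
      · refine (hΘB r y).trans ((hr' y).trans ((hx1 _ ?_).trans (hc y)))
        have := y.2
        rwa [← SetLike.mem_coe, hY] at this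
      · exact (hΘE r z).trans ((hr' z).trans ((hx2 _ z.2).trans (hd z)))
  refine ⟨γ, StarAlgEquiv.ofBijective Θ hbij, ?_, ?_, fun f r => ?_⟩
  · refine ClosedIdeal.lift_injective _ _ _ fun e he => (memZ e).2 fun v => ?_
    exact (hρ' 0 e (by rw [he, map_zero]) v).symm.trans (map_zero _)
  · intro f q
    obtain ⟨e, rfl⟩ := ClosedIdeal.cls_surjective _ q
    obtain ⟨b, hb⟩ := hres e
    change γ (act _ f (restrictionMap jZ E e)) = act _ f (γ (restrictionMap jZ E e))
    rw [act_restriction_cls, hγ, hγ, hρ b e hb, act_restriction_cls]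
    refine hρ _ _ fun v => ?_
    rw [hB.act, hE.act, hb, extendFun_apply, extendFun_apply]
    rfl
  · refine Prod.ext (hB.ext fun y => ?_) (hE.ext fun z => ?_)
    · refine (hΘB _ y).trans ((h.act _ _ _).trans ?_)
      rw [hB.act]
      exact congrArg _ (hΘB r y).symm
    · refine (hΘE _ z).trans ((h.act _ _ _).trans ?_)
      rw [hE.act]
      exact congrArg _ (hΘE r z).symm

/-- Algebras representing sections of a built subalgebra have small category. -/
theorem Built.catLE (hA : IsContinuousCXAlgebra X A) {n : ℕ} {S : Set X} {B : SubCX X A}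
    (hB : Built 𝒞 (n + 1) S B) {W : Type u} [TopologicalSpace W] [CompactSpace W] [T2Space W]
    (i : W → X) (hi : Continuous i) (hinj : Function.Injective i) (hr : Set.range i = S)
    {R : Type u} [NonUnitalCStarAlgebra R] [CXAlgebra W R]
    {ev : ∀ w, R →⋆ₙₐ[ℂ] Fiber X A (i w)} (h : Represents i B R ev) : CatLE 𝒞 n W R := by
  -- The first factor of the pullback lives over a closed subset of `W`, so the base must vary;
  -- hence an arbitrary injective map `i` onto `S`.
  induction n generalizing S B W R with
  | zero =>
    cases hB with
    | succ hB L =>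
      -- With one layer there is nothing underneath but `A` over the empty set, so the algebra is
      -- the elementary one. This is why `n + 1` layers give category `n`.
      cases hB
      obtain ⟨E, _, _, evE, hE, hE'⟩ := L.exists_elementary hA i hi hinj (by simpa using hr)
      exact hE.of_represents hE' h
  | succ n ih =>
    cases hB with
    | @succ _ S' B' hB L =>
      refine Or.inr ?_
      let Y : Closeds W := ⟨i ⁻¹' S', hB.isClosed.preimage hi⟩
      let Z : Closeds W := ⟨i ⁻¹' L.support, L.isClosed_support.preimage hi⟩
      let j : C(Y, X) := ⟨fun y => i y, by fun_prop⟩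
      have hj : Fact (Function.Injective j) := ⟨hinj.comp Subtype.val_injective⟩
      have hRB : Represents (fun y : Y => i y) B' (Restriction j B') (B'.restrictionEval j) :=
        B'.represents_restriction hA j
      obtain ⟨E, _, _, evE, hE, hE'⟩ := L.exists_elementary hA (fun z : Z => i z) (by fun_prop)
        (hinj.comp Subtype.val_injective) (by
          ext y
          constructor
          · rintro ⟨z, rfl⟩; exact z.2
          · intro hy
            obtain ⟨w, rfl⟩ : y ∈ Set.range i := hr ▸ Or.inr hy
            exact ⟨⟨w, hy⟩, rfl⟩)
      obtain ⟨γ, Φ, h1, h2, h3⟩ := L.exists_pullback hA hB.isClosed hi hr Y Z rfl rfl h hRB hE'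
      refine ⟨Y, Z, Restriction j B', E, inferInstance, inferInstance, inferInstance, inferInstance,
        γ, Φ, ?_, ?_, hE, h1, h2, h3⟩
      · change i ⁻¹' S' ∪ i ⁻¹' L.support = Set.univ
        rw [← Set.preimage_union, ← hr, Set.preimage_range]
      · refine ih hB (fun y : Y => i y) (by fun_prop) (hinj.comp Subtype.val_injective) ?_ hRB
        ext y
        constructor
        · rintro ⟨z, rfl⟩; exact z.2
        · intro hy
          obtain ⟨w, rfl⟩ : y ∈ Set.range i := hr ▸ Or.inl hy
          exact ⟨⟨w, hy⟩, rfl⟩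

end Category

/-! ### Covering dimension -/

section Dimension

/-- In a space of covering dimension at most `d`, there are arbitrarily fine finite closed covers
that split into `d + 1` disjoint families. -/
theorem CoveringDimLE.exists_coloured_cover {X : Type u} [TopologicalSpace X] [CompactSpace X]
    [T2Space X] [Nonempty X] {d : ℕ} (hd : CoveringDimLE X d) (O : X → Set X)
    (hO : ∀ x, IsOpen (O x) ∧ x ∈ O x) :
    ∃ (r : ℕ) (_ : 1 ≤ r) (P : Fin (d + 1) → Fin r → Set X), (∀ c i, IsClosed (P c i)) ∧
      (∀ c i j, i ≠ j → Disjoint (P c i) (P c j)) ∧ (∀ c i, ∃ x, P c i ⊆ O x) ∧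
      (⋃ c, ⋃ i, P c i) = Set.univ := by
  classical
  obtain ⟨s, hs⟩ := isCompact_univ.elim_nhds_subcover O fun x _ => (hO x).1.mem_nhds (hO x).2
  obtain ⟨l, V, hVo, hVc, hVU, hVd⟩ := hd s.card (fun i => O (s.equivFin.symm i))
    (fun i => (hO _).1) (Set.eq_univ_of_forall fun x => by
      obtain ⟨p, hp, hx⟩ := Set.mem_iUnion₂.1 (hs.2 (Set.mem_univ x))
      exact Set.mem_iUnion.2 ⟨s.equivFin ⟨p, hp⟩, by simpa using hx⟩)
  obtain ⟨f, hf⟩ := PartitionOfUnity.exists_isSubordinate isClosed_univ V hVo hVc.ge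
  have hfV : ∀ j x, 0 < f j x → x ∈ V j := fun j x h => hf j (subset_tsupport _ h.ne')
  -- Barycentric subdivision: `U S` consists of the points whose coordinates in `S` are positive and
  -- exceed all others. If two such sets of equal size met, some pair of coordinates would be
  -- strictly ordered both ways.
  let U : Finset (Fin l) → Set X := fun S =>
    {x | (1 ≤ S.card ∧ S.card ≤ d + 1) ∧ ∀ i ∈ S, 0 < f i x ∧ ∀ j, j ∉ S → f j x < f i x}
  have hUo : ∀ S, IsOpen (U S) := fun S => by
    have : U S = {x | 1 ≤ S.card ∧ S.card ≤ d + 1} ∩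
        ⋂ i ∈ S, ({x | 0 < f i x} ∩ ⋂ j, ⋂ (_ : j ∉ S), {x | f j x < f i x}) := by
      ext x
      simp [U]
    rw [this]
    refine isOpen_const.inter (isOpen_biInter_finset fun i _ => IsOpen.inter ?_ ?_)
    · exact isOpen_lt continuous_const (f i).continuous
    · exact isOpen_iInter_of_finite fun j => isOpen_iInter_of_finite fun _ =>
        isOpen_lt (f j).continuous (f i).continuous
  have hUc : (⋃ S, U S) = Set.univ := Set.eq_univ_of_forall fun x => by
    refine Set.mem_iUnion.2 ⟨Finset.univ.filter fun j => 0 < f j x, ⟨?_, ?_⟩, fun i hi => ?_⟩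
    · obtain ⟨i, hi⟩ := f.exists_pos (Set.mem_univ x)
      exact Finset.card_pos.2 ⟨i, by simpa using hi⟩
    · refine le_trans ?_ (hVd x)
      rw [Set.ncard_eq_toFinset_card']
      refine Finset.card_le_card fun j hj => ?_
      simpa using hfV j x (by simpa using hj)
    · have hi' : 0 < f i x := by simpa using hi
      refine ⟨hi', fun j hj => lt_of_le_of_lt ?_ hi'⟩
      simpa using hj
  obtain ⟨v, hvc, hv, hvU⟩ := exists_iUnion_eq_closed_subset hUo (fun x => Set.toFinite _) hUc
  let e := (Fintype.equivFin (Finset (Fin l))).symm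
  -- Colour `c` collects the sets `S` of size `c + 1`; the other indices carry the empty set, so
  -- that all colours share one index range.
  refine ⟨Fintype.card (Finset (Fin l)), Fintype.card_pos, fun c i =>
    if (e i).card = c + 1 then v (e i) else ∅, fun c i => ?_, fun c i j hij => ?_, fun c i => ?_,
    Set.eq_univ_of_forall fun x => ?_⟩
  · dsimp only
    split_ifs
    exacts [hv _, isClosed_empty]
  · dsimp only
    split_ifs with h1 h2
    · refine Set.disjoint_left.2 fun x hx hx' => ?_
      have hne : e i ≠ e j := fun h => hij (e.injective h)
      have hcard : (e i).card = (e j).card := h1.trans h2.symm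
      obtain ⟨a, ha, ha'⟩ := Finset.not_subset.1 fun h => hne (Finset.eq_of_subset_of_card_le h hcard.ge)
      obtain ⟨b, hb, hb'⟩ := Finset.not_subset.1 fun h => hne.symm (Finset.eq_of_subset_of_card_le h hcard.le)
      exact lt_asymm (((hvU _ hx).2 a ha).2 b hb') (((hvU _ hx').2 b hb).2 a ha')
    all_goals simp
  · dsimp only
    split_ifs with h1
    · obtain ⟨a, ha⟩ := Finset.card_pos.1 (h1 ▸ Nat.succ_pos c : 0 < (e i).card)
      obtain ⟨k, hk⟩ := hVU a
      exact ⟨_, fun x hx => hk (hfV a x ((hvU _ hx).2 a ha).1)⟩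
    · exact ⟨Classical.arbitrary X, Set.empty_subset _⟩
  · obtain ⟨S, hS⟩ := Set.mem_iUnion.1 (hvc ▸ Set.mem_univ x : x ∈ ⋃ S, v S)
    have hc := (hvU S hS).1
    refine Set.mem_iUnion₂.2 ⟨⟨S.card - 1, by omega⟩, e.symm S, ?_⟩
    rw [if_pos (by rw [Equiv.apply_symm_apply]; simp; omega), Equiv.apply_symm_apply]
    exact hS

theorem exists_coveringDimLE {X : Type u} [TopologicalSpace X] [Nonempty X]
    (hX : coveringDim X < ⊤) :
    ∃ d : ℕ, CoveringDimLE X d ∧ ((d : ℕ∞) : WithBot ℕ∞) ≤ coveringDim X := by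
  classical
  rw [coveringDim, if_neg (not_isEmpty_of_nonempty X)] at hX ⊢
  have h : ∃ n, CoveringDimLE X n := by
    by_contra! h
    simp [h] at hX
  refine ⟨Nat.find h, Nat.find_spec h, WithBot.coe_le_coe.2 ?_⟩
  exact le_iInf₂ fun n hn => by exact_mod_cast Nat.find_min' h hn

end Dimension

/-! ### One-sided approximate intertwinings -/

section Limit

variable {B : ℕ → Type u} [∀ k, NonUnitalCStarAlgebra (B k)] (μ : ∀ k, B k →⋆ₙₐ[ℂ] B (k + 1))

/-- Sequences that follow the connecting maps from the index `k` on. -/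
def IsOrbit (k : ℕ) (x : ∀ m, B m) : Prop := ∀ m, k ≤ m → x (m + 1) = μ m (x m)

variable {μ}

/-- Orbits replace composites of connecting maps between dependent types. The recursion inserts `b`
at index `k`; values below `k` play no role. -/
theorem exists_isOrbit (k : ℕ) (b : B k) : ∃ x, IsOrbit μ k x ∧ x k = b := by
  classical
  let x : ∀ m, B m := fun m => Nat.rec (motive := fun m => B m)
    (if h : k = 0 then cast (congrArg B h) b else 0)
    (fun m y => if h : k = m + 1 then cast (congrArg B h) b else μ m y) m
  refine ⟨x, fun m hm => ?_, ?_⟩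
  · have : k ≠ m + 1 := by omega
    simp only [x, dif_neg this]
  · cases k <;> simp [x]

namespace IsOrbit

variable {k : ℕ} {x y : ∀ m, B m}

theorem add (hx : IsOrbit μ k x) (hy : IsOrbit μ k y) : IsOrbit μ k (x + y) := fun m hm => by
  simp [hx m hm, hy m hm]

theorem sub (hx : IsOrbit μ k x) (hy : IsOrbit μ k y) : IsOrbit μ k (x - y) := fun m hm => by
  simp [hx m hm, hy m hm]

theorem mul (hx : IsOrbit μ k x) (hy : IsOrbit μ k y) : IsOrbit μ k (x * y) := fun m hm => by
  simp [hx m hm, hy m hm]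

theorem smul (c : ℂ) (hx : IsOrbit μ k x) : IsOrbit μ k (c • x) := fun m hm => by
  simp [hx m hm]

theorem star (hx : IsOrbit μ k x) : IsOrbit μ k (star x) := fun m hm => by
  simp [hx m hm, map_star]

theorem norm_le (hx : IsOrbit μ k x) {m : ℕ} (hm : k ≤ m) : ‖x m‖ ≤ ‖x k‖ := by
  induction m, hm using Nat.le_induction with
  | base => exact le_rfl
  | succ m hm ih => rw [hx m hm]; exact (starHom_norm_le _ _).trans ih

theorem apply_eq {D : Type u} [NonUnitalCStarAlgebra D] {ψ : ∀ k, B k →⋆ₙₐ[ℂ] D}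
    (hψ : ∀ k, (ψ (k + 1)).comp (μ k) = ψ k) (hx : IsOrbit μ k x) {m : ℕ} (hm : k ≤ m) :
    ψ m (x m) = ψ k (x k) := by
  induction m, hm using Nat.le_induction with
  | base => rfl
  | succ m hm ih => rw [hx m hm, ← ih, ← hψ m]; rfl

end IsOrbit

/-- A limit of a sequence of C⋆-algebras is detected by density of the images and the norm formula. -/
theorem isCStarInductiveLimit_of_dense {A : Type u} [NonUnitalCStarAlgebra A]
    {φ : ∀ k, B k →⋆ₙₐ[ℂ] A} (hφ : ∀ k, (φ (k + 1)).comp (μ k) = φ k)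
    (hdense : Dense (⋃ k, Set.range (φ k)))
    (hnorm : ∀ k x, IsOrbit μ k x → ∀ ε > 0, ∃ m ≥ k, ‖x m‖ < ‖φ k (x k)‖ + ε) :
    IsCStarInductiveLimit μ φ := by
  refine ⟨hφ, fun D _ ψ hψ => ?_⟩
  have hle : ∀ k b, ‖ψ k b‖ ≤ ‖φ k b‖ := fun k b => by
    refine le_of_forall_pos_le_add fun ε hε => ?_
    obtain ⟨x, hx, rfl⟩ := exists_isOrbit (μ := μ) k b
    obtain ⟨m, hm, h⟩ := hnorm k x hx ε hε
    rw [← hx.apply_eq hψ hm]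
    exact (starHom_norm_le _ _).trans h.le
  -- The map to `D` is defined by the closure of this graph. There the second coordinate is
  -- dominated by the first, and the first projection is onto since its range is closed and dense.
  let G : Set (A × D) := {p | ∃ k b, p = (φ k b, ψ k b)}
  have hcommon : ∀ p ∈ G, ∀ q ∈ G, ∃ k b c, p = (φ k b, ψ k b) ∧ q = (φ k c, ψ k c) := by
    rintro _ ⟨k, b, rfl⟩ _ ⟨l, c, rfl⟩
    obtain ⟨x, hx, rfl⟩ := exists_isOrbit (μ := μ) k b
    obtain ⟨y, hy, rfl⟩ := exists_isOrbit (μ := μ) l c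
    refine ⟨max k l, x _, y _, ?_, ?_⟩
    · rw [hx.apply_eq hψ (le_max_left _ _), hx.apply_eq hφ (le_max_left _ _)]
    · rw [hy.apply_eq hψ (le_max_right _ _), hy.apply_eq hφ (le_max_right _ _)]
  let Γ₀ : NonUnitalStarSubalgebra ℂ (A × D) :=
    { carrier := G
      add_mem' := fun {p q} hp hq => by
        obtain ⟨k, b, c, rfl, rfl⟩ := hcommon p hp q hq
        exact ⟨k, b + c, by simp⟩
      zero_mem' := ⟨0, 0, by simp; rfl⟩
      mul_mem' := fun {p q} hp hq => by
        obtain ⟨k, b, c, rfl, rfl⟩ := hcommon p hp q hq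
        exact ⟨k, b * c, by simp⟩
      smul_mem' := by
        rintro z _ ⟨k, b, rfl⟩
        exact ⟨k, z • b, by simp⟩
      star_mem' := by
        rintro _ ⟨k, b, rfl⟩
        exact ⟨k, star b, by simp only [map_star]; rfl⟩ }
  let Γ := Γ₀.topologicalClosure
  have hΓc : IsClosed (Γ : Set (A × D)) := NonUnitalStarSubalgebra.isClosed_topologicalClosure _
  have hGΓ : ∀ k b, (φ k b, ψ k b) ∈ Γ := fun k b =>
    NonUnitalStarSubalgebra.le_topologicalClosure Γ₀ ⟨k, b, rfl⟩
  let _ : NonUnitalCStarAlgebra Γ := NonUnitalStarSubalgebra.nonUnitalCStarAlgebra (h_closed := hΓc) Γ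
  let p₁ : Γ →⋆ₙₐ[ℂ] A := (NonUnitalStarAlgHom.fst ℂ A D).comp (NonUnitalStarSubalgebraClass.subtype Γ)
  let p₂ : Γ →⋆ₙₐ[ℂ] D := (NonUnitalStarAlgHom.snd ℂ A D).comp (NonUnitalStarSubalgebraClass.subtype Γ)
  have hp : ∀ g : Γ, ‖p₂ g‖ ≤ ‖p₁ g‖ := by
    have hc : IsClosed {p : A × D | ‖p.2‖ ≤ ‖p.1‖} := isClosed_le (by fun_prop) (by fun_prop)
    rintro ⟨p, hp⟩
    refine closure_minimal ?_ hc (show p ∈ closure G from hp)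
    rintro _ ⟨k, b, rfl⟩
    exact hle k b
  have hsurj : ∀ a, ∃ g, p₁ g = a := by
    have : Set.range p₁ = Set.univ := by
      rw [← (isClosed_range_starHom p₁).closure_eq]
      refine (hdense.mono ?_).closure_eq
      exact Set.iUnion_subset fun k => by
        rintro _ ⟨b, rfl⟩
        exact ⟨⟨_, hGΓ k b⟩, rfl⟩
    exact fun a => Set.range_eq_univ.1 this a
  obtain ⟨σ, hσ⟩ := exists_starHom_of_range_le (NonUnitalStarAlgHom.id ℂ A) p₁ p₂ hsurj
    fun g hg => norm_le_zero_iff.1 ((hp g).trans (by rw [hg, norm_zero]))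
  have hσφ : ∀ k, σ.comp (φ k) = ψ k := fun k => NonUnitalStarAlgHom.ext fun b =>
    hσ ⟨_, hGΓ k b⟩ _ rfl
  refine ⟨σ, hσφ, fun τ hτ => NonUnitalStarAlgHom.ext fun a => ?_⟩
  have hc : IsClosed {a | τ a = σ a} := isClosed_eq (starHom_continuous τ) (starHom_continuous σ)
  refine closure_minimal ?_ hc (hdense a)
  refine Set.iUnion_subset fun k => ?_
  rintro _ ⟨b, rfl⟩
  exact (DFunLike.congr_fun (hτ k) b).trans (DFunLike.congr_fun (hσφ k) b).symm

/-- One-sided approximate intertwining: the inductive limit of subalgebras of `A` along maps that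
are eventually close to the inclusions. -/
theorem exists_limit_maps {A : Type u} [NonUnitalCStarAlgebra A] (ι : ∀ k, B k →⋆ₙₐ[ℂ] A)
    (hι : ∀ k b, ‖ι k b‖ = ‖b‖) (K : ∀ k, Set (B k)) (hK : ∀ k, ∀ t ∈ K k, μ k t ∈ K (k + 1))
    (hKμ : ∀ k, ∀ t ∈ K k, ‖ι (k + 1) (μ k t) - ι k t‖ ≤ (1 / 2) ^ k)
    (hKd : ∀ k (b : B k), ∀ ε > 0, ∃ t ∈ K k, ∃ c : ℂ, ‖b - c • t‖ < ε)
    (hdense : ∀ a, ∀ ε > 0, ∀ N, ∃ k ≥ N, ∃ t ∈ K k, ‖a - ι k t‖ < ε) :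
    ∃ φ : ∀ k, B k →⋆ₙₐ[ℂ] A, IsCStarInductiveLimit μ φ ∧
      ∀ k x, IsOrbit μ k x → Tendsto (fun m => ι m (x m)) atTop (𝓝 (φ k (x k))) := by
  have hcauchyK : ∀ k x, IsOrbit μ k x → x k ∈ K k →
      ∃ a, Tendsto (fun m => ι m (x m)) atTop (𝓝 a) ∧ ‖ι k (x k) - a‖ ≤ 2 * (1 / 2) ^ k := by
    intro k x hx hxk
    have h1 : ∀ n, x (k + n) ∈ K (k + n) := fun n => by
      induction n with
      | zero => exact hxk
      | succ n ih =>
        rw [← add_assoc, hx _ (Nat.le_add_right _ _)]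
        exact hK _ _ ih
    have h2 : ∀ n, dist (ι (k + n) (x (k + n))) (ι (k + (n + 1)) (x (k + (n + 1)))) ≤
        (1 / 2) ^ k * (1 / 2) ^ n := fun n => by
      rw [dist_comm, dist_eq_norm, ← pow_add, ← add_assoc, hx _ (Nat.le_add_right _ _)]
      exact hKμ _ _ (h1 n)
    obtain ⟨a, ha⟩ := cauchySeq_tendsto_of_complete (cauchySeq_of_le_geometric _ _ (by norm_num) h2)
    have h3 := dist_le_of_le_geometric_of_tendsto₀ _ _ (by norm_num) h2 ha
    refine ⟨a, ?_, ?_⟩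
    · exact (tendsto_add_atTop_iff_nat (f := fun m => ι m (x m)) k).1
        (ha.congr fun n => congrArg (fun m => ι m (x m)) (add_comm k n))
    · rw [dist_eq_norm] at h3
      refine h3.trans (le_of_eq ?_)
      ring
  have hlim : ∀ k x, IsOrbit μ k x → ∃ a, Tendsto (fun m => ι m (x m)) atTop (𝓝 a) := by
    intro k x hx
    refine cauchySeq_tendsto_of_complete (Metric.cauchySeq_iff.2 fun ε hε => ?_)
    -- Only orbits starting in `K k` converge at a geometric rate. Multiples of these are dense and
    -- orbits do not increase norms, so the other orbits are Cauchy too.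
    obtain ⟨t, ht, c, htc⟩ := hKd k (x k) (ε / 3) (by positivity)
    obtain ⟨y, hy, rfl⟩ := exists_isOrbit (μ := μ) k t
    obtain ⟨a, ha, -⟩ := hcauchyK k y hy ht
    have h1 : CauchySeq fun m => ι m ((c • y) m) := by
      have := (ha.const_smul c).cauchySeq
      exact (funext fun m => map_smul (ι m) c (y m) : (fun m => ι m ((c • y) m)) = fun m => c • ι m (y m)) ▸ this
    obtain ⟨N, hN⟩ := Metric.cauchySeq_iff.1 h1 (ε / 3) (by positivity)
    have h2 : ∀ m ≥ k, dist (ι m (x m)) (ι m ((c • y) m)) < ε / 3 := fun m hm => by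
      rw [dist_eq_norm, ← map_sub, hι]
      exact ((hx.sub (hy.smul c)).norm_le hm).trans_lt htc
    refine ⟨max N k, fun m hm n hn => ?_⟩
    have e1 := h2 m ((le_max_right _ _).trans hm)
    have e2 := h2 n ((le_max_right _ _).trans hn)
    have e3 := hN m ((le_max_left _ _).trans hm) n ((le_max_left _ _).trans hn)
    rw [dist_comm] at e2
    have e4 := dist_triangle4 (ι m (x m)) (ι m ((c • y) m)) (ι n ((c • y) n)) (ι n (x n))
    linarith
  have hφ : ∀ k, ∃ φ : B k →⋆ₙₐ[ℂ] A, ∀ x, IsOrbit μ k x →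
      Tendsto (fun m => ι m (x m)) atTop (𝓝 (φ (x k))) := fun k => by
    obtain ⟨φ, hφ⟩ := exists_starHom_of_rel
      (fun b a => ∃ x, IsOrbit μ k x ∧ x k = b ∧ Tendsto (fun m => ι m (x m)) atTop (𝓝 a))
      (fun b => by
        obtain ⟨x, hx, rfl⟩ := exists_isOrbit (μ := μ) k b
        obtain ⟨a, ha⟩ := hlim k x hx
        exact ⟨a, x, hx, rfl, ha⟩)
      (by
        rintro _ _ a a' ⟨x, hx, rfl, ha⟩ ⟨y, hy, rfl, ha'⟩
        exact ⟨x + y, hx.add hy, rfl, by simpa using ha.add ha'⟩)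
      (by
        rintro c _ a ⟨x, hx, rfl, ha⟩
        exact ⟨c • x, hx.smul c, rfl, by simpa using ha.const_smul c⟩)
      (by
        rintro _ _ a a' ⟨x, hx, rfl, ha⟩ ⟨y, hy, rfl, ha'⟩
        exact ⟨x * y, hx.mul hy, rfl, by simpa using ha.mul ha'⟩)
      (by
        rintro _ a ⟨x, hx, rfl, ha⟩
        exact ⟨star x, hx.star, rfl, by simpa [map_star] using ha.star⟩)
      (by
        rintro a ⟨x, hx, h0, ha⟩
        refine tendsto_nhds_unique ha (tendsto_const_nhds.congr' ?_)
        filter_upwards [eventually_ge_atTop k] with m hm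
        have := hx.norm_le hm
        rw [h0, norm_zero, norm_le_zero_iff] at this
        rw [this, map_zero])
    refine ⟨φ, fun x hx => ?_⟩
    obtain ⟨a, ha⟩ := hlim k x hx
    rwa [(hφ (x k) a).1 ⟨x, hx, rfl, ha⟩]
  choose φ hφ using hφ
  refine ⟨φ, isCStarInductiveLimit_of_dense (fun k => ?_) ?_ ?_, hφ⟩
  · refine NonUnitalStarAlgHom.ext fun b => ?_
    obtain ⟨x, hx, rfl⟩ := exists_isOrbit (μ := μ) k b
    refine tendsto_nhds_unique ?_ (hφ k x hx)
    have := hφ (k + 1) x fun m hm => hx m (by omega)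
    rwa [hx k le_rfl] at this
  · refine Metric.dense_iff.2 fun a ε hε => ?_
    -- For `t` in `K k` the limit map moves `t` by at most `2 (1 / 2) ^ k`, which is below `ε / 2`
    -- once `k ≥ N`.
    obtain ⟨N, hN⟩ := exists_pow_lt_of_lt_one (show 0 < ε / 4 by positivity)
      (show (1 / 2 : ℝ) < 1 by norm_num)
    obtain ⟨k, hk, t, ht, hat⟩ := hdense a (ε / 2) (by positivity) N
    obtain ⟨x, hx, rfl⟩ := exists_isOrbit (μ := μ) k t
    obtain ⟨b, hb, hb'⟩ := hcauchyK k x hx ht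
    refine ⟨φ k (x k), ?_, Set.mem_iUnion.2 ⟨k, _, rfl⟩⟩
    rw [tendsto_nhds_unique hb (hφ k x hx)] at hb'
    rw [Metric.mem_ball', dist_eq_norm]
    have e1 : (1 / 2 : ℝ) ^ k ≤ (1 / 2) ^ N := pow_le_pow_of_le_one (by norm_num) (by norm_num) hk
    have e2 := norm_sub_le_norm_sub_add_norm_sub a (ι k (x k)) (φ k (x k))
    linarith
  · intro k x hx ε hε
    have h1 := (hφ k x hx).norm.eventually_lt_const (lt_add_of_pos_right ‖φ k (x k)‖ hε)
    obtain ⟨m, h, hm⟩ := (h1.and (eventually_ge_atTop k)).exists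
    exact ⟨m, hm, by rwa [hι] at h⟩

/-- A separable normed space contains a compact set whose multiples are dense. -/
theorem exists_compact_smul_dense (E : Type*) [NormedAddCommGroup E] [NormedSpace ℂ E]
    [TopologicalSpace.SeparableSpace E] :
    ∃ K : Set E, IsCompact K ∧ ∀ (b : E), ∀ ε > 0, ∃ t ∈ K, ∃ c : ℂ, ‖b - c • t‖ < ε := by
  let v := TopologicalSpace.denseSeq E
  -- Dividing a dense sequence by these scalars makes it converge to zero, so together with its
  -- limit it is compact.
  let c : ℕ → ℝ := fun n => (n + 1) * (1 + ‖v n‖)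
  have hc : ∀ n, 0 < c n := fun n => by positivity
  have ht : Tendsto (fun n => ((c n : ℂ))⁻¹ • v n) atTop (𝓝 0) := by
    refine squeeze_zero_norm (fun n => ?_) tendsto_one_div_add_atTop_nhds_zero_nat
    rw [norm_smul, norm_inv, Complex.norm_real, Real.norm_of_nonneg (hc n).le, inv_mul_le_iff₀ (hc n)]
    have : c n * (1 / ((n : ℝ) + 1)) = 1 + ‖v n‖ := by simp only [c]; field_simp
    rw [this]; linarith
  refine ⟨_, ht.isCompact_insert_range, fun b ε hε => ?_⟩
  obtain ⟨n, hn⟩ := (TopologicalSpace.denseRange_denseSeq E).exists_dist_lt b hε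
  refine ⟨_, Set.mem_insert_of_mem _ ⟨n, rfl⟩, (c n : ℂ), ?_⟩
  rw [smul_inv_smul₀ (by exact_mod_cast (hc n).ne'), ← dist_eq_norm]
  exact hn

end Limit

/-! ### The approximating sequence -/

section Main

open CXAlgebra

variable {X : Type u} [TopologicalSpace X] [CompactSpace X] [T2Space X]
  {A : Type u} [NonUnitalCStarAlgebra A] [CXAlgebra X A] {𝒞 : CStarClass.{u}}

theorem exists_built_univ [FirstCountableTopology X] [Nonempty X] (hA : IsContinuousCXAlgebra X A)
    (h𝒞 : ∀ (D : Type u) [NonUnitalCStarAlgebra D], 𝒞 D → IsSumOfSemiprojectiveSimple D)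
    (hfib : ∀ x : X, HasExhaustiveSequence 𝒞 (Fiber X A x)) {d : ℕ} (hd : CoveringDimLE X d)
    (F : Finset A) {ε : ℝ} (hε : 0 < ε) :
    ∃ B : SubCX X A, Built 𝒞 (d + 1) Set.univ B ∧ ∀ a ∈ F, ∃ b ∈ B, ‖a - b‖ < ε := by
  obtain ⟨O, hO, H⟩ := exists_built hA h𝒞 hfib (d + 1) F (half_pos hε)
  obtain ⟨r, hr, P, h1, h2, h3, h4⟩ := hd.exists_coloured_cover O hO
  obtain ⟨Y, B, hB, hY, hF⟩ := H r hr P h1 h2 h3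
  obtain rfl := hY.trans h4
  refine ⟨B, hB, fun a ha => ?_⟩
  obtain ⟨b, hb, h⟩ := SubCX.exists_approx_of_fiberwise hA isClosed_univ a fun y _ => hF a ha y
  refine ⟨b, hb, (norm_le_of_fiberMap (X := X) (half_pos hε).le fun x => ?_).trans_lt
    (half_lt_self hε)⟩
  rw [map_sub]; exact h x trivial

/-- The fiberwise maps assemble into a map to `B'` because their values are sections over all of
`X`. It is `C(X)`-linear because `f b - f(x) b` vanishes at `x`. A finite net passes from finite to
compact sets, as ⋆-homomorphisms are contractive. -/
theorem Built.exists_hom (hA : IsContinuousCXAlgebra X A)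
    (h𝒞 : ∀ (D : Type u) [NonUnitalCStarAlgebra D], 𝒞 D → IsSumOfSemiprojectiveSimple D)
    {n : ℕ} {B : SubCX X A} (h : Built 𝒞 n Set.univ B) {K : Set B} (hK : IsCompact K) {ε : ℝ}
    (hε : 0 < ε) :
    ∃ (G : Finset A) (δ : ℝ), 0 < δ ∧ ∀ B' : SubCX X A, (∀ a ∈ G, ∃ b ∈ B', ‖a - b‖ < δ) →
      ∃ μ : B →⋆ₙₐ[ℂ] B', IsCXLinear X μ ∧ ∀ t ∈ K, ‖(μ t : A) - t‖ ≤ ε := by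
  obtain ⟨S, -, hS, hSK⟩ := hK.finite_cover_balls (show 0 < ε / 3 by positivity)
  obtain ⟨G, δ, hδ, H⟩ := h.exists_approx_hom hA h𝒞 hS.toFinset (show 0 < ε / 3 by positivity)
  refine ⟨G, δ, hδ, fun B' hB' => ?_⟩
  obtain ⟨m, hm, hm0, hmS⟩ := H B' hB'
  obtain ⟨μ, hμ⟩ := exists_starHom_of_range_le (lpHom m)
    (lpHom fun x => (fiberMap X A x).comp B'.incl) (NonUnitalStarAlgHom.id ℂ B')
    (fun b => by
      obtain ⟨c, hc, h⟩ := hm b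
      exact ⟨⟨c, hc⟩, Subtype.ext (funext fun x => h x trivial)⟩)
    fun b hb => Subtype.ext (eq_zero_of_fiberMap_eq_zero (X := X) fun x =>
      congrArg (fun s : lp (fun x => Fiber X A x) ⊤ => s x) hb)
  have hμm : ∀ b x, fiberMap X A x (μ b : A) = m x b := fun b x => by
    obtain ⟨c, hc, h⟩ := hm b
    rw [hμ ⟨c, hc⟩ b (Subtype.ext (funext fun x => h x trivial))]
    exact h x trivial
  refine ⟨μ, fun f b => Subtype.ext ?_, fun t ht => ?_⟩
  · rw [← sub_eq_zero]
    refine eq_zero_of_fiberMap_eq_zero (X := X) fun x => ?_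
    rw [map_sub, hμm, SubCX.coe_act, fiberMap_act, hμm, ← map_smul, ← map_sub]
    refine hm0 x trivial _ ?_
    change fiberMap X A x (act X f (b : A) - f x • (b : A)) = 0
    rw [map_sub, fiberMap_act, map_smul, sub_self]
  · obtain ⟨s, hs, hts⟩ := Set.mem_iUnion₂.1 (hSK ht)
    rw [Metric.mem_ball, dist_eq_norm] at hts
    have e1 : ‖(μ s : A) - s‖ ≤ ε / 3 := norm_le_of_fiberMap (X := X) (by positivity) fun x => by
      rw [map_sub, hμm]
      exact hmS s (by simpa using hs) x trivial
    have e2 : ‖(μ t : A) - μ s‖ < ε / 3 := by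
      have := (starHom_norm_le μ (t - s)).trans_lt hts
      rwa [map_sub] at this
    have e3 : ‖(s : A) - t‖ < ε / 3 := by rw [norm_sub_rev]; exact hts
    have e4 := norm_sub_le_norm_sub_add_norm_sub (μ t : A) (μ s) t
    have e5 := norm_sub_le_norm_sub_add_norm_sub (μ s : A) s t
    linarith

/-- A built subalgebra of `A` together with a compact subset whose multiples are dense. -/
structure Stage (𝒞 : CStarClass.{u}) (X : Type u) [TopologicalSpace X] [CompactSpace X] [T2Space X]
    (A : Type u) [NonUnitalCStarAlgebra A] [CXAlgebra X A] (n : ℕ) where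
  B : SubCX X A
  built : Built 𝒞 n Set.univ B
  K : Set B
  isCompact : IsCompact K
  dense : ∀ (b : B), ∀ ε > 0, ∃ t ∈ K, ∃ c : ℂ, ‖b - c • t‖ < ε

theorem SubCX.exists_compact [TopologicalSpace.SeparableSpace A] (B : SubCX X A) :
    ∃ K : Set B, IsCompact K ∧ ∀ (b : B), ∀ ε > 0, ∃ t ∈ K, ∃ c : ℂ, ‖b - c • t‖ < ε := by
  have : TopologicalSpace.SeparableSpace B :=
    (TopologicalSpace.IsSeparable.of_separableSpace (B : Set A)).separableSpace
  exact exists_compact_smul_dense B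

/-- The requirements `G`, `δ` for mapping out of `s.B` are known before the next algebra is built,
so it can be chosen to meet them. Its compact set is enlarged by the image of the old one and by
approximants of `F`. -/
theorem Stage.exists_next [FirstCountableTopology X] [Nonempty X]
    [TopologicalSpace.SeparableSpace A] (hA : IsContinuousCXAlgebra X A)
    (h𝒞 : ∀ (D : Type u) [NonUnitalCStarAlgebra D], 𝒞 D → IsSumOfSemiprojectiveSimple D)
    (hfib : ∀ x : X, HasExhaustiveSequence 𝒞 (Fiber X A x)) {d : ℕ} (hd : CoveringDimLE X d)
    (s : Stage 𝒞 X A (d + 1)) (F : Finset A) {ε : ℝ} (hε : 0 < ε) :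
    ∃ (s' : Stage 𝒞 X A (d + 1)) (μ : s.B →⋆ₙₐ[ℂ] s'.B), IsCXLinear X μ ∧
      (∀ t ∈ s.K, ‖(μ t : A) - t‖ ≤ ε) ∧ (∀ t ∈ s.K, μ t ∈ s'.K) ∧
      ∀ a ∈ F, ∃ t ∈ s'.K, ‖a - t‖ < ε := by
  classical
  obtain ⟨G, δ, hδ, H⟩ := s.built.exists_hom hA h𝒞 s.isCompact hε
  obtain ⟨B, hB, hF⟩ := exists_built_univ hA h𝒞 hfib hd (F ∪ G) (lt_min hε hδ)
  obtain ⟨μ, hμ, hμs⟩ := H B fun a ha => (hF a (Finset.mem_union_right _ ha)).imp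
    fun b hb => ⟨hb.1, hb.2.trans_le (min_le_right _ _)⟩
  obtain ⟨K, hK, hK'⟩ := B.exists_compact
  have h1 : ∀ a, ∃ b : B, a ∈ F → ‖a - b‖ < ε := fun a => by
    by_cases ha : a ∈ F
    · obtain ⟨b, hb, h⟩ := hF a (Finset.mem_union_left _ ha)
      exact ⟨⟨b, hb⟩, fun _ => h.trans_le (min_le_left _ _)⟩
    · exact ⟨0, fun h => absurd h ha⟩
  choose c hc using h1
  refine ⟨⟨B, hB, K ∪ (μ '' s.K ∪ F.image c), hK.union ((s.isCompact.image (starHom_continuous μ)).union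
    (Finset.finite_toSet _).isCompact), fun b ε hε => ?_⟩, μ, hμ, hμs,
    fun t ht => Or.inr (Or.inl ⟨t, ht, rfl⟩), fun a ha => ⟨c a, Or.inr (Or.inr ?_), hc a ha⟩⟩
  · obtain ⟨t, ht, h⟩ := hK' b ε hε
    exact ⟨t, Or.inl ht, h⟩
  · exact Finset.mem_coe.2 (Finset.mem_image_of_mem _ ha)

end Main

theorem mainTheorem11 (𝒞 : CStarClass.{u})
    (h𝒞 : ∀ (D : Type u) [NonUnitalCStarAlgebra D], 𝒞 D → IsSumOfSemiprojectiveSimple D)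
    (X : Type u) [TopologicalSpace X] [CompactSpace X] [T2Space X]
    [TopologicalSpace.MetrizableSpace X] [Nonempty X] (hX : coveringDim X < ⊤)
    (A : Type u) [NonUnitalCStarAlgebra A] [TopologicalSpace.SeparableSpace A] [CXAlgebra X A]
    (hA : IsContinuousCXAlgebra X A)
    (hfib : ∀ x : X, HasExhaustiveSequence 𝒞 (Fiber X A x)) :
    ∃ (B : ℕ → Type u) (_ : ∀ k, NonUnitalCStarAlgebra (B k)) (_ : ∀ k, CXAlgebra X (B k))
      (μ : ∀ k, B k →⋆ₙₐ[ℂ] B (k + 1)) (φ : ∀ k, B k →⋆ₙₐ[ℂ] A),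
      (∀ k, IsContinuousCXAlgebra X (B k)) ∧
      (∀ k, ((cat 𝒞 X (B k) : ℕ∞) : WithBot ℕ∞) ≤ coveringDim X) ∧
      (∀ k, IsCXLinear X (μ k)) ∧
      (∀ k, IsCXLinear X (φ k)) ∧
      IsCStarInductiveLimit μ φ := by
  classical
  obtain ⟨d, hd, hdX⟩ := exists_coveringDimLE hX
  let a := TopologicalSpace.denseSeq A
  choose next ν hν hνK hνK' hνa using fun (s : Stage 𝒞 X A (d + 1)) (k : ℕ) =>
    s.exists_next hA h𝒞 hfib hd ((Finset.range k).image a) (show (0 : ℝ) < (1 / 2) ^ k by positivity)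
  obtain ⟨B₀, hB₀, -⟩ := exists_built_univ hA h𝒞 hfib hd ∅ one_pos
  obtain ⟨K₀, hK₀, hK₀'⟩ := B₀.exists_compact
  let s : ℕ → Stage 𝒞 X A (d + 1) := fun k => Nat.rec ⟨B₀, hB₀, K₀, hK₀, hK₀'⟩ (fun k s => next s k) k
  let μ : ∀ k, (s k).B →⋆ₙₐ[ℂ] (s (k + 1)).B := fun k => ν (s k) k
  obtain ⟨φ, hφ, hφx⟩ := exists_limit_maps (μ := μ) (fun k => (s k).B.incl) (fun k b => rfl)
    (fun k => (s k).K) (fun k => hνK' (s k) k) (fun k => hνK (s k) k) (fun k => (s k).dense)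
    fun x ε hε N => by
      obtain ⟨n, hn⟩ := (TopologicalSpace.denseRange_denseSeq A).exists_dist_lt x (half_pos hε)
      obtain ⟨M, hM⟩ := exists_pow_lt_of_lt_one (half_pos hε) (show (1 / 2 : ℝ) < 1 by norm_num)
      -- The step from stage `k` approximates the terms of the dense sequence with index below `k`,
      -- whence `n + 1`.
      let k := max N (max M (n + 1))
      obtain ⟨t, ht, h⟩ := hνa (s k) k (a n) (Finset.mem_image_of_mem _ (Finset.mem_range.2
        (lt_of_lt_of_le (Nat.lt_succ_self n) ((le_max_right _ _).trans (le_max_right _ _)))))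
      refine ⟨k + 1, (le_max_left _ _).trans (Nat.le_succ _), t, ht, ?_⟩
      have e1 : (1 / 2 : ℝ) ^ k ≤ (1 / 2) ^ M := pow_le_pow_of_le_one (by norm_num) (by norm_num)
        ((le_max_left _ _).trans (le_max_right _ _))
      rw [dist_eq_norm] at hn
      have e2 := norm_sub_le_norm_sub_add_norm_sub x (a n) (t : A)
      change ‖x - (t : A)‖ < ε
      linarith
  refine ⟨fun k => (s k).B, fun k => inferInstance, fun k => inferInstance, μ, φ,
    fun k => (s k).B.isContinuous hA, fun k => ?_, fun k => hν (s k) k, fun k f b => ?_, hφ⟩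
  · refine le_trans (WithBot.coe_le_coe.2 ?_) hdX
    exact iInf₂_le d ((s k).built.catLE hA (fun x : X => x) continuous_id Function.injective_id
      Set.range_id (s k).B.represents)
  · obtain ⟨x, hx, rfl⟩ := exists_isOrbit (μ := μ) k b
    -- Linear connecting maps carry orbits to orbits under the action of `f`, so linearity of `φ`
    -- follows by passing to limits.
    have hx' : IsOrbit μ k fun m => CXAlgebra.act X f (x m) := fun m hm => by
      dsimp only
      rw [hx m hm]
      exact (hν (s m) m f (x m)).symm
    exact tendsto_nhds_unique (hφx k _ hx')
      (((CXAlgebra.continuous_act X f).tendsto _).comp (hφx k x hx))
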